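/- **Setting.** Let $V:\mathbb R^3\to[0,\infty)$ be smooth, even and rapidly decreasing. Let $w$ be the $C^2$ function with $-\Delta(1-w)+V(1-w)=0$, $0\le w<1$ and $w(x)\to0$ as $|x|\to\infty$. Put $g=V(1-w)$, $g_p=\int_{\mathbb R^3}e^{-ip\cdot x}g(x)\,dx$ (a real number), $g_0=\int g=4\pi a$ with $a$ the scattering length of $V$, and $w_p=g_p/p^2$ for $p\ne0$ (the Fourier transform of $w$). For small $\rho>0$ let $L=\rho^{-25/24}$, $\Lambda=[0,L]^3$ with periodic boundary conditions, $N=\rho|\Lambda|$ (integer part, if this is not an integer), $\Lambda^*=(\tfrac{2\pi}{L}\mathbb Z)^3$, $\eta=\tfrac1{200}$, $\varepsilon_L=\eta_L=\varepsilon_H=\rho^{\eta}$, $m_c=\rho^{-\eta}$, and define the subsets $P_0=\{0\}$ and $$P_L=\{\varepsilon_L\rho^{1/2}\le|p|\le\eta_L^{-1}\rho^{1/2}\},\quad P_I=\{\eta_L^{-1}\rho^{1/2}<|p|\le\varepsilon_H\},\quad P_H=\{\varepsilon_H<|p|\}$$ of $\Lambda^*$, and $P=P_0\cup P_L\cup P_I\cup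 P_H$. Let $\widetilde M$ be the set of all $\alpha:P\to\{0,1,2,\dots\}$ with $\sum_{k}\alpha(k)=N$, and let $|\alpha\rangle$ be the normalized state with occupation numbers $\alpha$. For $\alpha\in\widetilde M$ let $\mathcal A^{k}\alpha$ be obtained from $\alpha$ by removing two particles of momentum $0$ and adding one of momentum $k$ and one of momentum $-k$. For $u\in P_L$ and $\pm k+u/2\in P_H$ let $\mathcal A^{u,k}\alpha$ be obtained by removing one particle of momentum $0$ and one of momentum $u$ and adding one of momentum $k+u/2$ and one of momentum $-k+u/2$. For $k_c\in\mathbb R$ let $M\subset\widetilde M$ be the smallest set such that 1. $M$ contains the configuration with all $N$ particles at momentum $0$; 2. if $\alpha\in M$, $u\in P_I\cup P_H$ and $\mathcal A^u\alpha\in\widetilde M$, then $\mathcal A^u\alpha\in M$; 3. if $\alpha\in M$, $u\in P_L$, $\max\{\alpha(u),\alpha(-u)\}<m_c$ and $\mathcal A^u\alpha\in\widetilde M$, then $\mathcal A^u\alpha\in M$; 4. if $\alpha\in M$, $u\in P_L$, $\alpha(u)=\alpha(-u)$, $\pm k+u/2\in P_H$, $\varepsilon_H\le|\pm k+u/2|\le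 k_c$ and $\mathcal A^{u,k}\alpha\in\widetilde M$, then $\mathcal A^{u,k}\alpha\in M$. Put $\lambda_k=\dfrac{1-\sqrt{1+4\rho g_0|k|^{-2}}}{1+\sqrt{1+4\rho g_0|k|^{-2}}}\,\rho^{-1}$ for $k\in P_L$, $\lambda_k=-w_k$ for $k\in P_I\cup P_H$, and $\alpha^*(u)=\max\{\alpha(u),\alpha(-u)\}$. The trial state is $\Psi=\sum_{\alpha\in M}f(\alpha)|\alpha\rangle$ with $$f(\alpha)=C_N\sqrt{\frac{|\Lambda|^{\alpha(0)}}{\alpha(0)!}}\ \prod_{k\ne0}\bigl(\sqrt{\lambda_k}\bigr)^{\alpha(k)}\prod_{u\in P_L,\ \alpha^*(u)-\alpha(u)=1}\sqrt{\frac{4\alpha^*(u)\lambda_u}{|\Lambda|}},$$ where $\sqrt x=i\sqrt{|x|}$ for $x<0$ and $C_N>0$ is such that $\langle\Psi|\Psi\rangle=1$. Let $Q_\Psi(u)=\langle a_u^\dagger a_u\rangle_\Psi=\sum_{\alpha\in M}\alpha(u)|f(\alpha)|^2$ be the expected number of particles of momentum $u$. **Theorem.** For every $k_c$ and all small $\rho>0$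 the state $\Psi$ is well defined (the normalizing sum converges, so that $\sum_{\alpha\in M}|f(\alpha)|^2=1$), the sums defining $Q_\Psi(u)$ and $\sum_{u\in P_I\cup P_H}Q_\Psi(u)$ converge, and $P_L$ is finite. Moreover $$\lim_{k_c\to\infty}\lim_{\rho\to0}\Bigl(\rho^{-3/2}|\Lambda|^{-1}\sum_{u\in P_I\cup P_H}Q_\Psi(u)\Bigr)=0,\qquad \lim_{k_c\to\infty}\lim_{\rho\to0}\Bigl(\rho^{-3/2}|\Lambda|^{-1}\sum_{u\in P_L}Q_\Psi(u)\Bigr)=\frac1{3\pi^2}\,g_0^{3/2}.$$ -/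

import Mathlib

open Filter Topology MeasureTheory
open scoped Laplacian InnerProductSpace ContDiff Nat

noncomputable section

namespace BoseGas

/-- Three dimensional Euclidean space. -/
abbrev Space : Type := EuclideanSpace ℝ (Fin 3)

/-- The two-body interaction: smooth, symmetric, nonnegative and of fast decay. -/
structure IsPotential (V : Space → ℝ) : Prop where
  smooth : ContDiff ℝ ∞ V
  symm : ∀ x, V (-x) = V x
  nonneg : ∀ x, 0 ≤ V x
  decay : ∀ n : ℕ, ∃ C : ℝ, ∀ x, ‖x‖ ^ n * |V x| ≤ C

/-- `1 - w` is the zero energy scattering solution of the potential `V`: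
`-Δ(1 - w) + V (1 - w) = 0` with `0 ≤ w < 1` and `w(x) → 0` as `|x| → ∞`. -/
structure IsScatteringSolution (V w : Space → ℝ) : Prop where
  regular : ContDiff ℝ 2 w
  nonneg : ∀ x, 0 ≤ w x
  lt_one : ∀ x, w x < 1
  eqn : ∀ x, -(Δ (fun y => 1 - w y) x) + V x * (1 - w x) = 0
  vanish : Tendsto w (cocompact Space) (𝓝 0)

/-- The function `g = V (1 - w)`. -/
def gFun (V w : Space → ℝ) (x : Space) : ℝ := V x * (1 - w x)

/-- The scattering length `a = (4π)⁻¹ ∫ V (1 - w)`. -/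
def scatteringLength (V w : Space → ℝ) : ℝ :=
  1 / (4 * Real.pi) * ∫ x : Space, V x * (1 - w x)

/-- `g₀ = 4 π a`. -/
def g0 (V w : Space → ℝ) : ℝ := 4 * Real.pi * scatteringLength V w

/-- Fourier transform `W_p = ∫ exp(-i p·x) W(x) dx` of a real function. -/
def fourier (W : Space → ℝ) (p : Space) : ℂ :=
  ∫ x : Space, Complex.exp (-(Complex.I * ((⟪p, x⟫_ℝ : ℝ) : ℂ))) * (W x : ℂ)

/-- The Fourier coefficient `w_p`, `p ≠ 0`, of the scattering solution. The function `w` decays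
only like `|x|⁻¹` and is not integrable; `w_p` is the solution of the scattering equation in
momentum space, `p² w_p = g_p`. The number `g_p` is real because `g` is even. -/
def wHat (V w : Space → ℝ) (p : Space) : ℝ := (fourier (gFun V w) p).re / ‖p‖ ^ 2

/-! ### The torus, its momenta and the cut-off parameters, as functions of the density -/

/-- Side length `L = ρ^{-25/24}` of the box `Λ = [0, L]³`. -/
def side (ρ : ℝ) : ℝ := ρ ^ (-(25 / 24) : ℝ)

/-- The volume `|Λ| = L³`. -/
def vol (ρ : ℝ) : ℝ := side ρ ^ 3

/-- The number of particles, `N = ρ |Λ|` (integer part, if this is not an integer). -/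
def numParticles (ρ : ℝ) : ℕ := ⌊ρ * vol ρ⌋₊

/-- The exponent `η = 1/200`. -/
def etaExp : ℝ := 1 / 200

def epsL (ρ : ℝ) : ℝ := ρ ^ etaExp
def etaL (ρ : ℝ) : ℝ := ρ ^ etaExp
def epsH (ρ : ℝ) : ℝ := ρ ^ etaExp

/-- The bound `m_c = ρ^{-η}` on the number of pairs of a low momentum. -/
def mCut (ρ : ℝ) : ℝ := ρ ^ (-etaExp)

/-- The points of the dual lattice `Λ* = ((2π/L) ℤ)³` are labelled by `ℤ³`. -/
abbrev Mode : Type := Fin 3 → ℤ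

/-- The momentum `p = (2π/L) n` with label `n`. -/
def momentum (ρ : ℝ) (n : Mode) : Space :=
  WithLp.toLp 2 (fun i => 2 * Real.pi / side ρ * (n i : ℝ))

/-- The condensate `P_0`. -/
def P0 : Set Mode := {0}

/-- Low momenta. -/
def PL (ρ : ℝ) : Set Mode :=
  {n | epsL ρ * ρ ^ (1 / 2 : ℝ) ≤ ‖momentum ρ n‖ ∧
    ‖momentum ρ n‖ ≤ (etaL ρ)⁻¹ * ρ ^ (1 / 2 : ℝ)}

/-- Intermediate momenta. -/
def PI (ρ : ℝ) : Set Mode :=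
  {n | (etaL ρ)⁻¹ * ρ ^ (1 / 2 : ℝ) < ‖momentum ρ n‖ ∧ ‖momentum ρ n‖ ≤ epsH ρ}

/-- High momenta. -/
def PH (ρ : ℝ) : Set Mode := {n | epsH ρ < ‖momentum ρ n‖}

/-- `P = P_0 ∪ P_L ∪ P_I ∪ P_H`. -/
def PAll (ρ : ℝ) : Set Mode := P0 ∪ PL ρ ∪ PI ρ ∪ PH ρ

/-! ### Occupation numbers and pair creation -/

/-- Occupation numbers: finitely many particles distributed over the modes. -/
abbrev Config : Type := Mode →₀ ℕ

/-- The set `M̃` of the `N`-particle configurations that live on `P`. -/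
def configs (ρ : ℝ) : Set Config :=
  {α | (∀ k, k ∉ PAll ρ → α k = 0) ∧ (α.sum fun _ m => m) = numParticles ρ}

/-- `α_free`: all particles are in the condensate. -/
def freeConfig (ρ : ℝ) : Config := Finsupp.single 0 (numParticles ρ)

/-- `β = 𝒜^k α`: strict creation of a pair with momenta `k, -k` out of the condensate. -/
def StrictPair (k : Mode) (α β : Config) : Prop :=
  β 0 + 2 = α 0 ∧ β k = α k + 1 ∧ β (-k) = α (-k) + 1 ∧
    ∀ p, p ≠ 0 → p ≠ k → p ≠ -k → β p = α p

/-- `β = 𝒜^{u,k} α`: soft creation of a pair with the momenta `p = k + u/2` and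
`u - p = -k + u/2` out of a particle of momentum `u` and one of the condensate. -/
def SoftPair (u p : Mode) (α β : Config) : Prop :=
  β 0 + 1 = α 0 ∧ β u + 1 = α u ∧ β p = α p + 1 ∧ β (u - p) = α (u - p) + 1 ∧
    ∀ q, q ≠ 0 → q ≠ u → q ≠ p → q ≠ u - p → β q = α q

/-- The smallest set `M` of configurations that contains `α_free` and is closed under strict pair
creation at intermediate and high momenta, under strict pair creation at low momenta below the
cut-off `m_c`, and under soft pair creation from perfectly paired low momenta. -/
inductive InM (ρ kc : ℝ) : Config → Prop
  | free : InM ρ kc (freeConfig ρ)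
  | strictHigh {α β : Config} {u : Mode} : InM ρ kc α → u ∈ PI ρ ∪ PH ρ →
      StrictPair u α β → β ∈ configs ρ → InM ρ kc β
  | strictLow {α β : Config} {u : Mode} : InM ρ kc α → u ∈ PL ρ →
      ((max (α u) (α (-u)) : ℕ) : ℝ) < mCut ρ →
      StrictPair u α β → β ∈ configs ρ → InM ρ kc β
  | soft {α β : Config} {u p : Mode} : InM ρ kc α → u ∈ PL ρ → α u = α (-u) →
      p ∈ PH ρ → u - p ∈ PH ρ →
      epsH ρ ≤ ‖momentum ρ p‖ → ‖momentum ρ p‖ ≤ kc →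
      epsH ρ ≤ ‖momentum ρ (u - p)‖ → ‖momentum ρ (u - p)‖ ≤ kc →
      SoftPair u p α β → β ∈ configs ρ → InM ρ kc β

/-- The set `M` as a set of configurations. -/
def M (ρ kc : ℝ) : Set Config := {α | InM ρ kc α}

/-- `α*(u) = max {α(u), α(-u)}`. -/
def starOcc (α : Config) (u : Mode) : ℕ := max (α u) (α (-u))

/-! ### The trial state -/

open scoped Classical in
/-- The coefficients `λ_k` for the momenta `k ∈ P_L ∪ P_I ∪ P_H`. -/
def lam (V w : Space → ℝ) (ρ : ℝ) (k : Mode) : ℝ :=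
  if k ∈ PL ρ then
    (1 - √(1 + 4 * ρ * g0 V w * (‖momentum ρ k‖ ^ 2)⁻¹)) /
      (1 + √(1 + 4 * ρ * g0 V w * (‖momentum ρ k‖ ^ 2)⁻¹)) * ρ⁻¹
  else -wHat V w (momentum ρ k)

/-- The square root of a real number, with `√x = √|x| i` for `x < 0`. -/
def csqrt (x : ℝ) : ℂ := if x < 0 then (√|x| : ℂ) * Complex.I else (√x : ℂ)

/-- The coefficient `f(α)` without the normalization constant `C_N`. -/
def weight (V w : Space → ℝ) (ρ : ℝ) (α : Config) : ℂ :=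
  csqrt (vol ρ ^ α 0 / ((α 0)! : ℝ)) *
    (∏ k ∈ α.support.erase 0, csqrt (lam V w ρ k) ^ α k) *
    ∏ᶠ (u : Mode) (_ : u ∈ PL ρ ∧ starOcc α u = α u + 1),
      csqrt (4 * (starOcc α u : ℝ) * lam V w ρ u / vol ρ)

/-- The normalization constant `C_N`. -/
def normConst (V w : Space → ℝ) (ρ kc : ℝ) : ℝ :=
  (√(∑' α : M ρ kc, ‖weight V w ρ α‖ ^ 2))⁻¹

/-- The coefficients `f(α)`, `α ∈ M`, of the trial state `Ψ = ∑_{α ∈ M} f(α) |α⟩` in the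
orthonormal basis of the occupation number states `|α⟩`. -/
def coeff (V w : Space → ℝ) (ρ kc : ℝ) (α : M ρ kc) : ℂ :=
  (normConst V w ρ kc : ℂ) * weight V w ρ α

/-- The expected number `Q_Ψ(u) = ⟨a†_u a_u⟩_Ψ = ∑_{α ∈ M} α(u) |f(α)|²` of particles with
momentum `u`. -/
def Q (V w : Space → ℝ) (ρ kc : ℝ) (u : Mode) : ℝ :=
  ∑' α : M ρ kc, ((α : Config) u : ℝ) * ‖coeff V w ρ kc α‖ ^ 2

/-- The iterated limit `lim_{kc → ∞} lim_{ρ → 0} F(kc, ρ) = c`, all limits being assumed to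
exist, the inner one for all large `kc`. -/
def IteratedLimit (F : ℝ → ℝ → ℝ) (c : ℝ) : Prop :=
  ∃ ℓ : ℝ → ℝ, (∀ᶠ kc in atTop, Tendsto (fun ρ => F kc ρ) (𝓝[>] 0) (𝓝 (ℓ kc))) ∧
    Tendsto ℓ atTop (𝓝 c)

end BoseGas

end

noncomputable section

namespace BoseGas

open scoped ENNReal

/-! ### Momenta -/

/-! The squared coefficients define a probability on `M` in which one pair creation changes the
weight by an explicit factor. With `x = ρ|Λ|`, a strict pair at `k` costs `ρ²|λ_k λ_{-k}|` times
`α(0)(α(0)-1)/x²` (`sqWeight_pair'`), provided it touches no low momentum with a soft defect. A soft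
pair costs `4 α(0) α(u) |λ_p λ_{u-p}| / |Λ|²` (`sqWeight_soft`). Every estimate compares a
configuration with the one before or after a single creation. For given data of the move, each
configuration determines the other, so sums can be compared term by term (`ex_le_of_rel`).

For a low momentum put `r = (ρ λ_u)² < 1`. Undoing a strict pair gives `E n ≤ r (E n + 1)`
(`lowOcc_le`) and performing one gives the reverse up to errors (`le_lowOcc`), so the occupation is
nearly `r/(1-r)`, as for a geometric law. In units of `ρ^{1/2}` this is a fixed function of the
momentum, and `ρ^{-3/2}|Λ|⁻¹ ∑` is `(2π)⁻³` times a Riemann sum of mesh `2π ρ^{13/24}`. The integral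
of `r/(1-r)` is `(π/3)(4g₀)^{3/2}` (`lintegral_bogDist`), whence the constant.

There are three errors. The cut-off at `m_c` contributes a geometric tail, which vanishes by
dominated convergence (`tendsto_lowSum_tail`). Soft pairs have probability `O(ρ^{1/2} ε_L⁻¹)` at
each low momentum, because `∑ |λ|²` over intermediate and high momenta is finite and small after
scaling. The depletion of the condensate is bounded by the occupations, whose upper bounds are
obtained first and do not involve it.

An intermediate or high particle comes from a strict pair, where the ratio is at most `1/2` and the
sum of the ratios is negligible, or from one of the rare soft pairs (`tsum_occ_high_le`). Since a
configuration does not record which, `M` is described through decompositions (`Decomp`): having one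
is equivalent to lying in `M`, and this shows that undoing a creation stays in `M`. No estimate uses
`kc`, so the inner limits do not depend on it. -/

theorem momentum_neg (ρ : ℝ) (n : Mode) : momentum ρ (-n) = -momentum ρ n := by
  ext i
  simp [momentum]

theorem momentum_zero (ρ : ℝ) : momentum ρ 0 = 0 := by
  ext i
  simp [momentum]

/-- The intermediate and high momenta. -/
def PIH (ρ : ℝ) : Set Mode := PI ρ ∪ PH ρ

theorem neg_mem_PL {ρ : ℝ} {n : Mode} : -n ∈ PL ρ ↔ n ∈ PL ρ := by
  simp [PL, momentum_neg]

theorem neg_mem_PIH {ρ : ℝ} {n : Mode} : -n ∈ PIH ρ ↔ n ∈ PIH ρ := by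
  simp [PIH, PI, PH, momentum_neg]

theorem PH_subset_PIH {ρ : ℝ} {n : Mode} (h : n ∈ PH ρ) : n ∈ PIH ρ := Or.inr h

/-- The density is so small that the low momenta lie strictly below the high ones. -/
structure IsDilute (ρ : ℝ) : Prop where
  pos : 0 < ρ
  gap : (etaL ρ)⁻¹ * ρ ^ (1 / 2 : ℝ) < epsH ρ

namespace IsDilute

variable {ρ : ℝ}

theorem epsL_pos (hρ : IsDilute ρ) : 0 < epsL ρ := Real.rpow_pos_of_pos hρ.pos _
theorem etaL_pos (hρ : IsDilute ρ) : 0 < etaL ρ := Real.rpow_pos_of_pos hρ.pos _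
theorem epsH_pos (hρ : IsDilute ρ) : 0 < epsH ρ := Real.rpow_pos_of_pos hρ.pos _
theorem sqrt_pos (hρ : IsDilute ρ) : 0 < ρ ^ (1 / 2 : ℝ) := Real.rpow_pos_of_pos hρ.pos _

theorem zero_notMem_PL (hρ : IsDilute ρ) : (0 : Mode) ∉ PL ρ := by
  intro h
  have := h.1
  rw [momentum_zero, norm_zero] at this
  exact absurd this (not_le.2 (mul_pos hρ.epsL_pos hρ.sqrt_pos))

theorem zero_notMem_PIH (hρ : IsDilute ρ) : (0 : Mode) ∉ PIH ρ := by
  rintro (h | h)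
  · have := h.1
    rw [momentum_zero, norm_zero] at this
    exact absurd this (not_lt.2 (mul_pos (inv_pos.2 hρ.etaL_pos) hρ.sqrt_pos).le)
  · have : epsH ρ < ‖momentum ρ 0‖ := h
    rw [momentum_zero, norm_zero] at this
    exact absurd this (not_lt.2 hρ.epsH_pos.le)

theorem notMem_PL_of_PIH (hρ : IsDilute ρ) {k : Mode} (hk : k ∈ PIH ρ) : k ∉ PL ρ := by
  intro h
  rcases hk with hk | hk
  · exact absurd h.2 (not_le.2 hk.1)
  · exact absurd (h.2.trans hρ.gap.le) (not_le.2 hk)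

theorem ne_zero_of_PL (hρ : IsDilute ρ) {k : Mode} (hk : k ∈ PL ρ) : k ≠ 0 := by
  rintro rfl
  exact hρ.zero_notMem_PL hk

theorem ne_zero_of_PIH (hρ : IsDilute ρ) {k : Mode} (hk : k ∈ PIH ρ) : k ≠ 0 := by
  rintro rfl
  exact hρ.zero_notMem_PIH hk

theorem ne_of_PL_of_PIH (hρ : IsDilute ρ) {u k : Mode} (hu : u ∈ PL ρ) (hk : k ∈ PIH ρ) :
    u ≠ k := by
  rintro rfl
  exact hρ.notMem_PL_of_PIH hk hu

end IsDilute

theorem Mode.ne_neg {u : Mode} (hu : u ≠ 0) : u ≠ -u := by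
  intro h
  apply hu
  funext i
  have := congrFun h i
  simp only [Pi.neg_apply] at this
  simp only [Pi.zero_apply]
  omega

/-- Otherwise `u = 2p` would be longer than `2 ε_H`, while low momenta are shorter than `ε_H`. -/
theorem IsDilute.ne_sub_self {ρ : ℝ} (hρ : IsDilute ρ) {u p : Mode} (hu : u ∈ PL ρ)
    (hp : p ∈ PH ρ) : p ≠ u - p := by
  intro h
  have hup : u = p + p := by rw [← sub_eq_iff_eq_add]; exact h.symm
  have h2 : momentum ρ u = (2 : ℝ) • momentum ρ p := by
    ext i
    simp [momentum, hup]
    ring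
  have h3 : ‖momentum ρ u‖ = 2 * ‖momentum ρ p‖ := by rw [h2, norm_smul]; norm_num
  have h4 : epsH ρ < ‖momentum ρ p‖ := hp
  have h5 := hu.2.trans hρ.gap.le
  have h6 := norm_nonneg (momentum ρ p)
  linarith

theorem mem_PAll {ρ : ℝ} {k : Mode} : k ∈ PAll ρ ↔ k = 0 ∨ k ∈ PL ρ ∨ k ∈ PIH ρ := by
  simp [PAll, P0, PIH, or_assoc]

/-! ### Pair creation as an identity between occupation numbers -/

/-- A pair of particles with momenta `k` and `-k`. -/
def pair (k : Mode) : Config := Finsupp.single k 1 + Finsupp.single (-k) 1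

/-- The two particles with momenta `p` and `u - p`. -/
def split (u p : Mode) : Config := Finsupp.single p 1 + Finsupp.single (u - p) 1

theorem pair_apply_self {k : Mode} (hk : k ≠ 0) : pair k k = 1 := by
  simp [pair, (Mode.ne_neg hk).symm]

theorem pair_apply_neg (k l : Mode) : pair k (-l) = pair k l := by
  simp only [pair, Finsupp.add_apply, Finsupp.single_apply, neg_eq_iff_eq_neg]
  rw [add_comm]
  congr 2
  simp

theorem pair_apply_of_ne {k l : Mode} (h1 : l ≠ k) (h2 : l ≠ -k) : pair k l = 0 := by
  simp [pair, h1.symm, h2.symm]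

theorem split_apply_of_ne {u p l : Mode} (h1 : l ≠ p) (h2 : l ≠ u - p) : split u p l = 0 := by
  simp [split, h1.symm, h2.symm]

/-- The additive form avoids truncated subtraction, and cancellation in it shows that either
configuration determines the other. -/
theorem strictPair_iff {k : Mode} (hk : k ≠ 0) {α β : Config} :
    StrictPair k α β ↔ β + Finsupp.single 0 2 = α + pair k := by
  have hk' := Mode.ne_neg hk
  have hk2 : -k ≠ 0 := neg_ne_zero.2 hk
  constructor
  · rintro ⟨h0, h1, h2, h3⟩
    ext p
    simp only [Finsupp.add_apply, pair, Finsupp.single_apply]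
    by_cases p0 : p = 0
    · subst p0; simp [hk]; omega
    by_cases pk : p = k
    · subst pk; simp [Ne.symm p0, hk'.symm]; omega
    by_cases pk2 : p = -k
    · subst pk2; simp [hk2.symm, hk']; omega
    · simp [Ne.symm p0, Ne.symm pk, Ne.symm pk2, h3 p p0 pk pk2]
  · intro h
    have e : ∀ p, β p + Finsupp.single 0 2 p = α p + pair k p := fun p => by
      rw [← Finsupp.add_apply, h, Finsupp.add_apply]
    refine ⟨?_, ?_, ?_, fun p p0 pk pk2 => ?_⟩
    · have := e 0
      rw [pair_apply_of_ne hk.symm hk2.symm] at this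
      simpa using this
    · have := e k
      rw [pair_apply_self hk] at this
      simpa [hk.symm] using this
    · have := e (-k)
      rw [pair_apply_neg, pair_apply_self hk] at this
      simpa [hk2.symm] using this
    · have := e p
      rw [pair_apply_of_ne pk pk2] at this
      simpa [Ne.symm p0] using this

/-- The relation between occupation numbers that defines a soft pair creation. -/
theorem softPair_iff {u p : Mode} (hu : u ≠ 0) (hp : p ≠ 0) (hup : u - p ≠ 0) (h1 : p ≠ u - p)
    {α β : Config} :
    SoftPair u p α β ↔
      β + (Finsupp.single 0 1 + Finsupp.single u 1) = α + split u p := by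
  have hpu : p ≠ u := fun h => hup (by rw [h, sub_self])
  have hpu2 : u - p ≠ u := fun h => hp (by simpa using h)
  constructor
  · rintro ⟨h0, hu', hp', hq', h3⟩
    ext q
    simp only [Finsupp.add_apply, split, Finsupp.single_apply]
    by_cases q0 : q = 0
    · subst q0; simp [hu, hp, hup]; omega
    by_cases qu : q = u
    · subst qu; simp [Ne.symm q0, hpu, hpu2]; omega
    by_cases qp : q = p
    · subst qp; simp [Ne.symm q0, Ne.symm qu, h1.symm]; omega
    by_cases qup : q = u - p
    · subst qup; simp [Ne.symm q0, Ne.symm qu, h1]; omega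
    · simp [Ne.symm q0, Ne.symm qu, Ne.symm qp, Ne.symm qup, h3 q q0 qu qp qup]
  · intro h
    have e : ∀ q, β q + (Finsupp.single 0 1 q + Finsupp.single u 1 q) = α q + split u p q :=
      fun q => by
        rw [← Finsupp.add_apply, ← Finsupp.add_apply, h, Finsupp.add_apply]
    refine ⟨?_, ?_, ?_, ?_, fun q q0 qu qp qup => ?_⟩
    · have := e 0
      rw [split_apply_of_ne hp.symm hup.symm] at this
      simpa [hu] using this
    · have := e u
      rw [split_apply_of_ne hpu.symm hpu2.symm] at this
      simpa [hu.symm] using this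
    · have := e p
      simpa [split, h1.symm, hp.symm, hpu.symm] using this
    · have := e (u - p)
      simpa [split, h1, hup.symm, hpu2.symm] using this
    · have := e q
      rw [split_apply_of_ne qp qup] at this
      simpa [Ne.symm q0, Ne.symm qu] using this

theorem mem_configs {ρ : ℝ} {α : Config} :
    α ∈ configs ρ ↔ (∀ k, k ∉ PAll ρ → α k = 0) ∧ α.degree = numParticles ρ := by
  rw [configs, Set.mem_ofPred_eq]
  rfl

/-! ### The structure of the configurations in `M` -/

theorem pair_add_apply {α β : Config} {k : Mode}
    (h : β + Finsupp.single 0 2 = α + pair k) {p : Mode} (hp : p ≠ 0) :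
    β p = α p + pair k p := by
  have := DFunLike.congr_fun h p
  simpa [Ne.symm hp] using this

theorem pair_add_apply_zero {α β : Config} {k : Mode} (hk : k ≠ 0)
    (h : β + Finsupp.single 0 2 = α + pair k) : β 0 + 2 = α 0 := by
  have := DFunLike.congr_fun h 0
  rw [Finsupp.add_apply, Finsupp.add_apply,
    pair_apply_of_ne hk.symm (neg_ne_zero.2 hk).symm] at this
  simpa using this

theorem degree_pair (k : Mode) : (pair k).degree = 2 := by
  simp [pair]

theorem pair_add_degree {α β : Config} {k : Mode}
    (h : β + Finsupp.single 0 2 = α + pair k) : β.degree = α.degree := by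
  have := congrArg Finsupp.degree h
  simpa [degree_pair] using this

theorem degree_split (u p : Mode) : (split u p).degree = 2 := by
  simp [split]

theorem split_add_degree {α β : Config} {u p : Mode}
    (h : β + (Finsupp.single 0 1 + Finsupp.single u 1) = α + split u p) :
    β.degree = α.degree := by
  have := congrArg Finsupp.degree h
  simpa [degree_split] using this

theorem neg_mem_PAll {ρ : ℝ} {k : Mode} : -k ∈ PAll ρ ↔ k ∈ PAll ρ := by
  rw [mem_PAll, mem_PAll, neg_mem_PL, neg_mem_PIH, neg_eq_zero]

theorem pair_add_mem_configs_iff {ρ : ℝ} {α β : Config} {k : Mode} (hk : k ∈ PAll ρ) 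
    (h : β + Finsupp.single 0 2 = α + pair k) : β ∈ configs ρ ↔ α ∈ configs ρ := by
  rw [mem_configs, mem_configs, pair_add_degree h]
  refine and_congr_left' (forall_congr' fun p => imp_congr_right fun hp => ?_)
  have p0 : p ≠ 0 := by rintro rfl; exact hp (mem_PAll.2 (Or.inl rfl))
  have pk : p ≠ k := by rintro rfl; exact hp hk
  have pk2 : p ≠ -k := by rintro rfl; exact hp (neg_mem_PAll.2 hk)
  rw [pair_add_apply h p0, pair_apply_of_ne pk pk2, add_zero]

open scoped Classical in
/-- The low momenta that have lost a particle in a soft pair creation. -/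
def softModes (ρ : ℝ) (α : Config) : Finset Mode :=
  (α.support.image fun k => -k).filter fun u => u ∈ PL ρ ∧ α (-u) = α u + 1

theorem mem_softModes {ρ : ℝ} {α : Config} {u : Mode} :
    u ∈ softModes ρ α ↔ u ∈ PL ρ ∧ α (-u) = α u + 1 := by
  classical
  rw [softModes, Finset.mem_filter]
  refine and_iff_right_of_imp fun h => ?_
  refine Finset.mem_image.2 ⟨-u, ?_, neg_neg u⟩
  rw [Finsupp.mem_support_iff, h.2]
  omega

theorem softModes_congr {ρ : ℝ} {α β : Config}
    (h : ∀ u ∈ PL ρ, β (-u) = β u + 1 ↔ α (-u) = α u + 1) :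
    softModes ρ β = softModes ρ α := by
  ext u
  rw [mem_softModes, mem_softModes]
  exact and_congr_right (h u)

/-- A decomposition of the configuration `α`: the particles of intermediate and high momentum come
from the strict pairs counted by `σ` and from the soft pairs `τ u`, `u - τ u`. -/
structure Decomp (ρ kc : ℝ) (α σ : Config) (τ : Mode → Mode) : Prop where
  mem : α ∈ configs ρ
  symm : ∀ k, σ (-k) = σ k
  supp : ∀ k, k ∉ PIH ρ → σ k = 0
  soft : ∀ u ∈ softModes ρ α, τ u ∈ PH ρ ∧ u - τ u ∈ PH ρ ∧
    ‖momentum ρ (τ u)‖ ≤ kc ∧ ‖momentum ρ (u - τ u)‖ ≤ kc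
  high : ∀ k ∈ PIH ρ, α k = σ k + ∑ u ∈ softModes ρ α, split u (τ u) k
  bound : ∀ u ∈ PL ρ, α u ≤ ⌈mCut ρ⌉₊
  low : ∀ u ∈ PL ρ, α (-u) = α u ∨ α (-u) = α u + 1 ∨ α u = α (-u) + 1

theorem pair_high_apply_low {ρ : ℝ} (hρ : IsDilute ρ) {k : Mode} (hk : k ∈ PIH ρ) {α β : Config}
    (h : β + Finsupp.single 0 2 = α + pair k) {u : Mode} (hu : u ∈ PL ρ) : β u = α u := by
  rw [pair_add_apply h (hρ.ne_zero_of_PL hu), pair_apply_of_ne, add_zero]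
  · exact hρ.ne_of_PL_of_PIH hu hk
  · exact hρ.ne_of_PL_of_PIH hu (neg_mem_PIH.2 hk)

theorem pair_apply_neg_add {α β : Config} {k u : Mode} (hu : u ≠ 0)
    (h : β + Finsupp.single 0 2 = α + pair k) :
    β u = α u + pair k u ∧ β (-u) = α (-u) + pair k u :=
  ⟨pair_add_apply h hu, by rw [pair_add_apply h (neg_ne_zero.2 hu), pair_apply_neg]⟩

/-- `pair k` is even, so a strict creation preserves the imbalance between `u` and `-u`. Hence a
soft defect is permanent and each low pair `±u` suffers at most one. -/
theorem softModes_pair {ρ : ℝ} (hρ : IsDilute ρ) {k : Mode} {α β : Config}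
    (h : β + Finsupp.single 0 2 = α + pair k) : softModes ρ β = softModes ρ α :=
  softModes_congr fun u hu => by
    obtain ⟨h1, h2⟩ := pair_apply_neg_add (hρ.ne_zero_of_PL hu) h
    rw [h1, h2]
    omega

/-- The two directions serve the two inclusions: `←` follows the generation of `M`, `→` undoes a
strict pair. -/
theorem decomp_pair_high_iff {ρ kc : ℝ} (hρ : IsDilute ρ) {k : Mode} (hk : k ∈ PIH ρ)
    {α β σ : Config} {τ : Mode → Mode} (h : β + Finsupp.single 0 2 = α + pair k) :
    Decomp ρ kc β (σ + pair k) τ ↔ Decomp ρ kc α σ τ := by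
  have hT := softModes_pair hρ h
  have hl : ∀ u ∈ PL ρ, β u = α u := fun u hu => pair_high_apply_low hρ hk h hu
  have hl' : ∀ u ∈ PL ρ, β (-u) = α (-u) := fun u hu => hl _ (neg_mem_PL.2 hu)
  have hc := pair_add_mem_configs_iff (mem_PAll.2 (Or.inr (Or.inr hk))) h
  constructor
  · intro d
    refine ⟨hc.1 d.mem, fun p => ?_, fun p hp => ?_, ?_, fun p hp => ?_, fun u hu => ?_,
      fun u hu => ?_⟩
    · have := d.symm p
      simpa [pair_apply_neg] using this
    · have := d.supp p hp
      simp only [Finsupp.add_apply] at this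
      omega
    · rw [← hT]; exact d.soft
    · have := d.high p hp
      rw [pair_add_apply h (hρ.ne_zero_of_PIH hp), hT, Finsupp.add_apply] at this
      omega
    · rw [← hl u hu]; exact d.bound u hu
    · rw [← hl u hu, ← hl' u hu]; exact d.low u hu
  · intro d
    refine ⟨hc.2 d.mem, fun p => ?_, fun p hp => ?_, ?_, fun p hp => ?_, fun u hu => ?_,
      fun u hu => ?_⟩
    · simp [pair_apply_neg, d.symm]
    · rw [Finsupp.add_apply, d.supp p hp, pair_apply_of_ne]
      · rintro rfl; exact hp hk
      · rintro rfl; exact hp (neg_mem_PIH.2 hk)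
    · rw [hT]; exact d.soft
    · rw [pair_add_apply h (hρ.ne_zero_of_PIH hp), hT, Finsupp.add_apply, d.high p hp]
      omega
    · rw [hl u hu]; exact d.bound u hu
    · rw [hl u hu, hl' u hu]; exact d.low u hu

theorem pair_low_apply_high {ρ : ℝ} (hρ : IsDilute ρ) {k : Mode} (hk : k ∈ PL ρ) {α β : Config}
    (h : β + Finsupp.single 0 2 = α + pair k) {p : Mode} (hp : p ∈ PIH ρ) : β p = α p := by
  rw [pair_add_apply h (hρ.ne_zero_of_PIH hp), pair_apply_of_ne, add_zero]
  · exact (hρ.ne_of_PL_of_PIH hk hp).symm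
  · exact (hρ.ne_of_PL_of_PIH (neg_mem_PL.2 hk) hp).symm

theorem decomp_pair_low_iff {ρ kc : ℝ} (hρ : IsDilute ρ) {k : Mode} (hk : k ∈ PL ρ)
    {α β σ : Config} {τ : Mode → Mode} (h : β + Finsupp.single 0 2 = α + pair k)
    (h1 : α k < ⌈mCut ρ⌉₊) (h2 : α (-k) < ⌈mCut ρ⌉₊) :
    Decomp ρ kc β σ τ ↔ Decomp ρ kc α σ τ := by
  have hT := softModes_pair hρ h
  have hl : ∀ u ∈ PL ρ, β u = α u + pair k u ∧ β (-u) = α (-u) + pair k u :=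
    fun u hu => pair_apply_neg_add (hρ.ne_zero_of_PL hu) h
  have hc := pair_add_mem_configs_iff (mem_PAll.2 (Or.inr (Or.inl hk))) h
  have hh : ∀ p ∈ PIH ρ, β p = α p := fun p hp => pair_low_apply_high hρ hk h hp
  constructor
  · intro d
    refine ⟨hc.1 d.mem, d.symm, d.supp, ?_, fun p hp => ?_, fun u hu => ?_, fun u hu => ?_⟩
    · rw [← hT]; exact d.soft
    · rw [← hh p hp, ← hT]; exact d.high p hp
    · have := d.bound u hu
      rw [(hl u hu).1] at this
      omega
    · have := d.low u hu
      rw [(hl u hu).1, (hl u hu).2] at this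
      omega
  · intro d
    refine ⟨hc.2 d.mem, d.symm, d.supp, ?_, fun p hp => ?_, fun u hu => ?_, fun u hu => ?_⟩
    · rw [hT]; exact d.soft
    · rw [hh p hp, hT]; exact d.high p hp
    · have := d.bound u hu
      rw [(hl u hu).1]
      by_cases e1 : u = k
      · subst e1
        rw [pair_apply_self (hρ.ne_zero_of_PL hk)]
        omega
      by_cases e2 : u = -k
      · subst e2
        rw [pair_apply_neg, pair_apply_self (hρ.ne_zero_of_PL hk)]
        omega
      rw [pair_apply_of_ne e1 e2]
      omega
    · have := d.low u hu
      rw [(hl u hu).1, (hl u hu).2]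
      omega

/-! ### Soft pairs -/

theorem split_add_apply {α β : Config} {u p : Mode}
    (h : β + (Finsupp.single 0 1 + Finsupp.single u 1) = α + split u p) {q : Mode} (hq : q ≠ 0)
    (hqu : q ≠ u) : β q = α q + split u p q := by
  have := DFunLike.congr_fun h q
  simpa [Ne.symm hq, Ne.symm hqu] using this

/-- The soft pair creation at a low momentum `u`, with all side conditions on the momenta. -/
structure SoftStep (ρ : ℝ) (u p : Mode) (α β : Config) : Prop where
  low : u ∈ PL ρ
  high : p ∈ PH ρ
  high' : u - p ∈ PH ρ
  eq : β + (Finsupp.single 0 1 + Finsupp.single u 1) = α + split u p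

namespace SoftStep

variable {ρ : ℝ} {u p : Mode} {α β : Config}

theorem apply_low (hρ : IsDilute ρ) (s : SoftStep ρ u p α β) {q : Mode} (hq : q ∈ PL ρ)
    (hqu : q ≠ u) : β q = α q := by
  rw [split_add_apply s.eq (hρ.ne_zero_of_PL hq) hqu, split_apply_of_ne, add_zero]
  · exact hρ.ne_of_PL_of_PIH hq (PH_subset_PIH s.high)
  · exact hρ.ne_of_PL_of_PIH hq (PH_subset_PIH s.high')

theorem apply_self (hρ : IsDilute ρ) (s : SoftStep ρ u p α β) : β u + 1 = α u := by
  have := DFunLike.congr_fun s.eq u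
  rw [Finsupp.add_apply, Finsupp.add_apply (a := u) (g₁ := α), split_apply_of_ne
    (hρ.ne_of_PL_of_PIH s.low (PH_subset_PIH s.high))
    (hρ.ne_of_PL_of_PIH s.low (PH_subset_PIH s.high'))] at this
  simpa [(hρ.ne_zero_of_PL s.low).symm] using this

theorem apply_neg (hρ : IsDilute ρ) (s : SoftStep ρ u p α β) : β (-u) = α (-u) :=
  s.apply_low hρ (neg_mem_PL.2 s.low) (Mode.ne_neg (hρ.ne_zero_of_PL s.low)).symm

theorem apply_high (hρ : IsDilute ρ) (s : SoftStep ρ u p α β) {q : Mode} (hq : q ∈ PIH ρ) :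
    β q = α q + split u p q :=
  split_add_apply s.eq (hρ.ne_zero_of_PIH hq) (hρ.ne_of_PL_of_PIH s.low hq).symm

theorem apply_zero (hρ : IsDilute ρ) (s : SoftStep ρ u p α β) : β 0 + 1 = α 0 := by
  have := DFunLike.congr_fun s.eq 0
  rw [Finsupp.add_apply, Finsupp.add_apply (a := 0) (g₁ := α), split_apply_of_ne
    (hρ.ne_zero_of_PIH (PH_subset_PIH s.high)).symm
    (hρ.ne_zero_of_PIH (PH_subset_PIH s.high')).symm] at this
  simpa [hρ.ne_zero_of_PL s.low] using this

theorem softPair (hρ : IsDilute ρ) (s : SoftStep ρ u p α β) : SoftPair u p α β :=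
  (softPair_iff (hρ.ne_zero_of_PL s.low) (hρ.ne_zero_of_PIH (PH_subset_PIH s.high))
    (hρ.ne_zero_of_PIH (PH_subset_PIH s.high')) (hρ.ne_sub_self s.low s.high)).2 s.eq

theorem mem_configs_iff (s : SoftStep ρ u p α β) :
    β ∈ configs ρ ↔ α ∈ configs ρ := by
  rw [mem_configs, mem_configs, split_add_degree s.eq]
  refine and_congr_left' (forall_congr' fun q => imp_congr_right fun hq => ?_)
  rw [mem_PAll] at hq
  push Not at hq
  have e1 : q ≠ u := by rintro rfl; exact hq.2.1 s.low
  have e2 : q ≠ p := by rintro rfl; exact hq.2.2 (PH_subset_PIH s.high)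
  have e3 : q ≠ u - p := by rintro rfl; exact hq.2.2 (PH_subset_PIH s.high')
  rw [split_add_apply s.eq hq.1 e1, split_apply_of_ne e2 e3, add_zero]

open scoped Classical in
theorem softModes_eq (hρ : IsDilute ρ) (s : SoftStep ρ u p α β) (he : α (-u) = α u) :
    u ∉ softModes ρ α ∧ softModes ρ β = insert u (softModes ρ α) := by
  have h1 := s.apply_self hρ
  have h2 := s.apply_neg hρ
  refine ⟨fun h => ?_, ?_⟩
  · have := (mem_softModes.1 h).2
    omega
  ext q
  rw [Finset.mem_insert, mem_softModes, mem_softModes]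
  by_cases e1 : q = u
  · subst e1
    simp only [s.low, true_and, true_or, iff_true]
    omega
  by_cases e2 : q = -u
  · subst e2
    simp only [e1, false_or, neg_neg]
    refine and_congr_right fun _ => ?_
    omega
  simp only [e1, false_or]
  refine and_congr_right fun hq => ?_
  rw [s.apply_low hρ hq e1, s.apply_low hρ (neg_mem_PL.2 hq) fun h => e2 (by rw [← h, neg_neg])]

end SoftStep

theorem Decomp.soft_step {ρ kc : ℝ} (hρ : IsDilute ρ) {u p : Mode} {α β σ : Config}
    {τ : Mode → Mode} (s : SoftStep ρ u p α β) (he : α (-u) = α u)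
    (h1 : ‖momentum ρ p‖ ≤ kc) (h2 : ‖momentum ρ (u - p)‖ ≤ kc)
    (d : Decomp ρ kc α σ τ) : Decomp ρ kc β σ (Function.update τ u p) := by
  classical
  obtain ⟨hu, hT⟩ := s.softModes_eq hρ he
  have hs := s.apply_self hρ
  have hn := s.apply_neg hρ
  have hτ : ∀ v ∈ softModes ρ α, Function.update τ u p v = τ v := fun v hv => by
    rw [Function.update_of_ne]
    rintro rfl
    exact hu hv
  refine ⟨(s.mem_configs_iff).2 d.mem, d.symm, d.supp, fun v hv => ?_, fun k hk => ?_,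
    fun v hv => ?_, fun v hv => ?_⟩
  · rw [hT, Finset.mem_insert] at hv
    rcases hv with rfl | hv
    · rw [Function.update_self]
      exact ⟨s.high, s.high', h1, h2⟩
    · rw [hτ v hv]
      exact d.soft v hv
  · have : ∑ v ∈ softModes ρ α, split v (Function.update τ u p v) k =
        ∑ v ∈ softModes ρ α, split v (τ v) k :=
      Finset.sum_congr rfl fun v hv => by rw [hτ v hv]
    rw [hT, Finset.sum_insert hu, Function.update_self, s.apply_high hρ hk, d.high k hk, this]
    omega
  · have := d.bound v hv
    by_cases e : v = u
    · subst e; omega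
    · rw [s.apply_low hρ hv e]; exact this
  · have := d.low v hv
    by_cases e : v = u
    · subst e; omega
    by_cases e2 : v = -u
    · subst e2; rw [neg_neg]; omega
    rw [s.apply_low hρ hv e, s.apply_low hρ (neg_mem_PL.2 hv) fun h => e2 (by rw [← h, neg_neg])]
    exact this

theorem Decomp.soft_undo {ρ kc : ℝ} (hρ : IsDilute ρ) {u p : Mode} {α β σ : Config}
    {τ : Mode → Mode} (s : SoftStep ρ u p α β) (he : α (-u) = α u) (hp : p = τ u)
    (d : Decomp ρ kc β σ τ) : Decomp ρ kc α σ τ := by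
  classical
  obtain ⟨hu, hT⟩ := s.softModes_eq hρ he
  have hs := s.apply_self hρ
  have hn := s.apply_neg hρ
  refine ⟨(s.mem_configs_iff).1 d.mem, d.symm, d.supp, fun v hv => ?_, fun k hk => ?_,
    fun v hv => ?_, fun v hv => ?_⟩
  · exact d.soft v (by rw [hT]; exact Finset.mem_insert_of_mem hv)
  · have := d.high k hk
    rw [hT, Finset.sum_insert hu, s.apply_high hρ hk, hp] at this
    omega
  · have := d.bound v hv
    by_cases e : v = u
    · subst e
      -- Undoing raises the occupation of `v`, but only to that of `-v`, which obeys the bound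
      -- already.
      have := d.bound (-v) (neg_mem_PL.2 hv)
      omega
    · rw [← s.apply_low hρ hv e]; exact this
  · have := d.low v hv
    by_cases e : v = u
    · subst e; omega
    by_cases e2 : v = -u
    · subst e2; rw [neg_neg]; omega
    rw [← s.apply_low hρ hv e, ← s.apply_low hρ (neg_mem_PL.2 hv) fun h => e2 (by rw [← h, neg_neg])]
    exact this

/-! ### Undoing a pair creation inside a decomposition. -/

theorem exists_pair_undo {α : Config} {k : Mode} (hk : k ≠ 0) (h1 : 0 < α k) (h2 : 0 < α (-k)) :
    ∃ β : Config, α + Finsupp.single 0 2 = β + pair k := by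
  refine ⟨α + Finsupp.single 0 2 - pair k, (tsub_add_cancel_of_le ?_).symm⟩
  intro p
  by_cases e1 : p = k
  · subst e1; rw [pair_apply_self hk, Finsupp.add_apply]; omega
  by_cases e2 : p = -k
  · subst e2; rw [pair_apply_neg, pair_apply_self hk, Finsupp.add_apply]; omega
  rw [pair_apply_of_ne e1 e2]
  omega

theorem Decomp.exists_undo_high {ρ kc : ℝ} (hρ : IsDilute ρ) {k : Mode} (hk : k ∈ PIH ρ)
    {α σ : Config} {τ : Mode → Mode} (d : Decomp ρ kc α σ τ) (h : 0 < σ k) :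
    ∃ β σ', α + Finsupp.single 0 2 = β + pair k ∧ Decomp ρ kc β σ' τ ∧ σ' k + 1 = σ k := by
  have h0 := hρ.ne_zero_of_PIH hk
  obtain ⟨β, hβ⟩ := exists_pair_undo (α := α) h0
    (by rw [d.high k hk]; omega)
    (by rw [d.high _ (neg_mem_PIH.2 hk), d.symm]; omega)
  have hσ : σ = (σ - pair k) + pair k := by
    refine (tsub_add_cancel_of_le ?_).symm
    intro p
    by_cases e1 : p = k
    · subst e1; rw [pair_apply_self h0]; omega
    by_cases e2 : p = -k
    · subst e2; rw [pair_apply_neg, pair_apply_self h0, d.symm]; omega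
    rw [pair_apply_of_ne e1 e2]
    omega
  rw [hσ] at d
  refine ⟨β, σ - pair k, hβ, (decomp_pair_high_iff hρ hk hβ).1 d, ?_⟩
  rw [Finsupp.tsub_apply, pair_apply_self h0]
  omega

theorem Decomp.exists_undo_low {ρ kc : ℝ} (hρ : IsDilute ρ) {k : Mode} (hk : k ∈ PL ρ)
    {α σ : Config} {τ : Mode → Mode} (d : Decomp ρ kc α σ τ) (h : 0 < α k) (h' : α (-k) = α k) :
    ∃ β, α + Finsupp.single 0 2 = β + pair k ∧ Decomp ρ kc β σ τ ∧ β k + 1 = α k ∧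
      β (-k) = β k := by
  have h0 := hρ.ne_zero_of_PL hk
  obtain ⟨β, hβ⟩ := exists_pair_undo (α := α) h0 h (by omega)
  obtain ⟨e1, e2⟩ := pair_apply_neg_add h0 hβ
  rw [pair_apply_self h0] at e1 e2
  have := d.bound k hk
  exact ⟨β, hβ, (decomp_pair_low_iff hρ hk hβ (by omega) (by omega)).1 d, by omega, by omega⟩

theorem Decomp.exists_undo_soft {ρ kc : ℝ} (hρ : IsDilute ρ) {u : Mode}
    {α σ : Config} {τ : Mode → Mode} (d : Decomp ρ kc α σ τ) (h : u ∈ softModes ρ α) :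
    ∃ β, SoftStep ρ u (τ u) β α ∧ β (-u) = β u ∧ Decomp ρ kc β σ τ := by
  obtain ⟨hp, hup, -, -⟩ := d.soft u h
  obtain ⟨hu, hα⟩ := mem_softModes.1 h
  -- The two particles are present in `α` even if other pairs occupy the same momenta, since the
  -- term of `u` is one summand in `d.high`.
  have hle : split u (τ u) ≤ α + (Finsupp.single 0 1 + Finsupp.single u 1) := by
    intro q
    by_cases hq : q = τ u ∨ q = u - τ u
    · have hq' : q ∈ PIH ρ := by rcases hq with rfl | rfl <;> exact PH_subset_PIH ‹_›
      have := Finset.single_le_sum (f := fun v => split v (τ v) q) (fun _ _ => Nat.zero_le _) h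
      rw [Finsupp.add_apply, d.high q hq']
      omega
    · push Not at hq
      rw [split_apply_of_ne hq.1 hq.2]
      omega
  obtain ⟨β, hβ⟩ : ∃ β, α + (Finsupp.single 0 1 + Finsupp.single u 1) = β + split u (τ u) :=
    ⟨_, (tsub_add_cancel_of_le hle).symm⟩
  have s : SoftStep ρ u (τ u) β α := ⟨hu, hp, hup, hβ⟩
  have e1 := s.apply_self hρ
  have e2 := s.apply_neg hρ
  have e3 : β (-u) = β u := by omega
  exact ⟨β, s, e3, d.soft_undo hρ s e3 rfl⟩

/-! ### Equivalence of membership in `M` with the existence of a decomposition. -/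

/-- Every configuration in `M` has a decomposition. -/
theorem InM.exists_decomp {ρ kc : ℝ} (hρ : IsDilute ρ) {α : Config} (h : InM ρ kc α) :
    ∃ σ τ, Decomp ρ kc α σ τ := by
  induction h with
  | free =>
    have hz : ∀ u, u ≠ 0 → freeConfig ρ u = 0 := fun u hu => by
      simp [freeConfig, hu.symm]
    have hT : softModes ρ (freeConfig ρ) = ∅ := by
      ext u
      simp only [mem_softModes, Finset.notMem_empty, iff_false, not_and]
      intro hu
      rw [hz u (hρ.ne_zero_of_PL hu), hz (-u) (hρ.ne_zero_of_PL (neg_mem_PL.2 hu))]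
      omega
    refine ⟨0, id, ⟨mem_configs.2 ⟨fun k hk => hz k ?_, by simp [freeConfig]⟩, by simp, by simp,
      by simp [hT], fun k hk => by simp [hT, hz k (hρ.ne_zero_of_PIH hk)], fun u hu => ?_,
      fun u hu => Or.inl ?_⟩⟩
    · rintro rfl; exact hk (mem_PAll.2 (Or.inl rfl))
    · rw [hz u (hρ.ne_zero_of_PL hu)]; omega
    · rw [hz u (hρ.ne_zero_of_PL hu), hz (-u) (hρ.ne_zero_of_PL (neg_mem_PL.2 hu))]
  | @strictHigh α β u _ hu hs _ ih =>
    obtain ⟨σ, τ, d⟩ := ih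
    exact ⟨_, τ, (decomp_pair_high_iff hρ hu
      ((strictPair_iff (hρ.ne_zero_of_PIH hu)).1 hs)).2 d⟩
  | @strictLow α β u _ hu hm hs _ ih =>
    obtain ⟨σ, τ, d⟩ := ih
    have hm' := Nat.lt_ceil.2 hm
    exact ⟨σ, τ, (decomp_pair_low_iff hρ hu
      ((strictPair_iff (hρ.ne_zero_of_PL hu)).1 hs) (by omega) (by omega)).2 d⟩
  | @soft α β u p _ hu he hp hup _ h1 _ h2 hs _ ih =>
    obtain ⟨σ, τ, d⟩ := ih
    have s : SoftStep ρ u p α β := ⟨hu, hp, hup, (softPair_iff (hρ.ne_zero_of_PL hu)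
      (hρ.ne_zero_of_PIH (PH_subset_PIH hp)) (hρ.ne_zero_of_PIH (PH_subset_PIH hup))
      (hρ.ne_sub_self hu hp)).1 hs⟩
    exact ⟨σ, _, d.soft_step hρ s he.symm h1 h2⟩

theorem apply_zero_le {ρ : ℝ} {α : Config} (h : α ∈ configs ρ) : α 0 ≤ numParticles ρ := by
  rw [← (mem_configs.1 h).2]; exact Finsupp.le_degree 0 α

/-- Unless all particles are in the condensate, one of the pair creations can be undone. -/
theorem Decomp.eq_free_or {ρ kc : ℝ} {α σ : Config} {τ : Mode → Mode}
    (d : Decomp ρ kc α σ τ) :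
    α = freeConfig ρ ∨ (∃ u, u ∈ softModes ρ α) ∨
      (softModes ρ α = ∅ ∧ ((∃ k ∈ PIH ρ, 0 < σ k) ∨ ∃ k ∈ PL ρ, 0 < α k ∧ α (-k) = α k)) := by
  by_cases h1 : (softModes ρ α).Nonempty
  · exact Or.inr (Or.inl h1)
  have hT : softModes ρ α = ∅ := Finset.not_nonempty_iff_eq_empty.1 h1
  by_cases h2 : ∃ k ∈ PIH ρ, 0 < σ k
  · exact Or.inr (Or.inr ⟨hT, Or.inl h2⟩)
  -- Without soft defects at `u` and `-u`, only the balanced alternative of `d.low` remains.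
  have hlow : ∀ u ∈ PL ρ, α (-u) = α u := by
    intro u hu
    have e1 : u ∉ softModes ρ α := by simp [hT]
    have e2 : -u ∉ softModes ρ α := by simp [hT]
    rw [mem_softModes, not_and] at e1 e2
    have e1 := e1 hu
    have e2 := e2 (neg_mem_PL.2 hu)
    rw [neg_neg] at e2
    have := d.low u hu
    omega
  by_cases h3 : ∃ k ∈ PL ρ, 0 < α k
  · obtain ⟨k, hk, hα⟩ := h3
    exact Or.inr (Or.inr ⟨hT, Or.inr ⟨k, hk, hα, hlow k hk⟩⟩)
  left
  have hz : ∀ k, k ≠ 0 → α k = 0 := by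
    intro k hk
    by_cases hkP : k ∈ PAll ρ
    · rcases mem_PAll.1 hkP with h | h | h
      · exact absurd h hk
      · by_contra h'
        exact h3 ⟨k, h, Nat.pos_of_ne_zero h'⟩
      · rw [d.high k h, hT, Finset.sum_empty, add_zero]
        by_contra h'
        exact h2 ⟨k, h, Nat.pos_of_ne_zero h'⟩
    · exact (mem_configs.1 d.mem).1 k hkP
  have e : α = Finsupp.single 0 (α 0) := by
    ext k
    by_cases hk : k = 0
    · subst hk; simp
    · simp [hz k hk, Ne.symm hk]
  have e2 : α 0 = numParticles ρ := by
    rw [← (mem_configs.1 d.mem).2]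
    conv_rhs => rw [e]
    simp
  rw [e, e2, freeConfig]

/-- Every configuration with a decomposition is in `M`. -/
theorem Decomp.inM {ρ kc : ℝ} (hρ : IsDilute ρ) {α σ : Config} {τ : Mode → Mode}
    (d : Decomp ρ kc α σ τ) : InM ρ kc α := by
  -- Each undone creation returns particles to the condensate, so the number outside it decreases.
  induction hn : numParticles ρ - α 0 using Nat.strong_induction_on generalizing α σ τ with
  | _ n ih =>
  rcases d.eq_free_or with h | ⟨u, hu⟩ | ⟨-, ⟨k, hk, hσ⟩ | ⟨k, hk, hα, he⟩⟩
  · rw [h]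
    exact InM.free
  · obtain ⟨hp, hup, b1, b2⟩ := d.soft u hu
    obtain ⟨β, s, he, d'⟩ := d.exists_undo_soft hρ hu
    have h0 := s.apply_zero hρ
    have := apply_zero_le d'.mem
    exact InM.soft (ih _ (by omega) d' rfl) s.low he.symm hp hup (le_of_lt hp) b1 (le_of_lt hup)
      b2 (s.softPair hρ) d.mem
  · obtain ⟨β, σ', hβ, d', -⟩ := d.exists_undo_high hρ hk hσ
    have h0 := pair_add_apply_zero (hρ.ne_zero_of_PIH hk) hβ
    have := apply_zero_le d'.mem
    exact InM.strictHigh (ih _ (by omega) d' rfl) hk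
      ((strictPair_iff (hρ.ne_zero_of_PIH hk)).2 hβ) d.mem
  · obtain ⟨β, hβ, d', e1, e2⟩ := d.exists_undo_low hρ hk hα he
    have h0 := pair_add_apply_zero (hρ.ne_zero_of_PL hk) hβ
    have := apply_zero_le d'.mem
    have hb := d.bound k hk
    refine InM.strictLow (ih _ (by omega) d' rfl) hk (Nat.lt_ceil.1 ?_)
      ((strictPair_iff (hρ.ne_zero_of_PL hk)).2 hβ) d.mem
    rw [e2, max_self]
    omega

/-! ### The squared coefficients -/

theorem norm_csqrt_sq (x : ℝ) : ‖csqrt x‖ ^ 2 = |x| := by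
  unfold csqrt
  split_ifs with h
  · rw [norm_mul, Complex.norm_I, mul_one, Complex.norm_real, Real.norm_eq_abs,
      abs_of_nonneg (Real.sqrt_nonneg _), Real.sq_sqrt (abs_nonneg _)]
  · rw [Complex.norm_real, Real.norm_eq_abs, abs_of_nonneg (Real.sqrt_nonneg _),
      Real.sq_sqrt (not_lt.1 h), abs_of_nonneg (not_lt.1 h)]

theorem IsDilute.side_pos {ρ : ℝ} (hρ : IsDilute ρ) : 0 < side ρ := Real.rpow_pos_of_pos hρ.pos _

theorem IsDilute.vol_pos {ρ : ℝ} (hρ : IsDilute ρ) : 0 < vol ρ := pow_pos hρ.side_pos 3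

section

variable (V w : Space → ℝ)

/-- The product of the factors `x k` over all particles outside of the condensate. -/
def occProd (x : Mode → ℝ) (α : Config) : ℝ :=
  α.prod fun k n => if k = 0 then 1 else x k ^ n

theorem occProd_add (x : Mode → ℝ) (α β : Config) :
    occProd x (α + β) = occProd x α * occProd x β := by
  classical
  unfold occProd
  refine Finsupp.prod_add_index' (fun k => by simp) (fun k m n => ?_)
  split_ifs
  · simp
  · exact pow_add _ _ _

theorem occProd_single_zero (x : Mode → ℝ) (n : ℕ) : occProd x (Finsupp.single 0 n) = 1 := by
  unfold occProd
  rw [Finsupp.prod_single_index] <;> simp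

theorem occProd_single {x : Mode → ℝ} {k : Mode} (hk : k ≠ 0) :
    occProd x (Finsupp.single k 1) = x k := by
  unfold occProd
  rw [Finsupp.prod_single_index] <;> simp [hk]

theorem occProd_pair {x : Mode → ℝ} {k : Mode} (hk : k ≠ 0) :
    occProd x (pair k) = x k * x (-k) := by
  rw [pair, occProd_add, occProd_single hk, occProd_single (neg_ne_zero.2 hk)]

/-- The absolute values of the coefficients `λ`. -/
def alam (ρ : ℝ) (k : Mode) : ℝ := |lam V w ρ k|

theorem alam_nonneg (ρ : ℝ) (k : Mode) : 0 ≤ alam V w ρ k := abs_nonneg _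

/-- The factor of the squared coefficient that is due to soft pairs. -/
def softProd (ρ : ℝ) (α : Config) : ℝ :=
  ∏ u ∈ softModes ρ α, 4 * (α (-u) : ℝ) * alam V w ρ u / vol ρ

/-- The squared coefficients without normalization. -/
def sqWeight (ρ : ℝ) (α : Config) : ℝ :=
  vol ρ ^ α 0 / ((α 0)! : ℝ) * occProd (alam V w ρ) α * softProd V w ρ α

theorem norm_weight_sq {ρ : ℝ} (hρ : IsDilute ρ) (α : Config) :
    ‖weight V w ρ α‖ ^ 2 = sqWeight V w ρ α := by
  have hv := hρ.vol_pos
  unfold weight sqWeight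
  rw [norm_mul, norm_mul, mul_pow, mul_pow, norm_csqrt_sq, abs_of_nonneg (by positivity)]
  congr 1
  · congr 1
    rw [norm_prod, ← Finset.prod_pow]
    unfold occProd Finsupp.prod
    by_cases h0 : (0 : Mode) ∈ α.support
    · rw [← Finset.mul_prod_erase _ _ h0]
      dsimp only
      rw [if_pos rfl, one_mul]
      refine Finset.prod_congr rfl fun k hk => ?_
      rw [if_neg (Finset.ne_of_mem_erase hk), norm_pow, ← pow_mul, mul_comm, pow_mul,
        norm_csqrt_sq, alam]
    · rw [Finset.erase_eq_of_notMem h0]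
      refine Finset.prod_congr rfl fun k hk => ?_
      have hk0 : k ≠ 0 := by rintro rfl; exact h0 hk
      dsimp only
      rw [if_neg hk0, norm_pow, ← pow_mul, mul_comm, pow_mul, norm_csqrt_sq, alam]
  -- The maximum exceeds `α u` only if it is `α (-u)`, so the extra factors of `f` sit exactly at
  -- the soft modes.
  · have e : ∀ u, (u ∈ PL ρ ∧ starOcc α u = α u + 1) ↔ u ∈ softModes ρ α := fun u => by
      rw [mem_softModes, starOcc]
      refine and_congr_right fun _ => ?_
      omega
    rw [finprod_congr fun u => finprod_congr_Prop (propext (e u)) fun _ => rfl,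
      finprod_mem_finset_eq_prod, norm_prod, ← Finset.prod_pow]
    refine Finset.prod_congr rfl fun u hu => ?_
    have h := (mem_softModes.1 hu).2
    have hs : starOcc α u = α (-u) := by rw [starOcc]; omega
    rw [norm_csqrt_sq, hs, abs_div, abs_mul, abs_of_nonneg (by positivity), abs_of_pos hv, alam]

theorem sqWeight_nonneg {ρ : ℝ} (hρ : IsDilute ρ) (α : Config) : 0 ≤ sqWeight V w ρ α := by
  rw [← norm_weight_sq V w hρ]; positivity

/-- The factor of a soft mode `u` contains `α (-u)`. The hypothesis `hs` keeps the new pair away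
from these occupations. -/
theorem softProd_pair {ρ : ℝ} (hρ : IsDilute ρ) {α β : Config} {k : Mode}
    (h : β + Finsupp.single 0 2 = α + pair k)
    (hs : ∀ u ∈ softModes ρ α, pair k u = 0) : softProd V w ρ β = softProd V w ρ α := by
  unfold softProd
  rw [softModes_pair hρ h]
  refine Finset.prod_congr rfl fun u hu => ?_
  have h0 := hρ.ne_zero_of_PL (mem_softModes.1 hu).1
  rw [(pair_apply_neg_add h0 h).2, hs u hu, add_zero]

theorem vol_pow_factorial (v : ℝ) (n : ℕ) :
    v ^ n / (n ! : ℝ) * v = (n + 1) * (v ^ (n + 1) / ((n + 1)! : ℝ)) := by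
  rw [Nat.factorial_succ]
  have : ((n : ℝ) + 1) ≠ 0 := by positivity
  have : (n ! : ℝ) ≠ 0 := by positivity
  push_cast
  field_simp
  ring

/-- The two particles leaving the condensate trade a factor `vol ρ` for `α 0` and for `α 0 - 1`; the
two new ones bring their coefficients. -/
theorem sqWeight_pair {ρ : ℝ} (hρ : IsDilute ρ) {α β : Config} {k : Mode} (hk : k ≠ 0)
    (h : β + Finsupp.single 0 2 = α + pair k)
    (hs : ∀ u ∈ softModes ρ α, pair k u = 0) :
    sqWeight V w ρ β * vol ρ ^ 2 =
      α 0 * (α 0 - 1) * (alam V w ρ k * alam V w ρ (-k)) * sqWeight V w ρ α := by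
  have h0 := pair_add_apply_zero hk h
  have hG := congrArg (occProd (alam V w ρ)) h
  rw [occProd_add, occProd_add, occProd_single_zero, occProd_pair hk, mul_one] at hG
  unfold sqWeight
  rw [hG, softProd_pair V w hρ h hs, ← h0]
  have e1 := vol_pow_factorial (vol ρ) (β 0)
  have e2 := vol_pow_factorial (vol ρ) (β 0 + 1)
  push_cast at e2 ⊢
  calc _ = (vol ρ ^ β 0 / (β 0)! * vol ρ) * vol ρ * (occProd (alam V w ρ) α *
        (alam V w ρ k * alam V w ρ (-k)) * softProd V w ρ α) := by ring
    _ = (β 0 + 1) * (vol ρ ^ (β 0 + 1) / (β 0 + 1)! * vol ρ) * (occProd (alam V w ρ) α *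
        (alam V w ρ k * alam V w ρ (-k)) * softProd V w ρ α) := by rw [e1]; ring
    _ = _ := by rw [e2]; ring

/-- The particle lost at `u` removes `alam u` from `occProd`, and the new soft mode puts it back
through `softProd` together with `4 α(u) / vol`. The identity is arranged so that `alam u` need not
be divided out. -/
theorem sqWeight_soft {ρ : ℝ} (hρ : IsDilute ρ) {α β : Config} {u p : Mode}
    (s : SoftStep ρ u p α β) (he : α (-u) = α u) :
    sqWeight V w ρ β * vol ρ ^ 2 =
      α 0 * (4 * α u) * (alam V w ρ p * alam V w ρ (u - p)) * sqWeight V w ρ α := by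
  classical
  have hv := hρ.vol_pos
  obtain ⟨hu, hT⟩ := s.softModes_eq hρ he
  have h0 := s.apply_zero hρ
  have hp0 := hρ.ne_zero_of_PIH (PH_subset_PIH s.high)
  have hup0 := hρ.ne_zero_of_PIH (PH_subset_PIH s.high')
  have hG := congrArg (occProd (alam V w ρ)) s.eq
  rw [occProd_add, occProd_add, occProd_add, split, occProd_add, occProd_single_zero, one_mul,
    occProd_single (hρ.ne_zero_of_PL s.low), occProd_single hp0, occProd_single hup0] at hG
  have hS : softProd V w ρ β = 4 * (α u : ℝ) * alam V w ρ u / vol ρ * softProd V w ρ α := by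
    unfold softProd
    rw [hT, Finset.prod_insert hu, s.apply_neg hρ, he]
    congr 1
    refine Finset.prod_congr rfl fun v hv => ?_
    rw [s.apply_low hρ (neg_mem_PL.2 (mem_softModes.1 hv).1)]
    -- The factor of `v` could change only for `v = -u`, which is not a soft mode of `α` because
    -- `±u` are balanced there.
    intro h
    have h2 := (mem_softModes.1 hv).2
    have : v = -u := by rw [← h, neg_neg]
    subst this
    rw [neg_neg] at h2
    omega
  unfold sqWeight
  rw [hS, ← h0]
  have e1 := vol_pow_factorial (vol ρ) (β 0)
  push_cast
  calc _ = (vol ρ ^ β 0 / (β 0)! * vol ρ) *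
        (occProd (alam V w ρ) β * alam V w ρ u) * (4 * (α u : ℝ)) * softProd V w ρ α := by
        field_simp
    _ = _ := by rw [e1, hG]; ring

end

/-! ### Summation over configurations -/

/-- A sum is bounded by another one if every term is bounded by a term to which it is attached, and
no two terms are attached to the same one. -/
theorem tsum_le_tsum_of_rel {A B : Type*} (f : A → ℝ≥0∞) (g : B → ℝ≥0∞) (R : B → A → Prop)
    (hR : ∀ b a a', R b a → R b a' → a = a') (h : ∀ a, f a ≠ 0 → ∃ b, R b a ∧ f a ≤ g b) :
    ∑' a, f a ≤ ∑' b, g b := by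
  classical
  choose i h1 h2 using fun a : Function.support f => h a a.2
  have hinj : Function.Injective i := fun a a' e => by
    refine Subtype.ext (hR (i a) a a' (h1 a) ?_)
    rw [e]
    exact h1 a'
  calc ∑' a, f a = ∑' a : Function.support f, f a := (tsum_subtype_support f).symm
    _ ≤ ∑' a : Function.support f, g (i a) := ENNReal.tsum_le_tsum h2
    _ ≤ ∑' b, g b := ENNReal.tsum_comp_le_tsum_of_injective hinj g

theorem mul_le_sq_add_sq (a b : ℝ≥0∞) : a * b ≤ a ^ 2 + b ^ 2 := by
  rcases le_total a b with h | h
  · calc a * b ≤ b * b := by gcongr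
      _ ≤ a ^ 2 + b ^ 2 := by rw [sq b]; exact le_add_self
  · calc a * b ≤ a * a := by gcongr
      _ ≤ a ^ 2 + b ^ 2 := by rw [sq a]; exact le_self_add

/-- The bound is uniform in the total momentum `u`, so square summability of `λ` controls soft pairs
and, at `u = 0`, strict ones. -/
theorem tsum_mul_reflect_le {G : Type*} [AddCommGroup G] (f : G → ℝ≥0∞) (u : G) :
    ∑' p, f p * f (u - p) ≤ 2 * ∑' p, f p ^ 2 := by
  calc ∑' p, f p * f (u - p) ≤ ∑' p, (f p ^ 2 + f (u - p) ^ 2) :=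
        ENNReal.tsum_le_tsum fun p => mul_le_sq_add_sq _ _
    _ = ∑' p, f p ^ 2 + ∑' p, f (u - p) ^ 2 := ENNReal.tsum_add
    _ = 2 * ∑' p, f p ^ 2 := by
        rw [two_mul, ← (Equiv.subLeft u).tsum_eq fun p => f p ^ 2]
        rfl

section

variable (V w : Space → ℝ)

theorem numParticles_le {ρ : ℝ} (hρ : IsDilute ρ) : (numParticles ρ : ℝ) ≤ ρ * vol ρ :=
  Nat.floor_le (mul_nonneg hρ.pos.le hρ.vol_pos.le)

theorem occ_zero_le {ρ : ℝ} (hρ : IsDilute ρ) {α : Config} (h : α ∈ configs ρ) :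
    (α 0 : ℝ) ≤ ρ * vol ρ :=
  (Nat.cast_le.2 (apply_zero_le h)).trans (numParticles_le hρ)

/-- The depletion factor `α(0)(α(0)-1)/N²`. -/
def condFactor (ρ : ℝ) (α : Config) : ℝ := α 0 * (α 0 - 1) / (ρ * vol ρ) ^ 2

theorem sqWeight_pair' {ρ : ℝ} (hρ : IsDilute ρ) {α β : Config} {k : Mode} (hk : k ≠ 0)
    (h : β + Finsupp.single 0 2 = α + pair k)
    (hs : ∀ u ∈ softModes ρ α, pair k u = 0) :
    sqWeight V w ρ β = ρ ^ 2 * (alam V w ρ k * alam V w ρ (-k)) * condFactor ρ α *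
      sqWeight V w ρ α := by
  have hv := hρ.vol_pos
  have hr := hρ.pos
  have := sqWeight_pair V w hρ hk h hs
  unfold condFactor
  field_simp
  rw [this]
  ring

theorem condFactor_le_one {ρ : ℝ} (hρ : IsDilute ρ) {α : Config} (h : α ∈ configs ρ) :
    condFactor ρ α ≤ 1 := by
  have hv := hρ.vol_pos
  have hr := hρ.pos
  have h1 := occ_zero_le hρ h
  have h0 : (0 : ℝ) ≤ α 0 := Nat.cast_nonneg _
  unfold condFactor
  rw [div_le_one (by positivity)]
  nlinarith

theorem condFactor_nonneg {ρ : ℝ} (α : Config) : 0 ≤ condFactor ρ α := by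
  unfold condFactor
  refine div_nonneg ?_ (sq_nonneg _)
  rcases Nat.eq_zero_or_pos (α 0) with h | h
  · simp [h]
  · have : (1 : ℝ) ≤ α 0 := by exact_mod_cast h
    nlinarith

theorem sqWeight_pair_le {ρ : ℝ} (hρ : IsDilute ρ) {α β : Config} {k : Mode} (hk : k ≠ 0)
    (h : β + Finsupp.single 0 2 = α + pair k) (hα : α ∈ configs ρ)
    (hs : ∀ u ∈ softModes ρ α, pair k u = 0) :
    sqWeight V w ρ β ≤ ρ ^ 2 * (alam V w ρ k * alam V w ρ (-k)) * sqWeight V w ρ α := by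
  rw [sqWeight_pair' V w hρ hk h hs]
  refine mul_le_mul_of_nonneg_right ?_ (sqWeight_nonneg V w hρ α)
  refine mul_le_of_le_one_right ?_ (condFactor_le_one hρ hα)
  have := alam_nonneg V w ρ k
  have := alam_nonneg V w ρ (-k)
  positivity

theorem sqWeight_soft_le {ρ : ℝ} (hρ : IsDilute ρ) {α β : Config} {u p : Mode}
    (s : SoftStep ρ u p α β) (he : α (-u) = α u) (hα : α ∈ configs ρ)
    (hb : α u ≤ ⌈mCut ρ⌉₊) :
    sqWeight V w ρ β ≤ 4 * ⌈mCut ρ⌉₊ * ρ / vol ρ * (alam V w ρ p * alam V w ρ (u - p)) *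
      sqWeight V w ρ α := by
  have hv := hρ.vol_pos
  have hr := hρ.pos
  have h := sqWeight_soft V w hρ s he
  have h1 := occ_zero_le hρ hα
  have hb' : (α u : ℝ) ≤ ⌈mCut ρ⌉₊ := by exact_mod_cast hb
  have a1 := alam_nonneg V w ρ p
  have a2 := alam_nonneg V w ρ (u - p)
  have a3 := sqWeight_nonneg V w hρ α
  have e : sqWeight V w ρ β = α 0 * (4 * α u) / vol ρ ^ 2 *
      (alam V w ρ p * alam V w ρ (u - p)) * sqWeight V w ρ α := by
    field_simp
    rw [h]
    ring
  rw [e]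
  refine mul_le_mul_of_nonneg_right (mul_le_mul_of_nonneg_right ?_ (mul_nonneg a1 a2)) a3
  calc (α 0 : ℝ) * (4 * α u) / vol ρ ^ 2 ≤ (ρ * vol ρ) * (4 * ⌈mCut ρ⌉₊) / vol ρ ^ 2 := by gcongr
    _ = _ := by field_simp

/-! ### Convergence of the normalizing sum -/

open scoped Classical in
/-- The coefficients `|λ|` of the intermediate and high momenta. -/
def hlam (ρ : ℝ) (k : Mode) : ℝ≥0∞ := if k ∈ PIH ρ then ENNReal.ofReal (alam V w ρ k) else 0

theorem hlam_of_mem {ρ : ℝ} {k : Mode} (hk : k ∈ PIH ρ) :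
    hlam V w ρ k = ENNReal.ofReal (alam V w ρ k) := if_pos hk

open scoped Classical in
/-- The coefficients `|λ|` of all momenta except for the condensate. -/
def elam (ρ : ℝ) (k : Mode) : ℝ≥0∞ :=
  if k ∈ PL ρ ∪ PIH ρ then ENNReal.ofReal (alam V w ρ k) else 0

theorem tsum_elam_sq_ne_top {ρ : ℝ} (hf : (PL ρ).Finite)
    (hl : ∑' k, hlam V w ρ k ^ 2 ≠ ⊤) : ∑' k, elam V w ρ k ^ 2 ≠ ⊤ := by
  classical
  have h : ∑' k, elam V w ρ k ^ 2 ≤ ∑' k, (∑ u ∈ hf.toFinset,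
      if k = u then ENNReal.ofReal (alam V w ρ u) ^ 2 else 0) + ∑' k, hlam V w ρ k ^ 2 := by
    rw [← ENNReal.tsum_add]
    refine ENNReal.tsum_le_tsum fun k => ?_
    unfold elam hlam
    by_cases h1 : k ∈ PL ρ
    · rw [if_pos (Set.mem_union_left _ h1)]
      refine le_add_right ?_
      rw [Finset.sum_ite_eq, if_pos (hf.mem_toFinset.2 h1)]
    by_cases h2 : k ∈ PIH ρ
    · rw [if_pos (Set.mem_union_right _ h2), if_pos h2]
      exact le_add_self
    · rw [if_neg (by simp [h1, h2])]
      simp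
  refine ne_top_of_le_ne_top (ENNReal.add_ne_top.2 ⟨?_, hl⟩) h
  rw [Summable.tsum_finsetSum fun _ _ => ENNReal.summable]
  refine ENNReal.sum_ne_top.2 fun u _ => ?_
  rw [tsum_ite_eq]
  exact ENNReal.pow_ne_top ENNReal.ofReal_ne_top

/-- All three moves are put into one form: `u = 0` encodes a strict pair, as `split 0 k = pair k`.
Soft pairs are undone first, so that no soft factor interferes when a strict pair is undone. -/
theorem exists_undo {ρ kc : ℝ} (hρ : IsDilute ρ) :
    ∃ C : ℝ, 0 ≤ C ∧ ∀ α : Config, InM ρ kc α → α ≠ freeConfig ρ → ∃ u p β,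
      (u = 0 ∨ u ∈ PL ρ) ∧ p ∈ PL ρ ∪ PIH ρ ∧ u - p ∈ PL ρ ∪ PIH ρ ∧ InM ρ kc β ∧
      α + (Finsupp.single 0 1 + Finsupp.single u 1) = β + split u p ∧ α 0 + 1 ≤ β 0 ∧
      sqWeight V w ρ α ≤ C * (alam V w ρ p * alam V w ρ (u - p)) * sqWeight V w ρ β := by
  have hv := hρ.vol_pos
  have hr := hρ.pos
  refine ⟨ρ ^ 2 + 4 * ⌈mCut ρ⌉₊ * ρ / vol ρ, by positivity, fun α hα hne => ?_⟩
  have key : ∀ C' : ℝ, C' ≤ ρ ^ 2 + 4 * ⌈mCut ρ⌉₊ * ρ / vol ρ → ∀ p q β,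
      sqWeight V w ρ α ≤ C' * (alam V w ρ p * alam V w ρ q) * sqWeight V w ρ β →
      sqWeight V w ρ α ≤ (ρ ^ 2 + 4 * ⌈mCut ρ⌉₊ * ρ / vol ρ) *
        (alam V w ρ p * alam V w ρ q) * sqWeight V w ρ β := fun C' hC' p q β h =>
    h.trans (mul_le_mul_of_nonneg_right (mul_le_mul_of_nonneg_right hC'
      (mul_nonneg (alam_nonneg V w ρ p) (alam_nonneg V w ρ q))) (sqWeight_nonneg V w hρ β))
  have c1 : ρ ^ 2 ≤ ρ ^ 2 + 4 * ⌈mCut ρ⌉₊ * ρ / vol ρ := le_add_of_nonneg_right (by positivity)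
  have c2 : 4 * ⌈mCut ρ⌉₊ * ρ / vol ρ ≤ ρ ^ 2 + 4 * ⌈mCut ρ⌉₊ * ρ / vol ρ :=
    le_add_of_nonneg_left (by positivity)
  have e0 : ∀ k, split 0 k = pair k := fun k => by rw [split, pair, zero_sub]
  have e1 : (Finsupp.single 0 1 + Finsupp.single 0 1 : Config) = Finsupp.single 0 2 := by
    rw [← Finsupp.single_add]
  obtain ⟨σ, τ, d⟩ := hα.exists_decomp hρ
  rcases d.eq_free_or with h | ⟨u, hu⟩ | ⟨hT, ⟨k, hk, hσ⟩ | ⟨k, hk, hα, he⟩⟩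
  · exact absurd h hne
  · obtain ⟨β, s, he, d'⟩ := d.exists_undo_soft hρ hu
    have h0 := s.apply_zero hρ
    exact ⟨u, τ u, β, Or.inr s.low, Or.inr (PH_subset_PIH s.high), Or.inr (PH_subset_PIH s.high'),
      d'.inM hρ, s.eq, h0.le, key _ c2 _ _ _
        (sqWeight_soft_le V w hρ s he d'.mem (d'.bound u s.low))⟩
  · obtain ⟨β, σ', hβ, d', -⟩ := d.exists_undo_high hρ hk hσ
    have h0 := pair_add_apply_zero (hρ.ne_zero_of_PIH hk) hβ
    refine ⟨0, k, β, Or.inl rfl, Or.inr hk, ?_, d'.inM hρ, ?_, by omega, key _ c1 _ _ _ ?_⟩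
    · rw [zero_sub]; exact Or.inr (neg_mem_PIH.2 hk)
    · rw [e0, e1, hβ]
    · rw [zero_sub]
      refine sqWeight_pair_le V w hρ (hρ.ne_zero_of_PIH hk) hβ d'.mem fun u hu => ?_
      rw [← softModes_pair hρ hβ, hT] at hu
      exact absurd hu (Finset.notMem_empty u)
  · obtain ⟨β, hβ, d', -, -⟩ := d.exists_undo_low hρ hk hα he
    have h0 := pair_add_apply_zero (hρ.ne_zero_of_PL hk) hβ
    refine ⟨0, k, β, Or.inl rfl, Or.inl hk, ?_, d'.inM hρ, ?_, by omega, key _ c1 _ _ _ ?_⟩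
    · rw [zero_sub]; exact Or.inl (neg_mem_PL.2 hk)
    · rw [e0, e1, hβ]
    · rw [zero_sub]
      refine sqWeight_pair_le V w hρ (hρ.ne_zero_of_PL hk) hβ d'.mem fun u hu => ?_
      rw [← softModes_pair hρ hβ, hT] at hu
      exact absurd hu (Finset.notMem_empty u)

open scoped Classical in
/-- The squared coefficients, extended by zero to all configurations. -/
def rawWeight (ρ kc : ℝ) (α : Config) : ℝ≥0∞ :=
  if InM ρ kc α then ENNReal.ofReal (sqWeight V w ρ α) else 0

theorem rawWeight_of_inM {ρ kc : ℝ} {α : Config} (h : InM ρ kc α) :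
    rawWeight V w ρ kc α = ENNReal.ofReal (sqWeight V w ρ α) := if_pos h

theorem InM.mem_configs {ρ kc : ℝ} {α : Config} (hρ : IsDilute ρ) (h : InM ρ kc α) :
    α ∈ configs ρ := by
  obtain ⟨σ, τ, d⟩ := h.exists_decomp hρ
  exact d.mem

/-- There are infinitely many momenta, so convergence needs an argument. Let `Z j` be the sum over
configurations with at least `j` condensate particles. Undoing one creation raises `α 0`, which
gives `Z j ≤ free + K * Z (j + 1)` with finite `K`, and `Z j = 0` for `j > N`. -/
theorem tsum_rawWeight_ne_top {ρ : ℝ} (kc : ℝ) (hρ : IsDilute ρ) (hf : (PL ρ).Finite)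
    (hl : ∑' k, hlam V w ρ k ^ 2 ≠ ⊤) : ∑' α, rawWeight V w ρ kc α ≠ ⊤ := by
  classical
  obtain ⟨C, hC, hundo⟩ := exists_undo V w (kc := kc) hρ
  have hE := tsum_elam_sq_ne_top V w hf hl
  have hK : ∑' u : ↥(insert 0 (PL ρ)), ∑' p, ENNReal.ofReal C * (elam V w ρ p * elam V w ρ (u - p))
      ≠ ⊤ := by
    have : Finite ↥(insert 0 (PL ρ)) := (hf.insert 0).to_subtype
    have := Fintype.ofFinite ↥(insert 0 (PL ρ))
    rw [tsum_fintype]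
    refine ENNReal.sum_ne_top.2 fun u _ => ?_
    rw [ENNReal.tsum_mul_left]
    refine ENNReal.mul_ne_top ENNReal.ofReal_ne_top ?_
    exact ne_top_of_le_ne_top (ENNReal.mul_ne_top (by simp) hE) (tsum_mul_reflect_le _ _)
  set K := ∑' u : ↥(insert 0 (PL ρ)), ∑' p,
    ENNReal.ofReal C * (elam V w ρ p * elam V w ρ (u - p)) with hKdef
  let Z : ℕ → ℝ≥0∞ := fun j => ∑' α : Config, if j ≤ α 0 then rawWeight V w ρ kc α else 0
  have step : ∀ j, Z j ≤ rawWeight V w ρ kc (freeConfig ρ) + K * Z (j + 1) := by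
    intro j
    have split1 : Z j ≤ ∑' α : Config, (if α = freeConfig ρ then
          rawWeight V w ρ kc (freeConfig ρ) else 0) +
        ∑' α : Config, if j ≤ α 0 ∧ α ≠ freeConfig ρ then rawWeight V w ρ kc α else 0 := by
      rw [← ENNReal.tsum_add]
      refine ENNReal.tsum_le_tsum fun α => ?_
      by_cases h : α = freeConfig ρ
      · subst h
        split_ifs <;> simp_all
      · simp [h]
    refine split1.trans ?_
    rw [tsum_ite_eq]
    gcongr
    have hprod : K * Z (j + 1) = ∑' b : (↥(insert 0 (PL ρ)) × Mode) × Config,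
        ENNReal.ofReal C * (elam V w ρ b.1.2 * elam V w ρ (b.1.1 - b.1.2)) *
          (if j + 1 ≤ b.2 0 then rawWeight V w ρ kc b.2 else 0) := by
      rw [ENNReal.tsum_prod']
      simp_rw [ENNReal.tsum_mul_left]
      rw [ENNReal.tsum_mul_right, ENNReal.tsum_prod']
    rw [hprod]
    refine tsum_le_tsum_of_rel _ _
      (fun b α => α + (Finsupp.single 0 1 + Finsupp.single (b.1.1 : Mode) 1) =
        b.2 + split b.1.1 b.1.2) (fun b α α' h h' => ?_) fun α hα => ?_
    · exact add_right_cancel (h.trans h'.symm)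
    · rw [ite_ne_right_iff] at hα
      obtain ⟨⟨hj, hne⟩, h0⟩ := hα
      have hM : InM ρ kc α := by
        by_contra h
        exact h0 (if_neg h)
      obtain ⟨u, p, β, hu, hp, hup, hβ, heq, hlt, hle⟩ := hundo α hM hne
      refine ⟨((⟨u, hu⟩, p), β), heq, ?_⟩
      rw [if_pos ⟨hj, hne⟩, if_pos (by dsimp only; omega), rawWeight_of_inM V w hM,
        rawWeight_of_inM V w hβ, elam, elam, if_pos hp, if_pos hup,
        ← ENNReal.ofReal_mul (alam_nonneg V w ρ p), ← ENNReal.ofReal_mul hC,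
        ← ENNReal.ofReal_mul (mul_nonneg hC
          (mul_nonneg (alam_nonneg V w ρ p) (alam_nonneg V w ρ _)))]
      exact ENNReal.ofReal_le_ofReal hle
  have hfree : rawWeight V w ρ kc (freeConfig ρ) ≠ ⊤ := by
    rw [rawWeight_of_inM V w InM.free]
    exact ENNReal.ofReal_ne_top
  -- Descending induction on `j`, with `i` measuring the distance from the top.
  have hZ : ∀ i j, numParticles ρ < i + j → Z j ≠ ⊤ := by
    intro i
    induction i with
    | zero =>
      intro j hj
      have : Z j = 0 := by
        refine ENNReal.tsum_eq_zero.2 fun α => ?_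
        rw [ite_eq_right_iff]
        intro hle
        refine if_neg fun hM => ?_
        have := apply_zero_le (hM.mem_configs hρ)
        omega
      rw [this]
      exact ENNReal.zero_ne_top
    | succ i ih =>
      intro j hj
      exact ne_top_of_le_ne_top (ENNReal.add_ne_top.2 ⟨hfree, ENNReal.mul_ne_top hK
        (ih (j + 1) (by omega))⟩) (step j)
  have := hZ (numParticles ρ + 1) 0 (by omega)
  simpa [Z] using this

theorem sqWeight_free_pos {ρ : ℝ} (hρ : IsDilute ρ) : 0 < sqWeight V w ρ (freeConfig ρ) := by
  have hv := hρ.vol_pos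
  have hT : softModes ρ (freeConfig ρ) = ∅ := by
    ext u
    simp only [mem_softModes, Finset.notMem_empty, iff_false, not_and]
    intro hu
    have h0 := hρ.ne_zero_of_PL hu
    simp [freeConfig, h0.symm, (neg_ne_zero.2 h0).symm]
  unfold sqWeight softProd
  rw [hT, Finset.prod_empty, freeConfig, occProd_single_zero]
  positivity

/-! ### The trial state as a probability on configurations. -/

/-- The probability of the configuration `α` in the trial state. -/
def prob (ρ kc : ℝ) (α : Config) : ℝ≥0∞ :=
  rawWeight V w ρ kc α / ∑' β, rawWeight V w ρ kc β

/-- Expectation values in the trial state. -/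
def ex (ρ kc : ℝ) (F : Config → ℝ≥0∞) : ℝ≥0∞ := ∑' α, F α * prob V w ρ kc α

theorem tsum_rawWeight_ne_zero {ρ : ℝ} (kc : ℝ) (hρ : IsDilute ρ) :
    ∑' α, rawWeight V w ρ kc α ≠ 0 := by
  intro h
  have := ENNReal.tsum_eq_zero.1 h (freeConfig ρ)
  rw [rawWeight_of_inM V w InM.free, ENNReal.ofReal_eq_zero] at this
  exact absurd this (not_le.2 (sqWeight_free_pos V w hρ))

theorem ex_one {ρ : ℝ} (kc : ℝ) (hρ : IsDilute ρ) (hf : (PL ρ).Finite)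
    (hl : ∑' k, hlam V w ρ k ^ 2 ≠ ⊤) : ex V w ρ kc (fun _ => 1) = 1 := by
  unfold ex prob
  simp_rw [one_mul, div_eq_mul_inv]
  rw [ENNReal.tsum_mul_right]
  exact ENNReal.mul_inv_cancel (tsum_rawWeight_ne_zero V w kc hρ)
    (tsum_rawWeight_ne_top V w kc hρ hf hl)

theorem prob_coeff {ρ : ℝ} (kc : ℝ) (hρ : IsDilute ρ) (hf : (PL ρ).Finite)
    (hl : ∑' k, hlam V w ρ k ^ 2 ≠ ⊤) (α : M ρ kc) :
    prob V w ρ kc α = ENNReal.ofReal (‖coeff V w ρ kc α‖ ^ 2) := by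
  have ht := tsum_rawWeight_ne_top V w kc hρ hf hl
  have h0 := tsum_rawWeight_ne_zero V w kc hρ
  have hsum : ENNReal.ofReal (∑' α : M ρ kc, ‖weight V w ρ α‖ ^ 2) =
      ∑' β, rawWeight V w ρ kc β := by
    have e : ∑' β, rawWeight V w ρ kc β =
        ∑' β : M ρ kc, ENNReal.ofReal (‖weight V w ρ β‖ ^ 2) := by
      rw [← tsum_subtype_eq_of_support_subset (s := M ρ kc)]
      · refine tsum_congr fun β => ?_
        rw [rawWeight_of_inM V w β.2, norm_weight_sq V w hρ]
      · intro β hβ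
        by_contra h
        exact hβ (if_neg h)
    rw [e]
    refine ENNReal.ofReal_tsum_of_nonneg (fun _ => by positivity) ?_
    rw [e] at ht
    have := ENNReal.summable_toReal ht
    refine this.congr fun β => ENNReal.toReal_ofReal (by positivity)
  have hpos : 0 < ∑' α : M ρ kc, ‖weight V w ρ α‖ ^ 2 := by
    rw [← ENNReal.ofReal_pos, hsum]
    exact pos_iff_ne_zero.2 h0
  unfold prob
  rw [rawWeight_of_inM V w α.2, ← hsum, ← ENNReal.ofReal_div_of_pos hpos]
  congr 1
  rw [coeff, norm_mul, mul_pow, norm_weight_sq V w hρ, Complex.norm_real, Real.norm_eq_abs,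
    sq_abs, normConst, inv_pow, Real.sq_sqrt hpos.le]
  field_simp

end

section

variable (V w : Space → ℝ)

/-! ### Expectation values -/

theorem inM_of_prob_ne_zero {ρ kc : ℝ} {α : Config} (h : prob V w ρ kc α ≠ 0) : InM ρ kc α := by
  by_contra hM
  exact h (by rw [prob, rawWeight, if_neg hM, ENNReal.zero_div])

theorem prob_le {ρ kc c : ℝ} (hc : 0 ≤ c) {α β : Config} (hα : InM ρ kc α) (hβ : InM ρ kc β)
    (h : sqWeight V w ρ β ≤ c * sqWeight V w ρ α) :
    prob V w ρ kc β ≤ ENNReal.ofReal c * prob V w ρ kc α := by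
  rw [prob, prob, rawWeight_of_inM V w hα, rawWeight_of_inM V w hβ, ← mul_div_assoc,
    ← ENNReal.ofReal_mul hc]
  gcongr

theorem le_prob {ρ kc c : ℝ} (hc : 0 ≤ c) {α β : Config} (hα : InM ρ kc α) (hβ : InM ρ kc β)
    (h : c * sqWeight V w ρ α ≤ sqWeight V w ρ β) :
    ENNReal.ofReal c * prob V w ρ kc α ≤ prob V w ρ kc β := by
  rw [prob, prob, rawWeight_of_inM V w hα, rawWeight_of_inM V w hβ, ← mul_div_assoc,
    ← ENNReal.ofReal_mul hc]
  gcongr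

theorem ex_mono {ρ kc : ℝ} {F G : Config → ℝ≥0∞} (h : ∀ α, InM ρ kc α → F α ≤ G α) :
    ex V w ρ kc F ≤ ex V w ρ kc G := by
  refine ENNReal.tsum_le_tsum fun α => ?_
  by_cases hM : prob V w ρ kc α = 0
  · simp [hM]
  · gcongr
    exact h α (inM_of_prob_ne_zero V w hM)

theorem ex_add {ρ kc : ℝ} (F G : Config → ℝ≥0∞) :
    ex V w ρ kc (fun α => F α + G α) = ex V w ρ kc F + ex V w ρ kc G := by
  unfold ex
  simp_rw [add_mul]
  exact ENNReal.tsum_add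

theorem ex_const_mul {ρ kc : ℝ} (c : ℝ≥0∞) (F : Config → ℝ≥0∞) :
    ex V w ρ kc (fun α => c * F α) = c * ex V w ρ kc F := by
  unfold ex
  simp_rw [mul_assoc]
  exact ENNReal.tsum_mul_left

theorem ex_tsum {ρ kc : ℝ} {I : Type*} (F : I → Config → ℝ≥0∞) :
    ex V w ρ kc (fun α => ∑' i, F i α) = ∑' i, ex V w ρ kc (F i) := by
  unfold ex
  simp_rw [← ENNReal.tsum_mul_right]
  exact ENNReal.tsum_comm

theorem ex_sum {ρ kc : ℝ} {I : Type*} (s : Finset I) (F : I → Config → ℝ≥0∞) :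
    ex V w ρ kc (fun α => ∑ i ∈ s, F i α) = ∑ i ∈ s, ex V w ρ kc (F i) := by
  unfold ex
  simp_rw [Finset.sum_mul]
  exact Summable.tsum_finsetSum fun _ _ => ENNReal.summable

/-- The exchange argument behind the estimates: `R i β α` says that `β` and `α` differ by one move,
and `i` carries the data of the move that `β` does not determine, such as the momentum `p` of a soft
pair. -/
theorem ex_le_of_rel {ρ kc : ℝ} {I : Type*} (F : Config → ℝ≥0∞) (G : I → Config → ℝ≥0∞)
    (R : I → Config → Config → Prop) (hR : ∀ i β α α', R i β α → R i β α' → α = α')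
    (h : ∀ α, InM ρ kc α → F α ≠ 0 →
      ∃ i β, R i β α ∧ F α * prob V w ρ kc α ≤ G i β * prob V w ρ kc β) :
    ex V w ρ kc F ≤ ∑' i, ex V w ρ kc (G i) := by
  unfold ex
  rw [← ENNReal.tsum_prod]
  refine tsum_le_tsum_of_rel _ _ (fun b α => R b.1 b.2 α) (fun b α α' => hR b.1 b.2 α α')
    fun α hα => ?_
  obtain ⟨i, β, h1, h2⟩ := h α (inM_of_prob_ne_zero V w (right_ne_zero_of_mul hα))
    (left_ne_zero_of_mul hα)
  exact ⟨(i, β), h1, h2⟩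

theorem ex_le_of_rel' {ρ kc : ℝ} (F G : Config → ℝ≥0∞)
    (R : Config → Config → Prop) (hR : ∀ β α α', R β α → R β α' → α = α')
    (h : ∀ α, InM ρ kc α → F α ≠ 0 →
      ∃ β, R β α ∧ F α * prob V w ρ kc α ≤ G β * prob V w ρ kc β) :
    ex V w ρ kc F ≤ ex V w ρ kc G := by
  have := ex_le_of_rel V w (ρ := ρ) (kc := kc) (I := Unit) F (fun _ => G) (fun _ => R)
    (fun _ => hR) fun α h1 h2 => ⟨(), h α h1 h2⟩
  simpa using this

/-! ### Soft pairs are rare -/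

open scoped Classical in
/-- The probability that a soft pair was created from the low momentum `u`. -/
def softP (ρ kc : ℝ) (u : Mode) : ℝ≥0∞ :=
  ex V w ρ kc fun α => if u ∈ softModes ρ α then 1 else 0

/-- Undo the soft pair at `u`. For each `p` the resulting configurations have total probability at
most one, and the factors `λ_p λ_{u-p}` are summed over all `p`, without the restriction by `kc`. -/
theorem softP_le {ρ : ℝ} (kc : ℝ) (hρ : IsDilute ρ) (hf : (PL ρ).Finite)
    (hl : ∑' k, hlam V w ρ k ^ 2 ≠ ⊤) (u : Mode) :
    softP V w ρ kc u ≤ ENNReal.ofReal (4 * ⌈mCut ρ⌉₊ * ρ / vol ρ) *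
      (2 * ∑' k, hlam V w ρ k ^ 2) := by
  classical
  have hv := hρ.vol_pos
  have hr := hρ.pos
  have hc : 0 ≤ 4 * ⌈mCut ρ⌉₊ * ρ / vol ρ := by positivity
  refine le_trans (ex_le_of_rel V w (I := Mode) _
    (fun p _ => ENNReal.ofReal (4 * ⌈mCut ρ⌉₊ * ρ / vol ρ) *
      (hlam V w ρ p * hlam V w ρ (u - p)) * 1)
    (fun p β α => α + (Finsupp.single 0 1 + Finsupp.single u 1) = β + split u p)
    (fun p β α α' h h' => add_right_cancel (h.trans h'.symm)) fun α hM hα => ?_) ?_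
  · have hu : u ∈ softModes ρ α := by
      by_contra h
      exact hα (if_neg h)
    obtain ⟨σ, τ, d⟩ := hM.exists_decomp hρ
    obtain ⟨β, s, he, d'⟩ := d.exists_undo_soft hρ hu
    refine ⟨τ u, β, s.eq, ?_⟩
    rw [if_pos hu, one_mul, mul_one, hlam_of_mem V w (PH_subset_PIH s.high),
      hlam_of_mem V w (PH_subset_PIH s.high'), ← ENNReal.ofReal_mul (alam_nonneg V w ρ _),
      ← ENNReal.ofReal_mul hc]
    have a1 := alam_nonneg V w ρ (τ u)
    have a2 := alam_nonneg V w ρ (u - τ u)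
    exact prob_le V w (by positivity) (d'.inM hρ) hM
      (sqWeight_soft_le V w hρ s he d'.mem (d'.bound u s.low))
  · simp_rw [ex_const_mul, ex_one V w kc hρ hf hl, mul_one]
    rw [ENNReal.tsum_mul_left]
    gcongr
    exact tsum_mul_reflect_le _ _

/-! ### Particles of intermediate and high momentum -/

/-- The largest possible number of strict pairs of momentum `k` in a decomposition of `α`. -/
def hiCount (ρ kc : ℝ) (k : Mode) (α : Config) : ℕ :=
  sSup {j | ∃ σ τ, Decomp ρ kc α σ τ ∧ σ k = j}

theorem bddAbove_hiCount {ρ kc : ℝ} {k : Mode} (hk : k ∈ PIH ρ) (α : Config) :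
    BddAbove {j | ∃ σ τ, Decomp ρ kc α σ τ ∧ σ k = j} := by
  refine ⟨α k, ?_⟩
  rintro _ ⟨σ, τ, d, rfl⟩
  rw [d.high k hk]
  omega

theorem Decomp.le_hiCount {ρ kc : ℝ} {k : Mode} (hk : k ∈ PIH ρ) {α σ : Config} {τ : Mode → Mode}
    (d : Decomp ρ kc α σ τ) : σ k ≤ hiCount ρ kc k α :=
  le_csSup (bddAbove_hiCount hk α) ⟨σ, τ, d, rfl⟩

theorem exists_hiCount {ρ kc : ℝ} (hρ : IsDilute ρ) {k : Mode} (hk : k ∈ PIH ρ) {α : Config}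
    (h : InM ρ kc α) : ∃ σ τ, Decomp ρ kc α σ τ ∧ σ k = hiCount ρ kc k α := by
  obtain ⟨σ, τ, d⟩ := h.exists_decomp hρ
  have hne : {j | ∃ σ τ, Decomp ρ kc α σ τ ∧ σ k = j}.Nonempty := ⟨σ k, σ, τ, d, rfl⟩
  exact Nat.sSup_mem hne (bddAbove_hiCount hk α)

theorem occ_le {ρ kc : ℝ} (hρ : IsDilute ρ) {α : Config} (h : InM ρ kc α) (k : Mode) :
    α k ≤ numParticles ρ := by
  rw [← (mem_configs.1 (h.mem_configs hρ)).2]; exact Finsupp.le_degree k α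

theorem ex_le_const {ρ : ℝ} (kc : ℝ) (hρ : IsDilute ρ) (hf : (PL ρ).Finite)
    (hl : ∑' k, hlam V w ρ k ^ 2 ≠ ⊤) {F : Config → ℝ≥0∞} {c : ℝ≥0∞}
    (h : ∀ α, InM ρ kc α → F α ≤ c) : ex V w ρ kc F ≤ c := by
  refine (ex_mono V w (G := fun _ => c * 1) fun α hα => (h α hα).trans (mul_one c).ge).trans ?_
  rw [ex_const_mul, ex_one V w kc hρ hf hl, mul_one]

/-- Decompositions are not unique, hence the maximal count: removing a pair from a maximal
decomposition leaves one with a single pair less, so the count of the predecessor is smaller by at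
most one. -/
theorem ex_hiCount_le {ρ : ℝ} (kc : ℝ) (hρ : IsDilute ρ) (hf : (PL ρ).Finite)
    (hl : ∑' k, hlam V w ρ k ^ 2 ≠ ⊤) {k : Mode} (hk : k ∈ PIH ρ) :
    ex V w ρ kc (fun α => (hiCount ρ kc k α : ℝ≥0∞)) ≤
      ENNReal.ofReal (ρ ^ 2) * (hlam V w ρ k * hlam V w ρ (-k)) *
        (ex V w ρ kc (fun α => (hiCount ρ kc k α : ℝ≥0∞)) + 1) := by
  have h0 := hρ.ne_zero_of_PIH hk
  rw [← ex_one V w kc hρ hf hl, ← ex_add, ← ex_const_mul]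
  refine ex_le_of_rel' V w _ _ (fun β α => α + Finsupp.single 0 2 = β + pair k)
    (fun β α α' h h' => add_right_cancel (h.trans h'.symm)) fun α hM hα => ?_
  obtain ⟨σ, τ, d, hσ⟩ := exists_hiCount hρ hk hM
  have hpos : 0 < σ k := by
    rw [hσ]
    exact Nat.pos_of_ne_zero (by simpa using hα)
  obtain ⟨β, σ', hβ, d', e⟩ := d.exists_undo_high hρ hk hpos
  have hle := d'.le_hiCount hk
  refine ⟨β, hβ, ?_⟩
  have a1 := alam_nonneg V w ρ k
  have a2 := alam_nonneg V w ρ (-k)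
  rw [hlam_of_mem V w hk, hlam_of_mem V w (neg_mem_PIH.2 hk), ← ENNReal.ofReal_mul a1,
    ← ENNReal.ofReal_mul (by positivity), mul_comm (ENNReal.ofReal _), mul_assoc]
  refine mul_le_mul' ?_ (prob_le V w (by positivity) (d'.inM hρ) hM
    (sqWeight_pair_le V w hρ h0 hβ d'.mem fun u hu => ?_))
  · norm_cast
    omega
  · refine pair_apply_of_ne ?_ ?_
    · exact hρ.ne_of_PL_of_PIH (mem_softModes.1 hu).1 hk
    · exact hρ.ne_of_PL_of_PIH (mem_softModes.1 hu).1 (neg_mem_PIH.2 hk)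

/-- This is `x ≤ r/(1-r)` with `1 - r ≥ 1/2`. Finiteness matters: `x = ⊤` satisfies `h` for every `r
≠ 0`. -/
theorem le_two_mul_of_le_mul_add_one {x r : ℝ≥0∞} (hx : x ≠ ⊤) (hr : r ≤ 2⁻¹)
    (h : x ≤ r * (x + 1)) : x ≤ 2 * r := by
  have hr' : r ≠ ⊤ := ne_top_of_le_ne_top (by simp) hr
  lift x to NNReal using hx
  lift r to NNReal using hr'
  have hr2 : r ≤ 2⁻¹ := by
    rw [← ENNReal.coe_le_coe, ENNReal.coe_inv (by norm_num)]
    simpa using hr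
  have h2 : x ≤ r * (x + 1) := by exact_mod_cast h
  have : x ≤ 2 * r := by
    rw [← NNReal.coe_le_coe] at hr2 h2 ⊢
    push_cast at *
    nlinarith [x.2, r.2, NNReal.coe_nonneg x]
  exact_mod_cast this

theorem tsum_split (u p : Mode) : ∑' k, (split u p k : ℝ≥0∞) = 2 := by
  have : ∀ k, (split u p k : ℝ≥0∞) = (if k = p then 1 else 0) + if k = u - p then 1 else 0 := by
    intro k
    simp [split, Finsupp.single_apply, eq_comm]
  simp_rw [this]
  rw [ENNReal.tsum_add, tsum_ite_eq, tsum_ite_eq]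
  norm_num

/-- The expected number of particles of momentum `k`. -/
def occ (ρ kc : ℝ) (k : Mode) : ℝ≥0∞ := ex V w ρ kc fun α => (α k : ℝ≥0∞)

theorem card_softModes {ρ : ℝ} (hf : (PL ρ).Finite) (α : Config)
    [∀ u, Decidable (u ∈ softModes ρ α)] :
    ((softModes ρ α).card : ℝ≥0∞) = ∑ u ∈ hf.toFinset, if u ∈ softModes ρ α then 1 else 0 := by
  rw [Finset.sum_boole, Finset.filter_mem_eq_inter, Finset.inter_eq_right.2]
  exact fun u hu => hf.mem_toFinset.2 (mem_softModes.1 hu).1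

/-- In any decomposition the strict pairs at `k` number at most `hiCount`, and each soft mode
accounts for two further particles in all. -/
theorem tsum_occ_high_le {ρ : ℝ} (kc : ℝ) (hρ : IsDilute ρ) (hf : (PL ρ).Finite)
    (hl : ∑' k, hlam V w ρ k ^ 2 ≠ ⊤)
    (hsmall : ∀ k ∈ PIH ρ, ENNReal.ofReal (ρ ^ 2) * (hlam V w ρ k * hlam V w ρ (-k)) ≤ 2⁻¹) :
    ∑' k : PIH ρ, occ V w ρ kc k ≤ 4 * (ENNReal.ofReal (ρ ^ 2) * ∑' k, hlam V w ρ k ^ 2) +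
      2 * ∑ u ∈ hf.toFinset, softP V w ρ kc u := by
  classical
  have h1 : ∑' k : PIH ρ, occ V w ρ kc k ≤
      ∑' k : PIH ρ, ex V w ρ kc (fun α => (hiCount ρ kc k α : ℝ≥0∞)) +
        2 * ∑ u ∈ hf.toFinset, softP V w ρ kc u := by
    unfold occ softP
    rw [← ex_tsum, ← ex_tsum, ← ex_sum, ← ex_const_mul, ← ex_add]
    refine ex_mono V w fun α hM => ?_
    obtain ⟨σ, τ, d⟩ := hM.exists_decomp hρ
    calc ∑' k : PIH ρ, (α k : ℝ≥0∞)
        ≤ ∑' k : PIH ρ, ((hiCount ρ kc k α : ℝ≥0∞) +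
          ∑ u ∈ softModes ρ α, (split u (τ u) k : ℝ≥0∞)) := by
          refine ENNReal.tsum_le_tsum fun k => ?_
          have := d.le_hiCount k.2
          rw [d.high k k.2]
          push_cast
          gcongr
      _ = ∑' k : PIH ρ, (hiCount ρ kc k α : ℝ≥0∞) +
          ∑ u ∈ softModes ρ α, ∑' k : PIH ρ, (split u (τ u) k : ℝ≥0∞) := by
          rw [ENNReal.tsum_add, Summable.tsum_finsetSum fun _ _ => ENNReal.summable]
      _ ≤ ∑' k : PIH ρ, (hiCount ρ kc k α : ℝ≥0∞) + ∑ u ∈ softModes ρ α, 2 := by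
          gcongr with u hu
          rw [← tsum_split u (τ u)]
          exact ENNReal.tsum_comp_le_tsum_of_injective Subtype.val_injective _
      _ = _ := by
          rw [Finset.sum_const, nsmul_eq_mul, card_softModes hf, mul_comm]
  refine h1.trans ?_
  gcongr
  calc ∑' k : PIH ρ, ex V w ρ kc (fun α => (hiCount ρ kc k α : ℝ≥0∞))
      ≤ ∑' k : PIH ρ, 2 * (ENNReal.ofReal (ρ ^ 2) * (hlam V w ρ k * hlam V w ρ (-k))) := by
        refine ENNReal.tsum_le_tsum fun k => ?_
        refine le_two_mul_of_le_mul_add_one ?_ (hsmall k k.2) (ex_hiCount_le V w kc hρ hf hl k.2)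
        refine ne_top_of_le_ne_top (b := (numParticles ρ : ℝ≥0∞)) (by simp)
          (ex_le_const V w kc hρ hf hl fun α hM => ?_)
        obtain ⟨σ, τ, d, hσ⟩ := exists_hiCount hρ k.2 hM
        have := occ_le hρ hM k
        rw [d.high k k.2, hσ] at this
        exact_mod_cast (by omega)
    _ ≤ ∑' k : Mode, 2 * (ENNReal.ofReal (ρ ^ 2) * (hlam V w ρ k * hlam V w ρ (-k))) :=
        ENNReal.tsum_comp_le_tsum_of_injective Subtype.val_injective
          (fun k : Mode => 2 * (ENNReal.ofReal (ρ ^ 2) * (hlam V w ρ k * hlam V w ρ (-k))))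
    _ ≤ 2 * (ENNReal.ofReal (ρ ^ 2) * (2 * ∑' k, hlam V w ρ k ^ 2)) := by
        rw [ENNReal.tsum_mul_left, ENNReal.tsum_mul_left]
        gcongr
        simpa only [zero_sub] using tsum_mul_reflect_le (hlam V w ρ) 0
    _ = _ := by ring

/-! ### Particles of low momentum -/

/-- Expectation value of a function of the occupation of a perfectly paired momentum `u`. -/
def pairedEx (ρ kc : ℝ) (u : Mode) (F : ℕ → ℝ≥0∞) : ℝ≥0∞ :=
  ex V w ρ kc fun α => if α (-u) = α u then F (α u) else 0

/-- The ratio `(ρ λ_u)²`. -/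
def ratio (ρ : ℝ) (u : Mode) : ℝ := ρ ^ 2 * (alam V w ρ u * alam V w ρ (-u))

theorem ratio_nonneg (ρ : ℝ) (u : Mode) : 0 ≤ ratio V w ρ u :=
  mul_nonneg (sq_nonneg _) (mul_nonneg (alam_nonneg V w ρ u) (alam_nonneg V w ρ (-u)))

theorem pair_eq_zero_of_paired {ρ : ℝ} {α : Config} {k : Mode} (he : α (-k) = α k) :
    ∀ u ∈ softModes ρ α, pair k u = 0 := by
  intro u hu
  have h := (mem_softModes.1 hu).2
  refine pair_apply_of_ne ?_ ?_
  · rintro rfl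
    omega
  · rintro rfl
    rw [neg_neg] at h
    omega

/-- Undo one pair at `±u` and bound the condensate factor by one. At occupation zero there is
nothing to undo, hence `F 0 = 0`. -/
theorem pairedEx_le {ρ : ℝ} (kc : ℝ) (hρ : IsDilute ρ) {u : Mode} (hu : u ∈ PL ρ) (F : ℕ → ℝ≥0∞)
    (hF : F 0 = 0) :
    pairedEx V w ρ kc u F ≤
      ENNReal.ofReal (ratio V w ρ u) * pairedEx V w ρ kc u fun j => F (j + 1) := by
  have h0 := hρ.ne_zero_of_PL hu
  unfold pairedEx
  rw [← ex_const_mul]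
  refine ex_le_of_rel' V w _ _ (fun β α => α + Finsupp.single 0 2 = β + pair u)
    (fun β α α' h h' => add_right_cancel (h.trans h'.symm)) fun α hM hα => ?_
  rw [ite_ne_right_iff] at hα
  obtain ⟨he, hFα⟩ := hα
  have hpos : 0 < α u := by
    rw [Nat.pos_iff_ne_zero]
    intro h
    rw [h] at hFα
    exact hFα hF
  obtain ⟨σ, τ, d⟩ := hM.exists_decomp hρ
  obtain ⟨β, hβ, d', e1, e2⟩ := d.exists_undo_low hρ hu hpos he
  refine ⟨β, hβ, ?_⟩
  rw [if_pos he, if_pos e2, mul_comm (ENNReal.ofReal _), mul_assoc, ← e1]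
  gcongr
  exact prob_le V w (ratio_nonneg V w ρ u) (d'.inM hρ) hM
    (sqWeight_pair_le V w hρ h0 hβ d'.mem (pair_eq_zero_of_paired e2))

/-- Here a pair is created, which requires an occupation below the cut-off and two condensate
particles. The latter needs no separate condition, since `condFactor` vanishes when they are
missing. -/
theorem le_pairedEx {ρ : ℝ} (kc : ℝ) (hρ : IsDilute ρ) {u : Mode} (hu : u ∈ PL ρ) (F : ℕ → ℝ≥0∞) :
    ENNReal.ofReal (ratio V w ρ u) * ex V w ρ kc (fun α => if α (-u) = α u ∧ α u < ⌈mCut ρ⌉₊ then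
      F (α u + 1) * ENNReal.ofReal (condFactor ρ α) else 0) ≤ pairedEx V w ρ kc u F := by
  have h0 := hρ.ne_zero_of_PL hu
  unfold pairedEx
  rw [← ex_const_mul]
  refine ex_le_of_rel' V w _ _ (fun β α => β + Finsupp.single 0 2 = α + pair u)
    (fun β α α' h h' => add_right_cancel (h.symm.trans h')) fun α hM hα => ?_
  have hα := (ite_ne_right_iff.1 (right_ne_zero_of_mul hα))
  obtain ⟨⟨he, hlt⟩, hne⟩ := hα
  have hy : condFactor ρ α ≠ 0 := by
    intro h
    rw [h] at hne
    simp at hne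
  have h2 : 2 ≤ α 0 := by
    by_contra hlt
    apply hy
    unfold condFactor
    have : α 0 = 0 ∨ α 0 = 1 := by omega
    rcases this with h | h <;> simp [h]
  obtain ⟨β, hβ⟩ : ∃ β, β + Finsupp.single 0 2 = α + pair u := by
    refine ⟨α + pair u - Finsupp.single 0 2, tsub_add_cancel_of_le ?_⟩
    rw [Finsupp.single_le_iff, Finsupp.add_apply]
    omega
  obtain ⟨σ, τ, d⟩ := hM.exists_decomp hρ
  have d' := (decomp_pair_low_iff hρ hu hβ hlt (by omega)).2 d
  obtain ⟨e1, e2⟩ := pair_apply_neg_add h0 hβ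
  rw [pair_apply_self h0] at e1 e2
  refine ⟨β, hβ, ?_⟩
  rw [if_pos ⟨he, hlt⟩, if_pos (by omega), e1]
  have hr := ratio_nonneg V w ρ u
  have hy' := condFactor_nonneg (ρ := ρ) α
  calc _ = F (α u + 1) * (ENNReal.ofReal (ratio V w ρ u * condFactor ρ α) * prob V w ρ kc α) := by
        rw [ENNReal.ofReal_mul hr]; ring
    _ ≤ _ := by
        gcongr
        refine le_prob V w (mul_nonneg hr hy') hM (d'.inM hρ) ?_
        rw [sqWeight_pair' V w hρ h0 hβ (pair_eq_zero_of_paired he)]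
        exact le_rfl

theorem pairedEx_ge_le_pow {ρ : ℝ} (kc : ℝ) (hρ : IsDilute ρ) (hf : (PL ρ).Finite)
    (hl : ∑' k, hlam V w ρ k ^ 2 ≠ ⊤) {u : Mode} (hu : u ∈ PL ρ) (j : ℕ) :
    pairedEx V w ρ kc u (fun i => if j ≤ i then 1 else 0) ≤
      ENNReal.ofReal (ratio V w ρ u) ^ j := by
  induction j with
  | zero =>
    rw [pow_zero]
    refine ex_le_const V w kc hρ hf hl fun α _ => ?_
    split_ifs <;> simp
  | succ j ih =>
    refine (pairedEx_le V w kc hρ hu _ (by simp)).trans ?_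
    rw [pow_succ']
    gcongr
    simpa using ih

/-- The expected occupation of a low momentum that is perfectly paired. -/
def lowOcc (ρ kc : ℝ) (u : Mode) : ℝ≥0∞ := pairedEx V w ρ kc u fun j => j

theorem lowOcc_le_occ (ρ kc : ℝ) (u : Mode) : lowOcc V w ρ kc u ≤ occ V w ρ kc u := by
  refine ex_mono V w fun α _ => ?_
  split_ifs <;> simp

theorem lowOcc_add_one {ρ : ℝ} (kc : ℝ) (u : Mode) :
    pairedEx V w ρ kc u (fun j => ((j + 1 : ℕ) : ℝ≥0∞)) =
      lowOcc V w ρ kc u + pairedEx V w ρ kc u fun _ => 1 := by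
  unfold lowOcc pairedEx
  rw [← ex_add]
  congr 1
  funext α
  split_ifs <;> simp

theorem one_le_paired_add {ρ : ℝ} (kc : ℝ) (hρ : IsDilute ρ) (hf : (PL ρ).Finite)
    (hl : ∑' k, hlam V w ρ k ^ 2 ≠ ⊤) {u : Mode} (hu : u ∈ PL ρ) :
    1 ≤ pairedEx V w ρ kc u (fun _ => 1) + (softP V w ρ kc u + softP V w ρ kc (-u)) := by
  classical
  refine (ex_one V w kc hρ hf hl).symm.le.trans ?_
  unfold pairedEx softP
  rw [← ex_add, ← ex_add]
  refine ex_mono V w fun α hM => ?_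
  obtain ⟨σ, τ, d⟩ := hM.exists_decomp hρ
  rcases d.low u hu with h | h | h
  · rw [if_pos h]; exact le_add_right le_rfl
  · rw [if_pos (mem_softModes.2 ⟨hu, h⟩)]
    exact le_add_left le_self_add
  · rw [if_pos (mem_softModes.2 ⟨neg_mem_PL.2 hu, by rwa [neg_neg]⟩)]
    exact le_add_left le_add_self

theorem occ_le_lowOcc_add {ρ : ℝ} (kc : ℝ) (hρ : IsDilute ρ) {u : Mode} (hu : u ∈ PL ρ) :
    occ V w ρ kc u ≤ lowOcc V w ρ kc u +
      ⌈mCut ρ⌉₊ * (softP V w ρ kc u + softP V w ρ kc (-u)) := by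
  classical
  unfold occ lowOcc pairedEx softP
  rw [← ex_add, ← ex_const_mul, ← ex_add]
  refine ex_mono V w fun α hM => ?_
  obtain ⟨σ, τ, d⟩ := hM.exists_decomp hρ
  have hb : (α u : ℝ≥0∞) ≤ ⌈mCut ρ⌉₊ := by exact_mod_cast d.bound u hu
  rcases d.low u hu with h | h | h
  · rw [if_pos h]; exact le_self_add
  · rw [if_pos (mem_softModes.2 ⟨hu, h⟩)]
    refine le_add_left (hb.trans ?_)
    exact (mul_one (_ : ℝ≥0∞)).ge.trans (mul_le_mul' le_rfl le_self_add)
  · rw [if_pos (show -u ∈ softModes ρ α from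
      mem_softModes.2 ⟨neg_mem_PL.2 hu, by rwa [neg_neg]⟩)]
    refine le_add_left (hb.trans ?_)
    exact (mul_one (_ : ℝ≥0∞)).ge.trans (mul_le_mul' le_rfl le_add_self)

/-- `pairedEx_le` for `F j = j` is a self-consistent inequality `x ≤ r (x + 1)`, that is `x ≤
r/(1-r)`. -/
theorem lowOcc_le {ρ : ℝ} (kc : ℝ) (hρ : IsDilute ρ) (hf : (PL ρ).Finite)
    (hl : ∑' k, hlam V w ρ k ^ 2 ≠ ⊤) {u : Mode} (hu : u ∈ PL ρ) :
    lowOcc V w ρ kc u ≤ ENNReal.ofReal (ratio V w ρ u) * (lowOcc V w ρ kc u + 1) := by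
  refine (pairedEx_le V w kc hρ hu _ (by simp)).trans ?_
  rw [lowOcc_add_one]
  gcongr
  refine ex_le_const V w kc hρ hf hl fun α _ => ?_
  split_ifs <;> simp

/-- The expected relative depletion of the condensate. -/
def depletion (ρ kc : ℝ) : ℝ≥0∞ :=
  ex V w ρ kc fun α => ENNReal.ofReal (1 - condFactor ρ α)

/-- The converse of `lowOcc_le`. It loses the configurations at the cut-off, where no pair can be
added, the condensate factor in the others, and those with a soft defect at `±u`. -/
theorem le_lowOcc {ρ : ℝ} (kc : ℝ) (hρ : IsDilute ρ) (hf : (PL ρ).Finite)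
    (hl : ∑' k, hlam V w ρ k ^ 2 ≠ ⊤) {u : Mode} (hu : u ∈ PL ρ) :
    ENNReal.ofReal (ratio V w ρ u) * (lowOcc V w ρ kc u + 1) ≤ lowOcc V w ρ kc u +
      ENNReal.ofReal (ratio V w ρ u) *
        ((⌈mCut ρ⌉₊ + 1) * ENNReal.ofReal (ratio V w ρ u) ^ ⌈mCut ρ⌉₊ +
          ⌈mCut ρ⌉₊ * depletion V w ρ kc + (softP V w ρ kc u + softP V w ρ kc (-u))) := by
  set m := ⌈mCut ρ⌉₊
  set r := ENNReal.ofReal (ratio V w ρ u)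
  have h1 := one_le_paired_add V w kc hρ hf hl hu
  have h2 := le_pairedEx V w kc hρ hu fun j => j
  have h3 := pairedEx_ge_le_pow V w kc hρ hf hl hu m
  have key : pairedEx V w ρ kc u (fun j => ((j + 1 : ℕ) : ℝ≥0∞)) ≤
      ex V w ρ kc (fun α => if α (-u) = α u ∧ α u < m then
        ((α u + 1 : ℕ) : ℝ≥0∞) * ENNReal.ofReal (condFactor ρ α) else 0) +
      m * depletion V w ρ kc +
      (m + 1) * pairedEx V w ρ kc u (fun i => if m ≤ i then 1 else 0) := by
    unfold pairedEx depletion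
    rw [← ex_const_mul, ← ex_const_mul, ← ex_add, ← ex_add]
    refine ex_mono V w fun α hM => ?_
    obtain ⟨σ, τ, d⟩ := hM.exists_decomp hρ
    have hb := d.bound u hu
    by_cases he : α (-u) = α u
    · by_cases hlt : α u < m
      · rw [if_pos he, if_pos ⟨he, hlt⟩]
        refine le_add_right ?_
        have hy0 := condFactor_nonneg (ρ := ρ) α
        have hy1 := condFactor_le_one hρ d.mem
        have e : (1 : ℝ≥0∞) = ENNReal.ofReal (condFactor ρ α) +
            ENNReal.ofReal (1 - condFactor ρ α) := by
          rw [← ENNReal.ofReal_add hy0 (by linarith)]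
          simp
        calc ((α u + 1 : ℕ) : ℝ≥0∞) = ((α u + 1 : ℕ) : ℝ≥0∞) * ENNReal.ofReal (condFactor ρ α) +
              ((α u + 1 : ℕ) : ℝ≥0∞) * ENNReal.ofReal (1 - condFactor ρ α) := by
              rw [← mul_add, ← e, mul_one]
          _ ≤ _ := by
              gcongr
              exact hlt
      · have hm : α u = m := le_antisymm hb (not_lt.1 hlt)
        rw [if_pos he, if_pos he]
        dsimp only
        rw [if_pos hm.ge, hm]
        push_cast
        rw [mul_one]
        exact le_add_self
    · simp [he]
  calc r * (lowOcc V w ρ kc u + 1)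
      ≤ r * (pairedEx V w ρ kc u (fun j => ((j + 1 : ℕ) : ℝ≥0∞)) +
        (softP V w ρ kc u + softP V w ρ kc (-u))) := by
        rw [lowOcc_add_one, add_assoc]
        gcongr
    _ ≤ r * ((ex V w ρ kc (fun α => if α (-u) = α u ∧ α u < m then
        ((α u + 1 : ℕ) : ℝ≥0∞) * ENNReal.ofReal (condFactor ρ α) else 0) +
      m * depletion V w ρ kc + (m + 1) * r ^ m) +
        (softP V w ρ kc u + softP V w ρ kc (-u))) := by
        gcongr
        exact key.trans (by gcongr)
    _ = r * ex V w ρ kc (fun α => if α (-u) = α u ∧ α u < m then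
        ((α u + 1 : ℕ) : ℝ≥0∞) * ENNReal.ofReal (condFactor ρ α) else 0) +
        r * ((m + 1) * r ^ m + m * depletion V w ρ kc +
          (softP V w ρ kc u + softP V w ρ kc (-u))) := by ring
    _ ≤ _ := by
        gcongr
        exact h2

theorem numParticles_le_sum_occ {ρ : ℝ} {α : Config} (hf : (PL ρ).Finite)
    (h : α ∈ configs ρ) :
    (numParticles ρ : ℝ≥0∞) ≤ α 0 + (∑ u ∈ hf.toFinset, (α u : ℝ≥0∞) +
      ∑' k : PIH ρ, (α k : ℝ≥0∞)) := by
  classical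
  have hd : (numParticles ρ : ℝ≥0∞) = ∑' k, (α k : ℝ≥0∞) := by
    rw [← (mem_configs.1 h).2, Finsupp.degree_apply, tsum_eq_sum (s := α.support), Nat.cast_sum]
    intro k hk
    rw [Finsupp.notMem_support_iff.1 hk, Nat.cast_zero]
  have e1 : (α 0 : ℝ≥0∞) = ∑' k : Mode, if k = 0 then (α 0 : ℝ≥0∞) else 0 :=
    (tsum_ite_eq (0 : Mode) fun _ => (α 0 : ℝ≥0∞)).symm
  have e2 : ∑ u ∈ hf.toFinset, (α u : ℝ≥0∞) = ∑' k, ∑ u ∈ hf.toFinset,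
      if k = u then (α u : ℝ≥0∞) else 0 := by
    rw [Summable.tsum_finsetSum fun _ _ => ENNReal.summable]
    exact Finset.sum_congr rfl fun u _ => (tsum_ite_eq u fun _ => (α u : ℝ≥0∞)).symm
  rw [hd, e1, e2, tsum_subtype (PIH ρ) fun k => (α k : ℝ≥0∞), ← ENNReal.tsum_add,
    ← ENNReal.tsum_add]
  refine ENNReal.tsum_le_tsum fun k => ?_
  by_cases hk : k ∈ PAll ρ
  · rcases mem_PAll.1 hk with h | h | h
    · rw [if_pos h, h]
      exact le_self_add
    · rw [Finset.sum_ite_eq, if_pos (hf.mem_toFinset.2 h)]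
      exact le_add_left le_self_add
    · rw [Set.indicator_of_mem h]
      exact le_add_left le_add_self
  · rw [(mem_configs.1 h).1 k hk, Nat.cast_zero]
    exact zero_le

theorem depletion_le {ρ : ℝ} (kc : ℝ) (hρ : IsDilute ρ) (hf : (PL ρ).Finite)
    (hl : ∑' k, hlam V w ρ k ^ 2 ≠ ⊤) :
    depletion V w ρ kc ≤ ENNReal.ofReal (ρ * vol ρ)⁻¹ *
      (2 * (∑ u ∈ hf.toFinset, occ V w ρ kc u + ∑' k : PIH ρ, occ V w ρ kc k) + 3) := by
  have hpos : 0 < ρ * vol ρ := mul_pos hρ.pos hρ.vol_pos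
  have e3 : (3 : ℝ≥0∞) = 3 * ex V w ρ kc (fun _ => 1) := by
    rw [ex_one V w kc hρ hf hl, mul_one]
  rw [e3]
  unfold depletion occ
  rw [← ex_tsum, ← ex_sum, ← ex_add, ← ex_const_mul, ← ex_const_mul, ← ex_add, ← ex_const_mul]
  refine ex_mono V w fun α hM => ?_
  have hα := hM.mem_configs hρ
  set S : ℝ≥0∞ := ∑ u ∈ hf.toFinset, (α u : ℝ≥0∞) + ∑' k : PIH ρ, (α k : ℝ≥0∞)
  have hS : ENNReal.ofReal ((numParticles ρ : ℝ) - α 0) ≤ S := by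
    rw [ENNReal.ofReal_sub _ (Nat.cast_nonneg _), ENNReal.ofReal_natCast, ENNReal.ofReal_natCast,
      tsub_le_iff_left]
    exact numParticles_le_sum_occ hf hα
  have hfl : ρ * vol ρ < numParticles ρ + 1 := Nat.lt_floor_add_one _
  have h0 : (α 0 : ℝ) ≤ ρ * vol ρ := occ_zero_le hρ hα
  have h1 : (α 0 : ℝ) ≤ numParticles ρ := by exact_mod_cast apply_zero_le hα
  have hc0 : (0 : ℝ) ≤ α 0 := Nat.cast_nonneg _
  calc ENNReal.ofReal (1 - condFactor ρ α)
      ≤ ENNReal.ofReal ((ρ * vol ρ)⁻¹ * (2 * ((numParticles ρ : ℝ) - α 0) + 3)) := by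
        refine ENNReal.ofReal_le_ofReal ?_
        unfold condFactor
        set x := ρ * vol ρ
        rw [inv_mul_eq_div, sub_le_iff_le_add, div_add_div _ _ hpos.ne' (by positivity),
          le_div_iff₀ (by positivity)]
        -- Since `x² - α(0)² ≤ 2x(x - α(0))` and `x < N + 1`, rounding costs `2x`; the `-1` in
        -- `α(0)(α(0)-1)` costs `α(0) ≤ x`. This is the `3`.
        have : 0 ≤ x * (x * (2 * ((numParticles ρ : ℝ) - α 0) + 3) + α 0 * (α 0 - 1) - x ^ 2) := by
          refine mul_nonneg hpos.le ?_
          nlinarith [mul_pos hpos (sub_pos.2 hfl), sq_nonneg (x - α 0)]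
        nlinarith
    _ = ENNReal.ofReal (ρ * vol ρ)⁻¹ *
        (2 * ENNReal.ofReal ((numParticles ρ : ℝ) - α 0) + 3 * 1) := by
        rw [ENNReal.ofReal_mul (by positivity), ENNReal.ofReal_add (by linarith) (by norm_num),
          ENNReal.ofReal_mul (by norm_num)]
        norm_num
    _ ≤ _ := by gcongr

/-! ### From extended nonnegative expectations back to convergent real sums. -/

theorem occ_ne_top {ρ : ℝ} (kc : ℝ) (hρ : IsDilute ρ) (hf : (PL ρ).Finite)
    (hl : ∑' k, hlam V w ρ k ^ 2 ≠ ⊤) (k : Mode) : occ V w ρ kc k ≠ ⊤ :=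
  ne_top_of_le_ne_top (b := (numParticles ρ : ℝ≥0∞)) (by simp)
    (ex_le_const V w kc hρ hf hl fun α hM => by exact_mod_cast occ_le hρ hM k)

theorem ex_ofReal_eq_tsum {ρ : ℝ} (kc : ℝ) (hρ : IsDilute ρ) (hf : (PL ρ).Finite)
    (hl : ∑' k, hlam V w ρ k ^ 2 ≠ ⊤) (F : Config → ℝ) (hF : ∀ α, 0 ≤ F α) :
    ex V w ρ kc (fun α => ENNReal.ofReal (F α)) =
      ∑' α : M ρ kc, ENNReal.ofReal (F α * ‖coeff V w ρ kc α‖ ^ 2) := by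
  unfold ex
  rw [← tsum_subtype_eq_of_support_subset (s := M ρ kc)]
  · refine tsum_congr fun α => ?_
    rw [ENNReal.ofReal_mul (hF _), prob_coeff V w kc hρ hf hl]
  · intro α hα
    exact inM_of_prob_ne_zero V w (right_ne_zero_of_mul hα)

theorem summable_Q {ρ : ℝ} (kc : ℝ) (hρ : IsDilute ρ) (hf : (PL ρ).Finite)
    (hl : ∑' k, hlam V w ρ k ^ 2 ≠ ⊤) (k : Mode) :
    (Summable fun α : M ρ kc => ((α : Config) k : ℝ) * ‖coeff V w ρ kc α‖ ^ 2) ∧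
      Q V w ρ kc k = (occ V w ρ kc k).toReal := by
  have h := ex_ofReal_eq_tsum V w kc hρ hf hl (fun α => (α k : ℝ)) fun α => Nat.cast_nonneg _
  simp_rw [ENNReal.ofReal_natCast] at h
  have ht : ∑' α : M ρ kc, ENNReal.ofReal (((α : Config) k : ℝ) * ‖coeff V w ρ kc α‖ ^ 2) ≠ ⊤ := by
    rw [← h]
    exact occ_ne_top V w kc hρ hf hl k
  have e : ∀ α : M ρ kc, (ENNReal.ofReal (((α : Config) k : ℝ) * ‖coeff V w ρ kc α‖ ^ 2)).toReal =
      ((α : Config) k : ℝ) * ‖coeff V w ρ kc α‖ ^ 2 := fun α =>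
    ENNReal.toReal_ofReal (by positivity)
  refine ⟨(ENNReal.summable_toReal ht).congr e, ?_⟩
  rw [occ, h, ENNReal.tsum_toReal_eq fun _ => ENNReal.ofReal_ne_top, Q]
  exact tsum_congr fun α => (e α).symm

theorem hasSum_coeff {ρ : ℝ} (kc : ℝ) (hρ : IsDilute ρ) (hf : (PL ρ).Finite)
    (hl : ∑' k, hlam V w ρ k ^ 2 ≠ ⊤) :
    HasSum (fun α : M ρ kc => ‖coeff V w ρ kc α‖ ^ 2) 1 := by
  have h := ex_ofReal_eq_tsum V w kc hρ hf hl (fun _ => 1) fun α => zero_le_one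
  simp_rw [ENNReal.ofReal_one, one_mul] at h
  rw [ex_one V w kc hρ hf hl] at h
  have ht : ∑' α : M ρ kc, ENNReal.ofReal (‖coeff V w ρ kc α‖ ^ 2) ≠ ⊤ := by
    rw [← h]
    exact ENNReal.one_ne_top
  have e : ∀ α : M ρ kc, (ENNReal.ofReal (‖coeff V w ρ kc α‖ ^ 2)).toReal =
      ‖coeff V w ρ kc α‖ ^ 2 := fun α => ENNReal.toReal_ofReal (by positivity)
  have := ENNReal.hasSum_toReal ht
  simp_rw [e] at this
  rwa [← tsum_congr e, ← ENNReal.tsum_toReal_eq fun _ => ENNReal.ofReal_ne_top, ← h,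
    ENNReal.toReal_one] at this

end

/-! ### Riemann sums over lattices -/

/-- The points of the lattice `(a ℤ)³`. -/
def lattPt (a : ℝ) (n : Mode) : Space := WithLp.toLp 2 fun i => a * (n i : ℝ)

/-- The label of the cell of the lattice `(a ℤ)³` that contains `y`. -/
def cell (a : ℝ) (y : Space) : Mode := fun i => ⌊y i / a⌋

theorem measurable_cell (a : ℝ) : Measurable (cell a) := by
  refine measurable_pi_lambda _ fun i => ?_
  unfold cell
  have : Measurable fun y : Space => y i := by fun_prop
  exact (this.div_const a).floor

theorem volume_cell {a : ℝ} (ha : 0 < a) (n : Mode) :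
    volume (cell a ⁻¹' {n}) = ENNReal.ofReal a ^ 3 := by
  have e : cell a ⁻¹' {n} = (WithLp.ofLp : Space → Fin 3 → ℝ) ⁻¹'
      (Set.pi Set.univ fun i => Set.Ico (a * n i) (a * n i + a)) := by
    ext y
    simp only [Set.mem_preimage, Set.mem_singleton_iff, Set.mem_pi, Set.mem_univ, true_imp_iff,
      Set.mem_Ico, cell, funext_iff]
    refine forall_congr' fun i => ?_
    rw [Int.floor_eq_iff, le_div_iff₀ ha, div_lt_iff₀ ha]
    constructor <;> rintro ⟨h1, h2⟩ <;> constructor <;> linarith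
  rw [e, (PiLp.volume_preserving_ofLp (Fin 3)).measure_preimage
    (MeasurableSet.univ_pi fun i => measurableSet_Ico).nullMeasurableSet, Real.volume_pi_Ico]
  simp

theorem map_cell {a : ℝ} (ha : 0 < a) :
    (volume : Measure Space).map (cell a) = ENNReal.ofReal a ^ 3 • Measure.count := by
  refine Measure.ext_of_singleton fun n => ?_
  rw [Measure.map_apply (measurable_cell a) (measurableSet_singleton n), volume_cell ha]
  simp

/-- A lattice sum becomes the integral of a step function, to which dominated convergence applies.
-/
theorem lintegral_cell {a : ℝ} (ha : 0 < a) (F : Mode → ℝ≥0∞) :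
    ∫⁻ y, F (cell a y) = ENNReal.ofReal a ^ 3 * ∑' n, F n := by
  rw [← lintegral_map (f := F) (measurable_of_countable F) (measurable_cell a), map_cell ha,
    lintegral_smul_measure, lintegral_count, smul_eq_mul]

theorem norm_lattPt_cell_sub_le {a : ℝ} (ha : 0 < a) (y : Space) :
    ‖lattPt a (cell a y) - y‖ ≤ 2 * a := by
  rw [EuclideanSpace.norm_eq, Real.sqrt_le_left (by positivity), Fin.sum_univ_three]
  have h : ∀ i, ‖(lattPt a (cell a y) - y) i‖ ^ 2 ≤ a ^ 2 := by
    intro i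
    have h1 := Int.floor_le (y i / a)
    have h2 := Int.lt_floor_add_one (y i / a)
    rw [le_div_iff₀ ha] at h1
    rw [div_lt_iff₀ ha] at h2
    rw [Real.norm_eq_abs, sq_abs]
    refine sq_le_sq' ?_ ?_
    · simp [lattPt, cell]; linarith
    · simp [lattPt, cell]; linarith
  have := h 0
  have := h 1
  have := h 2
  nlinarith

theorem tendsto_lattPt_cell {ι : Type*} {l : Filter ι} {a : ι → ℝ} (ha : ∀ᶠ i in l, 0 < a i)
    (ha0 : Tendsto a l (𝓝 0)) (y : Space) :
    Tendsto (fun i => lattPt (a i) (cell (a i) y)) l (𝓝 y) := by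
  rw [tendsto_iff_norm_sub_tendsto_zero]
  refine squeeze_zero' (Eventually.of_forall fun _ => norm_nonneg _) ?_
    (by simpa using ha0.const_mul 2)
  filter_upwards [ha] with i hi using norm_lattPt_cell_sub_le hi y

/-- An integrable radial function that dominates the momentum distributions. -/
def domFun (z : ℝ) : ℝ := (z ^ 2 * (1 + z ^ 2))⁻¹

theorem domFun_nonneg (z : ℝ) : 0 ≤ domFun z := by
  unfold domFun; positivity

theorem domFun_le_of_le {x z : ℝ} (hx : 0 < x) (h : x ≤ 2 * z) : domFun z ≤ 16 * domFun x := by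
  unfold domFun
  have hz : 0 < z := by linarith
  rw [← div_eq_mul_inv, inv_eq_one_div, div_le_div_iff₀ (by positivity) (by positivity), one_mul]
  have h1 : x ^ 2 ≤ 4 * z ^ 2 := by nlinarith
  have h2 : 1 + x ^ 2 ≤ 4 * (1 + z ^ 2) := by nlinarith
  calc x ^ 2 * (1 + x ^ 2) ≤ (4 * z ^ 2) * (4 * (1 + z ^ 2)) := by gcongr
    _ = _ := by ring

/-- In polar coordinates the Jacobian cancels the singularity and leaves `1/(1 + x²)`. -/
theorem integrable_domFun : Integrable fun y : Space => domFun ‖y‖ := by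
  rw [integrable_fun_norm_addHaar]
  refine (integrable_inv_one_add_sq.integrableOn (s := Set.Ioi 0)).congr_fun ?_ measurableSet_Ioi
  intro x hx
  have hx : 0 < x := hx
  simp only [finrank_euclideanSpace, Fintype.card_fin, domFun, smul_eq_mul]
  field_simp

/-- Dominated convergence for Riemann sums over the lattices `(a ℤ)³`, `a → 0`. -/
theorem tendsto_riemann_sum {ι : Type*} {l : Filter ι} [l.IsCountablyGenerated] {a cut : ι → ℝ}
    (ha : ∀ᶠ i in l, 0 < a i) (hcut : ∀ᶠ i in l, 2 * a i ≤ cut i)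
    {F : ι → Mode → ℝ≥0∞} {G : Space → ℝ≥0∞} {C : ℝ} (hC : 0 ≤ C)
    (hF : ∀ᶠ i in l, ∀ n, F i n ≠ 0 → cut i ≤ ‖lattPt (a i) n‖ ∧
      F i n ≤ ENNReal.ofReal (C * domFun ‖lattPt (a i) n‖))
    (hG : ∀ y, y ≠ 0 → Tendsto (fun i => F i (cell (a i) y)) l (𝓝 (G y))) :
    Tendsto (fun i => ENNReal.ofReal (a i) ^ 3 * ∑' n, F i n) l (𝓝 (∫⁻ y, G y)) := by
  have h : Tendsto (fun i => ∫⁻ y, F i (cell (a i) y)) l (𝓝 (∫⁻ y, G y)) := by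
    refine tendsto_lintegral_filter_of_dominated_convergence
      (fun y => ENNReal.ofReal (16 * C * domFun ‖y‖)) ?_ ?_ ?_ ?_
    · exact Eventually.of_forall fun i => (measurable_of_countable (F i)).comp (measurable_cell _)
    · filter_upwards [ha, hcut, hF] with i hi hc hF
      have hne : ∀ᵐ y : Space, y ≠ 0 := by
        simp [ae_iff]
      filter_upwards [hne] with y hy
      by_cases h0 : F i (cell (a i) y) = 0
      · rw [h0]; exact zero_le
      obtain ⟨h1, h2⟩ := hF _ h0
      refine h2.trans (ENNReal.ofReal_le_ofReal ?_)
      have h3 := norm_lattPt_cell_sub_le hi y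
      have h4 : ‖y‖ ≤ ‖lattPt (a i) (cell (a i) y)‖ + ‖lattPt (a i) (cell (a i) y) - y‖ := by
        rw [norm_sub_rev]
        exact norm_le_norm_add_norm_sub' _ _
      -- The cut-off `2a ≤ cut` absorbs the diameter of the cell: `‖y‖ ≤ z + 2a ≤ 2z` at the lattice
      -- point of length `z`. Without it the cells at the origin would not be dominated.
      have h5 := domFun_le_of_le (norm_pos_iff.2 hy)
        (show ‖y‖ ≤ 2 * ‖lattPt (a i) (cell (a i) y)‖ by linarith)
      nlinarith
    · rw [← ofReal_integral_eq_lintegral_ofReal (integrable_domFun.const_mul _)]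
      · exact ENNReal.ofReal_ne_top
      · exact Eventually.of_forall fun y => mul_nonneg (by positivity) (domFun_nonneg _)
    · have hne : ∀ᵐ y : Space, y ≠ 0 := by
        simp [ae_iff]
      filter_upwards [hne] with y hy using hG y hy
  refine h.congr' ?_
  filter_upwards [ha] with i hi using lintegral_cell hi (F i)

/-! ### The momentum distribution -/

/-- The square root in the Bogoliubov coefficients. -/
def bogRoot (b q : ℝ) : ℝ := √(1 + b * (q ^ 2)⁻¹)

/-- The squared Bogoliubov coefficient. -/
def bogRatio (b q : ℝ) : ℝ := ((1 - bogRoot b q) / (1 + bogRoot b q)) ^ 2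

/-- The momentum distribution `r / (1 - r)`. -/
def bogDist (b q : ℝ) : ℝ := (bogRoot b q - 1) ^ 2 / (4 * bogRoot b q)

theorem one_le_bogRoot {b : ℝ} (hb : 0 ≤ b) (q : ℝ) : 1 ≤ bogRoot b q := by
  unfold bogRoot
  rw [Real.one_le_sqrt]
  have : 0 ≤ b * (q ^ 2)⁻¹ := by positivity
  linarith

theorem bogRatio_nonneg (b q : ℝ) : 0 ≤ bogRatio b q := sq_nonneg _

theorem bogDist_nonneg {b : ℝ} (hb : 0 ≤ b) (q : ℝ) : 0 ≤ bogDist b q := by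
  have := one_le_bogRoot hb q
  unfold bogDist
  positivity

theorem one_sub_bogRatio {b : ℝ} (hb : 0 ≤ b) (q : ℝ) :
    1 - bogRatio b q = 4 * bogRoot b q / (1 + bogRoot b q) ^ 2 := by
  have := one_le_bogRoot hb q
  unfold bogRatio
  have : 1 + bogRoot b q ≠ 0 := by positivity
  field_simp
  ring

theorem bogRatio_lt_one {b : ℝ} (hb : 0 ≤ b) (q : ℝ) : bogRatio b q < 1 := by
  have h := one_sub_bogRatio hb q
  have := one_le_bogRoot hb q
  have : 0 < 1 - bogRatio b q := by rw [h]; positivity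
  linarith

theorem bogDist_eq {b : ℝ} (hb : 0 ≤ b) (q : ℝ) :
    bogDist b q = bogRatio b q / (1 - bogRatio b q) := by
  have := one_le_bogRoot hb q
  rw [one_sub_bogRatio hb q]
  unfold bogDist bogRatio
  have : 1 + bogRoot b q ≠ 0 := by positivity
  have : bogRoot b q ≠ 0 := by positivity
  field_simp
  ring

/-- With `s = bogRoot` the left side is `(s² - 1)²/(16 s²)`, free of square roots. Bounding
`r/(1-r)²` rather than `r/(1-r)` gives a dominating function for the cut-off tail as well. -/
theorem bogDist_div_le {b : ℝ} (hb : 0 ≤ b) {q : ℝ} (hq : 0 < q) :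
    bogDist b q / (1 - bogRatio b q) ≤ (b ^ 2 + b) * domFun q := by
  have h1 := one_le_bogRoot hb q
  have hs : bogRoot b q ^ 2 = 1 + b * (q ^ 2)⁻¹ := Real.sq_sqrt (by positivity)
  have e : bogDist b q / (1 - bogRatio b q) = b ^ 2 / (16 * q ^ 2 * (q ^ 2 + b)) := by
    have hp : 0 < bogRoot b q := by linarith
    rw [one_sub_bogRatio hb q, bogDist]
    have : (bogRoot b q - 1) ^ 2 / (4 * bogRoot b q) / (4 * bogRoot b q / (1 + bogRoot b q) ^ 2) =
        (bogRoot b q ^ 2 - 1) ^ 2 / (16 * bogRoot b q ^ 2) := by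
      field_simp
      ring
    rw [this, hs]
    field_simp
    ring
  rw [e, domFun, ← div_eq_mul_inv, div_le_div_iff₀ (by positivity) (by positivity)]
  have h2 : 0 < q ^ 2 := by positivity
  have : b ^ 2 * (1 + q ^ 2) ≤ (b ^ 2 + b) * (16 * (q ^ 2 + b)) := by
    have : 0 ≤ b ^ 2 * q ^ 2 := by positivity
    have : 0 ≤ b * q ^ 2 := by positivity
    have : 0 ≤ b ^ 3 := by positivity
    nlinarith
  nlinarith

theorem bogDist_le {b : ℝ} (hb : 0 ≤ b) {q : ℝ} (hq : 0 < q) :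
    bogDist b q ≤ (b ^ 2 + b) * domFun q := by
  refine le_trans ?_ (bogDist_div_le hb hq)
  rw [le_div_iff₀ (by linarith [bogRatio_lt_one hb q])]
  exact mul_le_of_le_one_right (bogDist_nonneg hb q) (by linarith [bogRatio_nonneg b q])

theorem continuousAt_bogRoot (b : ℝ) {q : ℝ} (hq : q ≠ 0) : ContinuousAt (bogRoot b) q := by
  unfold bogRoot
  have : q ^ 2 ≠ 0 := by positivity
  fun_prop (disch := assumption)

theorem continuousAt_bogRatio {b : ℝ} (hb : 0 ≤ b) {q : ℝ} (hq : q ≠ 0) :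
    ContinuousAt (bogRatio b) q := by
  have h := continuousAt_bogRoot b hq
  have := one_le_bogRoot hb q
  have h2 : 1 + bogRoot b q ≠ 0 := by positivity
  unfold bogRatio
  exact ((continuousAt_const.sub h).div (continuousAt_const.add h) h2).pow 2

theorem continuousAt_bogDist {b : ℝ} (hb : 0 ≤ b) {q : ℝ} (hq : q ≠ 0) :
    ContinuousAt (bogDist b) q := by
  have h := continuousAt_bogRoot b hq
  have := one_le_bogRoot hb q
  have h2 : 4 * bogRoot b q ≠ 0 := by positivity
  unfold bogDist
  exact ((h.sub continuousAt_const).pow 2).div (continuousAt_const.mul h) h2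

/-- A primitive of `q² r/(1-r)`. -/
def bogPrim (b q : ℝ) : ℝ := -(1 / 12) * ((√(q ^ 2 + b) - q) ^ 2 * (√(q ^ 2 + b) + 2 * q))

theorem hasDerivAt_bogPrim {b : ℝ} (hb : 0 ≤ b) {q : ℝ} (hq : 0 < q) :
    HasDerivAt (bogPrim b) (q ^ 2 * bogDist b q) q := by
  have hpos : 0 < q ^ 2 + b := by positivity
  have ht : HasDerivAt (fun q => √(q ^ 2 + b)) (2 * q / (2 * √(q ^ 2 + b))) q := by
    have := ((hasDerivAt_pow 2 q).add_const b).sqrt hpos.ne'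
    simpa using this
  have h1 := (((ht.sub (hasDerivAt_id q)).pow 2).mul (ht.add ((hasDerivAt_id q).const_mul 2))).const_mul
    (-(1 / 12 : ℝ))
  have hs : bogRoot b q = √(q ^ 2 + b) / q := by
    unfold bogRoot
    rw [show 1 + b * (q ^ 2)⁻¹ = (q ^ 2 + b) / q ^ 2 by field_simp, Real.sqrt_div hpos.le,
      Real.sqrt_sq hq.le]
  have htp : 0 < √(q ^ 2 + b) := Real.sqrt_pos.2 hpos
  refine h1.congr_deriv ?_
  rw [bogDist, hs]
  simp only [Pi.sub_apply, Pi.pow_apply, id, Pi.add_apply]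
  -- Only the derivative `q/t` of `t` has entered; what remains is an identity for all positive `t`,
  -- without `t² = q² + b`.
  generalize √(q ^ 2 + b) = t at htp
  field_simp
  ring

/-- With `t = √(q² + b)` one has `t - q = b/(t + q)`, so the primitive is `O(b²/q)`. -/
theorem tendsto_bogPrim {b : ℝ} (hb : 0 ≤ b) : Tendsto (bogPrim b) atTop (𝓝 0) := by
  have hz : Tendsto (fun q : ℝ => b ^ 2 / q) atTop (𝓝 0) := tendsto_const_nhds.div_atTop tendsto_id
  refine squeeze_zero_norm' ?_ hz
  filter_upwards [eventually_gt_atTop 0] with q hq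
  have hpos : 0 < q ^ 2 + b := by positivity
  have h1 : √(q ^ 2 + b) ^ 2 = q ^ 2 + b := Real.sq_sqrt hpos.le
  have hge : q ≤ √(q ^ 2 + b) := Real.le_sqrt_of_sq_le (by linarith)
  unfold bogPrim
  generalize √(q ^ 2 + b) = t at *
  have hb' : b = (t - q) * (t + q) := by nlinarith
  have htp : 0 < t := by linarith
  have h2 : 0 ≤ (t - q) ^ 2 * (t + 2 * q) := by positivity
  rw [norm_mul, Real.norm_of_nonneg h2, Real.norm_eq_abs, abs_neg, abs_of_pos (by norm_num),
    le_div_iff₀ hq, hb', mul_pow]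
  have h3 : (t + 2 * q) * q ≤ 2 * (t + q) ^ 2 := by nlinarith
  have h4 : 0 ≤ (t - q) ^ 2 := sq_nonneg _
  nlinarith [mul_le_mul_of_nonneg_left h3 h4, mul_nonneg h4 (sq_nonneg (t + q))]

theorem integral_sq_mul_bogDist {b : ℝ} (hb : 0 ≤ b) :
    IntegrableOn (fun q => q ^ 2 * bogDist b q) (Set.Ioi 0) ∧
      ∫ q in Set.Ioi 0, q ^ 2 * bogDist b q = √b ^ 3 / 12 := by
  have hc : ContinuousWithinAt (bogPrim b) (Set.Ici 0) 0 := by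
    unfold bogPrim
    fun_prop
  have hd : ∀ q ∈ Set.Ioi (0 : ℝ), HasDerivAt (bogPrim b) (q ^ 2 * bogDist b q) q :=
    fun q hq => hasDerivAt_bogPrim hb hq
  have hn : ∀ q ∈ Set.Ioi (0 : ℝ), 0 ≤ q ^ 2 * bogDist b q :=
    fun q _ => mul_nonneg (sq_nonneg _) (bogDist_nonneg hb q)
  refine ⟨integrableOn_Ioi_deriv_of_nonneg hc hd hn (tendsto_bogPrim hb), ?_⟩
  rw [integral_Ioi_of_hasDerivAt_of_nonneg hc hd hn (tendsto_bogPrim hb)]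
  simp [bogPrim]
  ring

/-- The radial integral is `-bogPrim b 0 = √b³/12`, and the unit sphere contributes `4π`. -/
theorem lintegral_bogDist {b : ℝ} (hb : 0 ≤ b) :
    ∫⁻ y : Space, ENNReal.ofReal (bogDist b ‖y‖) = ENNReal.ofReal (Real.pi / 3 * √b ^ 3) := by
  obtain ⟨hi, he⟩ := integral_sq_mul_bogDist hb
  have hint : Integrable fun y : Space => bogDist b ‖y‖ := by
    rw [integrable_fun_norm_addHaar]
    simpa [finrank_euclideanSpace] using hi
  rw [← ofReal_integral_eq_lintegral_ofReal hint
    (Eventually.of_forall fun y => bogDist_nonneg hb _), integral_fun_norm_addHaar]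
  congr 1
  simp only [finrank_euclideanSpace, Fintype.card_fin, smul_eq_mul, Nat.add_one_sub_one, he,
    Measure.real, EuclideanSpace.volume_ball_fin_three]
  rw [ENNReal.toReal_mul, ENNReal.toReal_ofReal (by positivity)]
  simp
  ring

/-! ### The scattering solution in momentum space -/

section

variable {V w : Space → ℝ}

theorem g0_eq (V w : Space → ℝ) : g0 V w = ∫ x, gFun V w x := by
  unfold g0 scatteringLength gFun
  have := Real.pi_pos
  field_simp

theorem gFun_nonneg (hV : IsPotential V) (hw : IsScatteringSolution V w) (x : Space) :
    0 ≤ gFun V w x :=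
  mul_nonneg (hV.nonneg x) (by linarith [hw.lt_one x])

theorem g0_nonneg (hV : IsPotential V) (hw : IsScatteringSolution V w) : 0 ≤ g0 V w := by
  rw [g0_eq]
  exact integral_nonneg (gFun_nonneg hV hw)

/-- Positivity of `g` gives `|g_p| ≤ g₀`. The resulting decay `p⁻²` suffices: its square is summable
at large momenta in three dimensions. -/
theorem abs_wHat_le (hV : IsPotential V) (hw : IsScatteringSolution V w) (p : Space) :
    |wHat V w p| ≤ g0 V w / ‖p‖ ^ 2 := by
  unfold wHat
  rw [abs_div, abs_of_nonneg (sq_nonneg ‖p‖)]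
  gcongr
  refine (Complex.abs_re_le_norm _).trans ?_
  unfold fourier
  refine (norm_integral_le_integral_norm _).trans ?_
  rw [g0_eq]
  refine le_of_eq (integral_congr_ae (Eventually.of_forall fun x => ?_))
  simp only [norm_mul, Complex.norm_real, Real.norm_of_nonneg (gFun_nonneg hV hw x)]
  rw [show -(Complex.I * ((⟪p, x⟫_ℝ : ℝ) : ℂ)) = ((-⟪p, x⟫_ℝ : ℝ) : ℂ) * Complex.I by
    push_cast; ring, Complex.norm_exp_ofReal_mul_I, one_mul]

end

/-! ### Rescaled momenta -/

/-- The lattice spacing of the momenta in units of `ρ^{1/2}`. -/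
def step (ρ : ℝ) : ℝ := 2 * Real.pi * ρ ^ (13 / 24 : ℝ)

/-- The length of a momentum in units of `ρ^{1/2}`. -/
def relMom (ρ : ℝ) (n : Mode) : ℝ := ‖lattPt (step ρ) n‖

theorem step_pos {ρ : ℝ} (hρ : 0 < ρ) : 0 < step ρ := by
  have := Real.pi_pos
  unfold step
  positivity

theorem norm_momentum {ρ : ℝ} (hρ : 0 < ρ) (n : Mode) :
    ‖momentum ρ n‖ = ρ ^ (1 / 2 : ℝ) * relMom ρ n := by
  have h : momentum ρ n = ρ ^ (1 / 2 : ℝ) • lattPt (step ρ) n := by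
    ext i
    simp only [momentum, lattPt, step, side, PiLp.smul_apply, smul_eq_mul]
    rw [Real.rpow_neg hρ.le, div_inv_eq_mul,
      show (25 / 24 : ℝ) = 1 / 2 + 13 / 24 by norm_num, Real.rpow_add hρ]
    ring
  rw [h, norm_smul, Real.norm_of_nonneg (by positivity), relMom]

theorem inv_vol {ρ : ℝ} (hρ : 0 < ρ) : (vol ρ)⁻¹ = ρ ^ (25 / 8 : ℝ) := by
  unfold vol side
  rw [← Real.rpow_natCast, ← Real.rpow_mul hρ.le, ← Real.rpow_neg hρ.le]
  norm_num

theorem step_cube {ρ : ℝ} (hρ : 0 < ρ) : step ρ ^ 3 = (2 * Real.pi) ^ 3 * ρ ^ (13 / 8 : ℝ) := by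
  unfold step
  rw [mul_pow, ← Real.rpow_natCast (ρ ^ (13 / 24 : ℝ)), ← Real.rpow_mul hρ.le]
  norm_num

/-- The prefactor in the theorem is exactly the cell volume of the rescaled momentum lattice over
`(2π)³`. -/
theorem normalization_eq {ρ : ℝ} (hρ : 0 < ρ) :
    ρ ^ (-(3 / 2) : ℝ) * (vol ρ)⁻¹ = ((2 * Real.pi) ^ 3)⁻¹ * step ρ ^ 3 := by
  have := Real.pi_pos
  rw [inv_vol hρ, step_cube hρ, ← mul_assoc, inv_mul_cancel₀ (by positivity), one_mul,
    ← Real.rpow_add hρ]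
  norm_num

/-- Since `17/8 = 1/2 + 13/8`, the inverse particle number is a cell volume with `ρ^{1/2}` to spare.
This gain beats the powers of `ε_L⁻¹` in the error terms. -/
theorem inv_mul_vol_le {ρ : ℝ} (hρ : 0 < ρ) :
    (ρ * vol ρ)⁻¹ ≤ ρ ^ (1 / 2 : ℝ) * step ρ ^ 3 := by
  have h : (ρ * vol ρ)⁻¹ = ρ ^ (1 / 2 : ℝ) * ρ ^ (13 / 8 : ℝ) := by
    rw [mul_inv, inv_vol hρ, ← Real.rpow_neg_one, ← Real.rpow_add hρ, ← Real.rpow_add hρ]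
    norm_num
  rw [h, step_cube hρ]
  have h1 : (1 : ℝ) ≤ (2 * Real.pi) ^ 3 := one_le_pow₀ (by linarith [Real.pi_gt_three])
  gcongr
  exact le_mul_of_one_le_left (by positivity) h1

theorem mem_PL_iff {ρ : ℝ} (hρ : 0 < ρ) {n : Mode} :
    n ∈ PL ρ ↔ epsL ρ ≤ relMom ρ n ∧ relMom ρ n ≤ (epsL ρ)⁻¹ := by
  have h : 0 < ρ ^ (1 / 2 : ℝ) := by positivity
  rw [PL, Set.mem_ofPred_eq, norm_momentum hρ, mul_comm (epsL ρ), mul_comm (etaL ρ)⁻¹,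
    mul_le_mul_iff_right₀ h, mul_le_mul_iff_right₀ h]
  rfl

theorem relMom_of_PIH {ρ : ℝ} (hρ : IsDilute ρ) {n : Mode} (hn : n ∈ PIH ρ) :
    (epsL ρ)⁻¹ < relMom ρ n := by
  have h : 0 < ρ ^ (1 / 2 : ℝ) := hρ.sqrt_pos
  have h1 : (etaL ρ)⁻¹ * ρ ^ (1 / 2 : ℝ) < ‖momentum ρ n‖ := by
    rcases hn with hn | hn
    · exact hn.1
    · exact hρ.gap.trans hn
  rw [norm_momentum hρ.pos, mul_comm, mul_lt_mul_iff_right₀ h] at h1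
  exact h1

theorem relMom_neg (ρ : ℝ) (n : Mode) : relMom ρ (-n) = relMom ρ n := by
  have : lattPt (step ρ) (-n) = -lattPt (step ρ) n := by
    ext i
    simp [lattPt]
  rw [relMom, this, norm_neg, relMom]

section

variable {V w : Space → ℝ}

theorem alam_low {ρ : ℝ} (hρ : 0 < ρ) {u : Mode} (hu : u ∈ PL ρ) :
    alam V w ρ u = |(1 - bogRoot (4 * g0 V w) (relMom ρ u)) /
      (1 + bogRoot (4 * g0 V w) (relMom ρ u))| * ρ⁻¹ := by
  have h : (ρ ^ (1 / 2 : ℝ)) ^ 2 = ρ := by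
    rw [← Real.rpow_natCast, ← Real.rpow_mul hρ.le]
    norm_num
  have e : 1 + 4 * ρ * g0 V w * (‖momentum ρ u‖ ^ 2)⁻¹ =
      1 + 4 * g0 V w * (relMom ρ u ^ 2)⁻¹ := by
    rw [norm_momentum hρ, mul_pow, h, mul_inv]
    field_simp
  rw [alam, lam, if_pos hu, e, abs_mul, abs_of_pos (inv_pos.2 hρ)]
  rfl

theorem ratio_low {ρ : ℝ} (hρ : 0 < ρ) {u : Mode} (hu : u ∈ PL ρ) :
    ratio V w ρ u = bogRatio (4 * g0 V w) (relMom ρ u) := by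
  rw [ratio, alam_low hρ hu, alam_low hρ (neg_mem_PL.2 hu), relMom_neg, bogRatio,
    ← sq_abs ((1 - bogRoot (4 * g0 V w) (relMom ρ u)) / (1 + bogRoot (4 * g0 V w) (relMom ρ u)))]
  field_simp

theorem alam_high_le (hV : IsPotential V) (hw : IsScatteringSolution V w) {ρ : ℝ}
    (hρ : IsDilute ρ) {k : Mode} (hk : k ∈ PIH ρ) :
    ρ * alam V w ρ k ≤ g0 V w / relMom ρ k ^ 2 := by
  have h : (ρ ^ (1 / 2 : ℝ)) ^ 2 = ρ := by
    rw [← Real.rpow_natCast, ← Real.rpow_mul hρ.pos.le]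
    norm_num
  have h1 := abs_wHat_le hV hw (momentum ρ k)
  have h2 : 0 < relMom ρ k := (inv_pos.2 hρ.epsL_pos).trans (relMom_of_PIH hρ hk)
  rw [norm_momentum hρ.pos, mul_pow, h] at h1
  rw [alam, lam, if_neg (hρ.notMem_PL_of_PIH hk), abs_neg]
  calc ρ * |wHat V w (momentum ρ k)| ≤ ρ * (g0 V w / (ρ * relMom ρ k ^ 2)) := by
        gcongr
        exact hρ.pos.le
    _ = _ := by
        have := hρ.pos
        field_simp

end

/-! ### Limits of small density -/

theorem tendsto_rpow_zero {s : ℝ} (hs : 0 < s) :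
    Tendsto (fun ρ : ℝ => ρ ^ s) (𝓝[>] 0) (𝓝 0) := by
  have := (Real.continuousAt_rpow_const 0 s (Or.inr hs.le)).tendsto
  rw [Real.zero_rpow hs.ne'] at this
  exact this.mono_left nhdsWithin_le_nhds

theorem eventually_pos : ∀ᶠ ρ : ℝ in 𝓝[>] 0, 0 < ρ := self_mem_nhdsWithin

theorem eventually_lt_one : ∀ᶠ ρ : ℝ in 𝓝[>] 0, ρ < 1 :=
  nhdsWithin_le_nhds (eventually_lt_nhds one_pos)

theorem tendsto_step : Tendsto step (𝓝[>] 0) (𝓝 0) := by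
  have := (tendsto_rpow_zero (s := 13 / 24) (by norm_num)).const_mul (2 * Real.pi)
  rw [mul_zero] at this
  exact this

theorem tendsto_epsL : Tendsto epsL (𝓝[>] 0) (𝓝 0) :=
  tendsto_rpow_zero (by norm_num [etaExp])

theorem epsL_pos {ρ : ℝ} (hρ : 0 < ρ) : 0 < epsL ρ := Real.rpow_pos_of_pos hρ _

theorem tendsto_inv_epsL : Tendsto (fun ρ => (epsL ρ)⁻¹) (𝓝[>] 0) atTop := by
  refine tendsto_inv_nhdsGT_zero.comp (tendsto_nhdsWithin_iff.2 ⟨tendsto_epsL, ?_⟩)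
  filter_upwards [eventually_pos] with ρ hρ using epsL_pos hρ

theorem epsL_le_one {ρ : ℝ} (h0 : 0 < ρ) (h1 : ρ < 1) : epsL ρ ≤ 1 :=
  Real.rpow_le_one h0.le h1.le (by norm_num [etaExp])

theorem eventually_isDilute : ∀ᶠ ρ : ℝ in 𝓝[>] 0, IsDilute ρ := by
  filter_upwards [eventually_pos, eventually_lt_one] with ρ h0 h1
  refine ⟨h0, ?_⟩
  unfold etaL epsH etaExp
  rw [← Real.rpow_neg h0.le, ← Real.rpow_add h0]
  exact Real.rpow_lt_rpow_of_exponent_gt h0 h1 (by norm_num)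

theorem eventually_step_le : ∀ᶠ ρ : ℝ in 𝓝[>] 0, 2 * step ρ ≤ epsL ρ := by
  have h := (tendsto_rpow_zero (s := 13 / 24 - 1 / 200) (by norm_num)).const_mul (4 * Real.pi)
  rw [mul_zero] at h
  filter_upwards [eventually_pos, h.eventually_lt_const one_pos] with ρ h0 h1
  have e : ρ ^ (13 / 24 : ℝ) = ρ ^ (13 / 24 - 1 / 200 : ℝ) * ρ ^ (1 / 200 : ℝ) := by
    rw [← Real.rpow_add h0]
    norm_num
  unfold step epsL etaExp
  rw [e]
  have : 0 < ρ ^ (1 / 200 : ℝ) := by positivity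
  nlinarith

theorem two_mul_step_le_inv_epsL {ρ : ℝ} (hc : 2 * step ρ ≤ epsL ρ) (h0 : 0 < ρ) (h1 : ρ < 1) :
    2 * step ρ ≤ (epsL ρ)⁻¹ :=
  hc.trans ((epsL_le_one h0 h1).trans ((one_le_inv₀ (epsL_pos h0)).2 (epsL_le_one h0 h1)))

theorem eventually_step_pos : ∀ᶠ ρ : ℝ in 𝓝[>] 0, 0 < step ρ := by
  filter_upwards [eventually_pos] with ρ hρ using step_pos hρ

theorem tendsto_relMom_cell (y : Space) :
    Tendsto (fun ρ => relMom ρ (cell (step ρ) y)) (𝓝[>] 0) (𝓝 ‖y‖) :=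
  (tendsto_lattPt_cell eventually_step_pos tendsto_step y).norm

theorem eventually_cell_mem_PL {y : Space} (hy : y ≠ 0) :
    ∀ᶠ ρ in 𝓝[>] 0, cell (step ρ) y ∈ PL ρ := by
  have h := tendsto_relMom_cell y
  have hy' := norm_pos_iff.2 hy
  filter_upwards [eventually_pos, h.eventually_lt_const (lt_add_one ‖y‖),
    h.eventually_const_lt (half_lt_self hy'), tendsto_epsL.eventually_lt_const (half_pos hy'),
    tendsto_inv_epsL.eventually_gt_atTop (‖y‖ + 1)] with ρ h0 h1 h2 h3 h4
  exact (mem_PL_iff h0).2 ⟨by linarith, by linarith⟩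

/-- Riemann sums over the low momenta. -/
theorem tendsto_low_sum {f : ℝ → ℝ → ℝ≥0∞} {g : ℝ → ℝ≥0∞} {C : ℝ} (hC : 0 ≤ C)
    (hf : ∀ᶠ ρ in 𝓝[>] 0, ∀ q, 0 < q → f ρ q ≤ ENNReal.ofReal (C * domFun q))
    (hg : ∀ q₀, 0 < q₀ → ∀ q : ℝ → ℝ, Tendsto q (𝓝[>] 0) (𝓝 q₀) →
      Tendsto (fun ρ => f ρ (q ρ)) (𝓝[>] 0) (𝓝 (g q₀))) :
    Tendsto (fun ρ => ENNReal.ofReal (step ρ) ^ 3 *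
      ∑' n, (PL ρ).indicator (fun n => f ρ (relMom ρ n)) n) (𝓝[>] 0) (𝓝 (∫⁻ y : Space, g ‖y‖)) := by
  refine tendsto_riemann_sum (cut := epsL) eventually_step_pos eventually_step_le hC ?_
    fun y hy => ?_
  · filter_upwards [eventually_pos, hf] with ρ h0 hf n hn
    have hmem : n ∈ PL ρ := Set.mem_of_indicator_ne_zero hn
    rw [Set.indicator_of_mem hmem]
    have h1 := (mem_PL_iff h0).1 hmem
    exact ⟨h1.1, hf _ ((epsL_pos h0).trans_le h1.1)⟩
  · refine (hg ‖y‖ (norm_pos_iff.2 hy) _ (tendsto_relMom_cell y)).congr' ?_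
    filter_upwards [eventually_cell_mem_PL hy] with ρ hρ
    rw [Set.indicator_of_mem hρ]

/-- Riemann sums over the intermediate and high momenta. -/
theorem tendsto_high_sum {C : ℝ} (hC : 0 ≤ C) :
    Tendsto (fun ρ => ENNReal.ofReal (step ρ) ^ 3 *
      ∑' n, {n | (epsL ρ)⁻¹ < relMom ρ n}.indicator
        (fun n => ENNReal.ofReal (C * domFun (relMom ρ n))) n) (𝓝[>] 0) (𝓝 0) := by
  have := tendsto_riemann_sum (a := step) (l := 𝓝[>] 0) (cut := fun ρ => (epsL ρ)⁻¹)
    (F := fun ρ n => {n | (epsL ρ)⁻¹ < relMom ρ n}.indicator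
        (fun n => ENNReal.ofReal (C * domFun (relMom ρ n))) n) (G := 0) eventually_step_pos
    ?_ hC ?_ fun y hy => ?_
  · simpa using this
  · filter_upwards [eventually_step_le, eventually_pos, eventually_lt_one] with ρ h h0 h1
      using two_mul_step_le_inv_epsL h h0 h1
  · filter_upwards with ρ n hn
    have hmem := Set.mem_of_indicator_ne_zero hn
    rw [Set.indicator_of_mem hmem]
    exact ⟨le_of_lt hmem, le_rfl⟩
  -- A fixed `y` eventually lies inside the growing ball of radius `ε_L⁻¹`, so the pointwise limit
  -- is zero.
  · refine tendsto_const_nhds.congr' ?_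
    filter_upwards [(tendsto_relMom_cell y).eventually_lt_const (lt_add_one ‖y‖),
      tendsto_inv_epsL.eventually_gt_atTop (‖y‖ + 1)] with ρ h1 h2
    rw [Set.indicator_of_notMem]
    · rfl
    · rw [Set.mem_ofPred_eq]
      linarith

/-! ### Asymptotics of the sums over the low momenta -/

theorem mCut_eq {ρ : ℝ} (hρ : 0 < ρ) : mCut ρ = (epsL ρ)⁻¹ := Real.rpow_neg hρ.le _

theorem ceil_mCut_le {ρ : ℝ} (h0 : 0 < ρ) (h1 : ρ < 1) :
    (⌈mCut ρ⌉₊ : ℝ) ≤ 2 * (epsL ρ)⁻¹ := by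
  have h := (one_le_inv₀ (epsL_pos h0)).2 (epsL_le_one h0 h1)
  rw [mCut_eq h0]
  have := Nat.ceil_lt_add_one (a := (epsL ρ)⁻¹) (by linarith)
  linarith

theorem tendsto_ceil_mCut : Tendsto (fun ρ => ⌈mCut ρ⌉₊) (𝓝[>] 0) atTop := by
  refine tendsto_nat_ceil_atTop.comp (tendsto_inv_epsL.congr' ?_)
  filter_upwards [eventually_pos] with ρ hρ using (mCut_eq hρ).symm

/-- `r^m` is the smallest of the `m + 1` terms of a partial geometric sum. The bound is uniform in
`m`, as domination of the tail requires. -/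
theorem add_one_mul_pow_le {r : ℝ} (h0 : 0 ≤ r) (h1 : r < 1) (m : ℕ) :
    (m + 1) * r ^ m ≤ (1 - r)⁻¹ := by
  have h : (m + 1) * r ^ m ≤ ∑ i ∈ Finset.range (m + 1), r ^ i := by
    calc (m + 1) * r ^ m = ∑ i ∈ Finset.range (m + 1), r ^ m := by simp
      _ ≤ _ := Finset.sum_le_sum fun i hi =>
        pow_le_pow_of_le_one h0 h1.le (by have := Finset.mem_range.1 hi; omega)
  refine h.trans ?_
  rw [← tsum_geometric_of_lt_one h0 h1]
  exact (summable_geometric_of_lt_one h0 h1).sum_le_tsum _ fun i _ => pow_nonneg h0 i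

/-- A rescaled sum over the low momenta. -/
def lowSum (ρ : ℝ) (f : Mode → ℝ≥0∞) : ℝ≥0∞ :=
  ENNReal.ofReal (step ρ) ^ 3 * ∑' n, (PL ρ).indicator f n

theorem lowSum_mono {ρ : ℝ} {f g : Mode → ℝ≥0∞} (h : ∀ n ∈ PL ρ, f n ≤ g n) :
    lowSum ρ f ≤ lowSum ρ g := by
  unfold lowSum
  exact mul_le_mul' le_rfl (ENNReal.tsum_le_tsum fun n => Set.indicator_le_indicator' (h n))

theorem lowSum_add (ρ : ℝ) (f g : Mode → ℝ≥0∞) :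
    lowSum ρ (fun n => f n + g n) = lowSum ρ f + lowSum ρ g := by
  unfold lowSum
  simp_rw [Set.indicator_add]
  rw [ENNReal.tsum_add, mul_add]

theorem lowSum_mul_const (ρ : ℝ) (f : Mode → ℝ≥0∞) (c : ℝ≥0∞) :
    lowSum ρ (fun n => f n * c) = lowSum ρ f * c := by
  unfold lowSum
  rw [mul_assoc, ← ENNReal.tsum_mul_right]
  congr 2
  funext n
  by_cases h : n ∈ PL ρ <;> simp [h]

theorem lowSum_eq_sum {ρ : ℝ} (hf : (PL ρ).Finite) (f : Mode → ℝ≥0∞) :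
    lowSum ρ f = ENNReal.ofReal (step ρ) ^ 3 * ∑ u ∈ hf.toFinset, f u := by
  unfold lowSum
  rw [tsum_eq_sum (s := hf.toFinset)]
  · congr 1
    exact Finset.sum_congr rfl fun u hu => Set.indicator_of_mem (hf.mem_toFinset.1 hu) _
  · intro n hn
    exact Set.indicator_of_notMem (fun h => hn (hf.mem_toFinset.2 h)) _

theorem tendsto_lowSum_bogDist {b : ℝ} (hb : 0 ≤ b) :
    Tendsto (fun ρ => lowSum ρ fun n => ENNReal.ofReal (bogDist b (relMom ρ n))) (𝓝[>] 0)
      (𝓝 (ENNReal.ofReal (Real.pi / 3 * √b ^ 3))) := by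
  rw [← lintegral_bogDist hb]
  refine tendsto_low_sum (f := fun _ q => ENNReal.ofReal (bogDist b q))
    (g := fun q => ENNReal.ofReal (bogDist b q)) (C := b ^ 2 + b) (by positivity) ?_ ?_
  · exact Eventually.of_forall fun ρ q hq => ENNReal.ofReal_le_ofReal (bogDist_le hb hq)
  · intro q₀ hq₀ q hq
    exact ENNReal.tendsto_ofReal ((continuousAt_bogDist hb hq₀.ne').tendsto.comp hq)

theorem tendsto_lowSum_tail {b : ℝ} (hb : 0 ≤ b) :
    Tendsto (fun ρ => lowSum ρ fun n => ENNReal.ofReal (bogDist b (relMom ρ n) *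
      ((⌈mCut ρ⌉₊ + 1) * bogRatio b (relMom ρ n) ^ ⌈mCut ρ⌉₊))) (𝓝[>] 0) (𝓝 0) := by
  have := tendsto_low_sum (f := fun ρ q => ENNReal.ofReal (bogDist b q *
      ((⌈mCut ρ⌉₊ + 1) * bogRatio b q ^ ⌈mCut ρ⌉₊))) (g := fun _ => 0) (C := b ^ 2 + b)
      (by positivity) ?_ ?_
  · rwa [lintegral_zero] at this
  · refine Eventually.of_forall fun ρ q hq => ENNReal.ofReal_le_ofReal ?_
    refine le_trans ?_ (bogDist_div_le hb hq)
    rw [div_eq_mul_inv]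
    exact mul_le_mul_of_nonneg_left
      (add_one_mul_pow_le (bogRatio_nonneg b q) (bogRatio_lt_one hb q) _) (bogDist_nonneg hb q)
  · intro q₀ hq₀ q hq
    suffices h : Tendsto (fun ρ => (⌈mCut ρ⌉₊ + 1) * bogRatio b (q ρ) ^ ⌈mCut ρ⌉₊) (𝓝[>] 0)
        (𝓝 0) by
      have h' := ((continuousAt_bogDist hb hq₀.ne').tendsto.comp hq).mul h
      rw [mul_zero] at h'
      simpa using ENNReal.tendsto_ofReal h'
    -- The momentum varies with `ρ`; a fixed `x < 1` above the nearby ratios gives one geometric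
    -- sequence to compare with.
    obtain ⟨x, hx1, hx2⟩ := exists_between (bogRatio_lt_one hb q₀)
    have hx0 : 0 ≤ x := (bogRatio_nonneg b q₀).trans hx1.le
    have hlim : Tendsto (fun n : ℕ => ((n : ℝ) + 1) * x ^ n) atTop (𝓝 0) := by
      have h1 := tendsto_self_mul_const_pow_of_lt_one hx0 hx2
      have h2 := tendsto_pow_atTop_nhds_zero_of_lt_one hx0 hx2
      simpa [add_mul] using h1.add h2
    refine squeeze_zero' (Eventually.of_forall fun ρ => ?_) ?_ (hlim.comp tendsto_ceil_mCut)
    · have := bogRatio_nonneg b (q ρ)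
      positivity
    · filter_upwards [((continuousAt_bogRatio hb hq₀.ne').tendsto.comp hq).eventually_lt_const hx1]
        with ρ hρ
      have := bogRatio_nonneg b (q ρ)
      simp only [Function.comp_apply] at hρ ⊢
      gcongr

/-- On `PL` one has `1 ≤ 2 ε_L⁻⁴ domFun`, and the Riemann sums of `domFun` stay bounded. -/
theorem exists_lowSum_one_le : ∃ K : ℝ, 0 ≤ K ∧ ∀ᶠ ρ in 𝓝[>] 0,
    lowSum ρ (fun _ => 1) ≤ ENNReal.ofReal (K * (epsL ρ)⁻¹ ^ 4) := by
  have h := tendsto_low_sum (f := fun _ q => ENNReal.ofReal (domFun q))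
    (g := fun q => ENNReal.ofReal (domFun q)) (C := 1) zero_le_one ?_ ?_
  · have hfin : ∫⁻ y : Space, ENNReal.ofReal (domFun ‖y‖) ≠ ⊤ := by
      rw [← ofReal_integral_eq_lintegral_ofReal integrable_domFun
        (Eventually.of_forall fun y => domFun_nonneg _)]
      exact ENNReal.ofReal_ne_top
    set I := ∫⁻ y : Space, ENNReal.ofReal (domFun ‖y‖)
    refine ⟨2 * (I.toReal + 1), by positivity, ?_⟩
    have hlt : I < ENNReal.ofReal (I.toReal + 1) := by
      rw [ENNReal.lt_ofReal_iff_toReal_lt hfin]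
      linarith
    filter_upwards [eventually_pos, eventually_lt_one, h.eventually_lt_const hlt] with ρ h0 h1 h2
    have hc := epsL_pos h0
    have hc1 := (one_le_inv₀ hc).2 (epsL_le_one h0 h1)
    calc lowSum ρ (fun _ => 1) ≤ lowSum ρ fun n => ENNReal.ofReal (domFun (relMom ρ n)) *
          ENNReal.ofReal (2 * (epsL ρ)⁻¹ ^ 4) := by
          refine lowSum_mono fun n hn => ?_
          obtain ⟨q1, q2⟩ := (mem_PL_iff h0).1 hn
          have hq : 0 < relMom ρ n := hc.trans_le q1
          rw [← ENNReal.ofReal_mul (domFun_nonneg _), ← ENNReal.ofReal_one]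
          refine ENNReal.ofReal_le_ofReal ?_
          rw [domFun, inv_mul_eq_div, le_div_iff₀ (by positivity), one_mul]
          calc relMom ρ n ^ 2 * (1 + relMom ρ n ^ 2)
              ≤ (epsL ρ)⁻¹ ^ 2 * ((epsL ρ)⁻¹ ^ 2 + (epsL ρ)⁻¹ ^ 2) := by
                gcongr
                exact one_le_pow₀ hc1
            _ = _ := by ring
      _ ≤ ENNReal.ofReal (I.toReal + 1) * ENNReal.ofReal (2 * (epsL ρ)⁻¹ ^ 4) := by
          rw [lowSum_mul_const]
          gcongr
          exact h2.le
      _ = _ := by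
          rw [← ENNReal.ofReal_mul (by positivity)]
          congr 1
          ring
  · exact Eventually.of_forall fun ρ q hq => by rw [one_mul]
  · intro q₀ hq₀ q hq
    have hc : ContinuousAt domFun q₀ := by
      unfold domFun
      have : q₀ ^ 2 * (1 + q₀ ^ 2) ≠ 0 := by positivity
      fun_prop (disch := assumption)
    exact ENNReal.tendsto_ofReal (hc.tendsto.comp hq)

/-! ### Bounds for the trial state at small density -/

/-- The rescaled sum that bounds the squared coefficients of intermediate and high momenta. -/
def highSum (g ρ : ℝ) : ℝ≥0∞ := ENNReal.ofReal (step ρ) ^ 3 *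
  ∑' n, {n | (epsL ρ)⁻¹ < relMom ρ n}.indicator
    (fun n => ENNReal.ofReal (2 * g ^ 2 * domFun (relMom ρ n))) n

theorem tendsto_highSum (g : ℝ) : Tendsto (highSum g) (𝓝[>] 0) (𝓝 0) :=
  tendsto_high_sum (by positivity)

section

variable {V w : Space → ℝ}

theorem sq_hlam_le (hV : IsPotential V) (hw : IsScatteringSolution V w) {ρ : ℝ}
    (hρ : IsDilute ρ) (h1 : ρ < 1) :
    ENNReal.ofReal (step ρ) ^ 3 * (ENNReal.ofReal (ρ ^ 2) * ∑' k, hlam V w ρ k ^ 2) ≤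
      highSum (g0 V w) ρ := by
  unfold highSum
  rw [← ENNReal.tsum_mul_left]
  gcongr with k
  by_cases hk : k ∈ PIH ρ
  · have hq := relMom_of_PIH hρ hk
    have hq1 : 1 < relMom ρ k :=
      ((one_le_inv₀ (epsL_pos hρ.pos)).2 (epsL_le_one hρ.pos h1)).trans_lt hq
    rw [Set.indicator_of_mem (show k ∈ {n | (epsL ρ)⁻¹ < relMom ρ n} from hq),
      hlam_of_mem V w hk, ← ENNReal.ofReal_pow (alam_nonneg V w ρ k),
      ← ENNReal.ofReal_mul (by positivity)]
    refine ENNReal.ofReal_le_ofReal ?_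
    have ha := alam_high_le hV hw hρ hk
    have ha0 := alam_nonneg V w ρ k
    have hρ0 := hρ.pos
    have hg := g0_nonneg hV hw
    calc ρ ^ 2 * alam V w ρ k ^ 2 = (ρ * alam V w ρ k) ^ 2 := by ring
      _ ≤ (g0 V w / relMom ρ k ^ 2) ^ 2 := by gcongr
      _ ≤ _ := by
        unfold domFun
        rw [div_pow, ← div_eq_mul_inv, div_le_div_iff₀ (by positivity) (by positivity)]
        have e : relMom ρ k ^ 2 * (1 + relMom ρ k ^ 2) ≤ 2 * (relMom ρ k ^ 2) ^ 2 := by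
          have : 1 ≤ relMom ρ k ^ 2 := one_le_pow₀ hq1.le
          nlinarith
        calc _ ≤ g0 V w ^ 2 * (2 * (relMom ρ k ^ 2) ^ 2) := by gcongr
          _ = _ := by ring
  · rw [hlam, if_neg hk]
    simp

theorem high_ratio_le (hV : IsPotential V) (hw : IsScatteringSolution V w) {ρ : ℝ}
    (hρ : IsDilute ρ) (h1 : ρ < 1) (h2 : 2 * g0 V w ≤ (epsL ρ)⁻¹) :
    ∀ k ∈ PIH ρ, ENNReal.ofReal (ρ ^ 2) * (hlam V w ρ k * hlam V w ρ (-k)) ≤ 2⁻¹ := by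
  intro k hk
  have hk' := neg_mem_PIH.2 hk
  have hq := relMom_of_PIH hρ hk
  have hq1 : 1 < relMom ρ k :=
    ((one_le_inv₀ (epsL_pos hρ.pos)).2 (epsL_le_one hρ.pos h1)).trans_lt hq
  have a1 := alam_high_le hV hw hρ hk
  have a2 := alam_high_le hV hw hρ hk'
  rw [relMom_neg] at a2
  have b1 := alam_nonneg V w ρ k
  have b2 := alam_nonneg V w ρ (-k)
  have hρ0 := hρ.pos
  have hg := g0_nonneg hV hw
  have h3 : g0 V w / relMom ρ k ^ 2 ≤ 1 / 2 := by
    rw [div_le_iff₀ (by positivity)]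
    nlinarith
  rw [hlam_of_mem V w hk, hlam_of_mem V w hk', ← ENNReal.ofReal_mul b1,
    ← ENNReal.ofReal_mul (by positivity), show (2⁻¹ : ℝ≥0∞) = ENNReal.ofReal (2⁻¹) by
      rw [ENNReal.ofReal_inv_of_pos (by norm_num)]; norm_num]
  refine ENNReal.ofReal_le_ofReal ?_
  calc ρ ^ 2 * (alam V w ρ k * alam V w ρ (-k)) = (ρ * alam V w ρ k) * (ρ * alam V w ρ (-k)) := by
        ring
    _ ≤ (1 / 2) * (1 / 2) := by
        gcongr
        · exact a1.trans h3
        · exact a2.trans h3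
    _ ≤ _ := by norm_num

/-- The conditions on the density under which the estimates for the trial state hold. -/
structure IsSmall (V w : Space → ℝ) (K ρ : ℝ) : Prop where
  dilute : IsDilute ρ
  lt_one : ρ < 1
  finite : (PL ρ).Finite
  summable : ∑' k, hlam V w ρ k ^ 2 ≠ ⊤
  ratio_le : ∀ k ∈ PIH ρ, ENNReal.ofReal (ρ ^ 2) * (hlam V w ρ k * hlam V w ρ (-k)) ≤ 2⁻¹
  sum_le : ENNReal.ofReal (step ρ) ^ 3 * (ENNReal.ofReal (ρ ^ 2) * ∑' k, hlam V w ρ k ^ 2) ≤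
    highSum (g0 V w) ρ
  high_le : highSum (g0 V w) ρ ≤ 1
  card_le : lowSum ρ (fun _ => 1) ≤ ENNReal.ofReal (K * (epsL ρ)⁻¹ ^ 4)

theorem exists_isSmall (hV : IsPotential V) (hw : IsScatteringSolution V w) :
    ∃ K : ℝ, 0 ≤ K ∧ ∀ᶠ ρ in 𝓝[>] 0, IsSmall V w K ρ := by
  obtain ⟨K, hK, hcard⟩ := exists_lowSum_one_le
  refine ⟨K, hK, ?_⟩
  filter_upwards [eventually_isDilute, eventually_lt_one, hcard,
    (tendsto_highSum (g0 V w)).eventually_lt_const one_pos,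
    tendsto_inv_epsL.eventually_ge_atTop (2 * g0 V w)] with ρ h0 h1 h2 h3 h4
  have ha : ENNReal.ofReal (step ρ) ^ 3 ≠ 0 :=
    pow_ne_zero _ (ENNReal.ofReal_pos.2 (step_pos h0.pos)).ne'
  have hs := sq_hlam_le hV hw h0 h1
  refine ⟨h0, h1, ?_, ?_, high_ratio_le hV hw h0 h1 h4, hs, h3.le, h2⟩
  · have ht : ∑' n, (PL ρ).indicator (fun _ => (1 : ℝ≥0∞)) n ≠ ⊤ := by
      intro h
      rw [lowSum, h, ENNReal.mul_top ha] at h2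
      exact absurd (top_le_iff.1 h2) ENNReal.ofReal_ne_top
    refine (ENNReal.finite_const_le_of_tsum_ne_top ht one_ne_zero).subset fun n hn => ?_
    rw [Set.mem_ofPred_eq, Set.indicator_of_mem hn]
  · intro h
    have hr : ENNReal.ofReal (ρ ^ 2) ≠ 0 := (ENNReal.ofReal_pos.2 (pow_pos h0.pos 2)).ne'
    rw [h, ENNReal.mul_top hr, ENNReal.mul_top ha, top_le_iff] at hs
    rw [hs] at h3
    exact absurd h3 (by simp)

/-- The size of the relative errors. -/
def errScale (ρ : ℝ) : ℝ := ρ ^ (1 / 2 : ℝ) * (epsL ρ)⁻¹ ^ 6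

theorem tendsto_errScale : Tendsto errScale (𝓝[>] 0) (𝓝 0) := by
  -- `47/100 = 1/2 - 6/200`.
  refine (tendsto_rpow_zero (s := 47 / 100) (by norm_num)).congr' ?_
  filter_upwards [eventually_pos] with ρ h0
  unfold errScale epsL etaExp
  rw [← Real.rpow_neg h0.le, ← Real.rpow_natCast, ← Real.rpow_mul h0.le, ← Real.rpow_add h0]
  norm_num

theorem tendsto_ofReal_errScale (c : ℝ) :
    Tendsto (fun ρ => ENNReal.ofReal (c * errScale ρ)) (𝓝[>] 0) (𝓝 0) := by
  simpa using ENNReal.tendsto_ofReal (tendsto_errScale.const_mul c)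

namespace IsSmall

variable {K ρ : ℝ}

theorem one_le_inv (h : IsSmall V w K ρ) : 1 ≤ (epsL ρ)⁻¹ :=
  (one_le_inv₀ (epsL_pos h.dilute.pos)).2 (epsL_le_one h.dilute.pos h.lt_one)

/-- The factor `step³ ρ²` contained in the prefactor turns `∑ λ²` into a rescaled sum bounded by
one. -/
theorem softP_le (h : IsSmall V w K ρ) (kc : ℝ) (u : Mode) :
    softP V w ρ kc u ≤ ENNReal.ofReal (16 * (ρ ^ (1 / 2 : ℝ) * (epsL ρ)⁻¹)) := by
  have h0 := h.dilute.pos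
  have hv := h.dilute.vol_pos
  have hm := ceil_mCut_le h0 h.lt_one
  have hs := step_pos h0
  have hc := epsL_pos h0
  refine (BoseGas.softP_le V w kc h.dilute h.finite h.summable u).trans ?_
  have e : 4 * ⌈mCut ρ⌉₊ * ρ / vol ρ ≤
      8 * (ρ ^ (1 / 2 : ℝ) * (epsL ρ)⁻¹) * (step ρ ^ 3 * ρ ^ 2) := by
    calc 4 * ⌈mCut ρ⌉₊ * ρ / vol ρ = 4 * ⌈mCut ρ⌉₊ * (ρ * vol ρ)⁻¹ * ρ ^ 2 := by field_simp
      _ ≤ 4 * (2 * (epsL ρ)⁻¹) * (ρ ^ (1 / 2 : ℝ) * step ρ ^ 3) * ρ ^ 2 := by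
          gcongr
          exact inv_mul_vol_le h0
      _ = _ := by ring
  calc _ ≤ ENNReal.ofReal (8 * (ρ ^ (1 / 2 : ℝ) * (epsL ρ)⁻¹) * (step ρ ^ 3 * ρ ^ 2)) *
        (2 * ∑' k, hlam V w ρ k ^ 2) := by gcongr
    _ = ENNReal.ofReal (16 * (ρ ^ (1 / 2 : ℝ) * (epsL ρ)⁻¹)) *
        (ENNReal.ofReal (step ρ) ^ 3 * (ENNReal.ofReal (ρ ^ 2) * ∑' k, hlam V w ρ k ^ 2)) := by
        rw [ENNReal.ofReal_mul (by positivity), ENNReal.ofReal_mul (p := step ρ ^ 3) (by positivity),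
          ENNReal.ofReal_pow hs.le, show 16 * (ρ ^ (1 / 2 : ℝ) * (epsL ρ)⁻¹) =
            8 * (ρ ^ (1 / 2 : ℝ) * (epsL ρ)⁻¹) * 2 by ring, ENNReal.ofReal_mul (p := 8 * _)
            (by positivity), ENNReal.ofReal_ofNat]
        ring
    _ ≤ ENNReal.ofReal (16 * (ρ ^ (1 / 2 : ℝ) * (epsL ρ)⁻¹)) * 1 := by
        gcongr
        exact h.sum_le.trans h.high_le
    _ = _ := mul_one _

/-- The six powers of `ε_L⁻¹` in `errScale` are one from `m_c`, four from the number of modes and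
one from `softP`. The map `f` allows for both `u` and `-u`. -/
theorem lowSum_softP_le (h : IsSmall V w K ρ) (hK : 0 ≤ K) (kc : ℝ) {f : Mode → Mode} :
    ⌈mCut ρ⌉₊ * lowSum ρ (fun u => softP V w ρ kc (f u)) ≤ ENNReal.ofReal (32 * K * errScale ρ) := by
  have h0 := h.dilute.pos
  have hm := ceil_mCut_le h0 h.lt_one
  have hc := epsL_pos h0
  calc ⌈mCut ρ⌉₊ * lowSum ρ (fun u => softP V w ρ kc (f u))
      ≤ ⌈mCut ρ⌉₊ * lowSum ρ (fun _ => 1 * ENNReal.ofReal (16 * (ρ ^ (1 / 2 : ℝ) * (epsL ρ)⁻¹))) := by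
        gcongr
        refine lowSum_mono fun u _ => ?_
        rw [one_mul]
        exact h.softP_le kc _
    _ ≤ ENNReal.ofReal (2 * (epsL ρ)⁻¹) * (ENNReal.ofReal (K * (epsL ρ)⁻¹ ^ 4) *
        ENNReal.ofReal (16 * (ρ ^ (1 / 2 : ℝ) * (epsL ρ)⁻¹))) := by
        rw [lowSum_mul_const]
        gcongr
        · rw [← ENNReal.ofReal_natCast]
          exact ENNReal.ofReal_le_ofReal hm
        · exact h.card_le
    _ = _ := by
        rw [← ENNReal.ofReal_mul (by positivity), ← ENNReal.ofReal_mul (by positivity), errScale]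
        congr 1
        ring

theorem one_le_ceil (h : IsSmall V w K ρ) : 1 ≤ ⌈mCut ρ⌉₊ := by
  rw [Nat.one_le_ceil_iff, mCut_eq h.dilute.pos]
  exact zero_lt_one.trans_le h.one_le_inv

theorem high_occ_le (h : IsSmall V w K ρ) (hK : 0 ≤ K) (kc : ℝ) :
    ENNReal.ofReal (step ρ) ^ 3 * ∑' k : PIH ρ, occ V w ρ kc k ≤
      4 * highSum (g0 V w) ρ + 2 * ENNReal.ofReal (32 * K * errScale ρ) := by
  have h1 : (1 : ℝ≥0∞) ≤ ⌈mCut ρ⌉₊ := by exact_mod_cast h.one_le_ceil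
  calc _ ≤ ENNReal.ofReal (step ρ) ^ 3 *
        (4 * (ENNReal.ofReal (ρ ^ 2) * ∑' k, hlam V w ρ k ^ 2) +
          2 * ∑ u ∈ h.finite.toFinset, softP V w ρ kc u) := by
        gcongr
        exact tsum_occ_high_le V w kc h.dilute h.finite h.summable h.ratio_le
    _ = 4 * (ENNReal.ofReal (step ρ) ^ 3 * (ENNReal.ofReal (ρ ^ 2) * ∑' k, hlam V w ρ k ^ 2)) +
        2 * (1 * lowSum ρ fun u => softP V w ρ kc u) := by
        rw [lowSum_eq_sum h.finite]
        ring
    _ ≤ _ := by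
        gcongr
        · exact h.sum_le
        · exact (mul_le_mul' h1 le_rfl).trans (h.lowSum_softP_le hK kc (f := id))

theorem lowOcc_le_bogDist (hg : 0 ≤ g0 V w) (h : IsSmall V w K ρ) (kc : ℝ) {u : Mode}
    (hu : u ∈ PL ρ) :
    lowOcc V w ρ kc u ≤ ENNReal.ofReal (bogDist (4 * g0 V w) (relMom ρ u)) := by
  have hb : 0 ≤ 4 * g0 V w := by positivity
  have h1 := lowOcc_le V w kc h.dilute h.finite h.summable hu
  have hfin : lowOcc V w ρ kc u ≠ ⊤ :=
    ne_top_of_le_ne_top (occ_ne_top V w kc h.dilute h.finite h.summable u)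
      (lowOcc_le_occ V w ρ kc u)
  rw [ratio_low h.dilute.pos hu] at h1
  have hr0 := bogRatio_nonneg (4 * g0 V w) (relMom ρ u)
  have hr1 := bogRatio_lt_one hb (relMom ρ u)
  rw [bogDist_eq hb]
  rw [← ENNReal.ofReal_toReal hfin] at h1 ⊢
  set x := (lowOcc V w ρ kc u).toReal
  have hx : 0 ≤ x := ENNReal.toReal_nonneg
  rw [← ENNReal.ofReal_one, ← ENNReal.ofReal_add hx zero_le_one, ← ENNReal.ofReal_mul hr0,
    ENNReal.ofReal_le_ofReal_iff (by positivity)] at h1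
  refine ENNReal.ofReal_le_ofReal ?_
  rw [le_div_iff₀ (by linarith)]
  linarith

theorem low_occ_le (hg : 0 ≤ g0 V w) (h : IsSmall V w K ρ) (hK : 0 ≤ K) (kc : ℝ) :
    lowSum ρ (occ V w ρ kc) ≤
      lowSum ρ (fun n => ENNReal.ofReal (bogDist (4 * g0 V w) (relMom ρ n))) +
        2 * ENNReal.ofReal (32 * K * errScale ρ) := by
  calc lowSum ρ (occ V w ρ kc)
      ≤ lowSum ρ (fun u => ENNReal.ofReal (bogDist (4 * g0 V w) (relMom ρ u)) +
        (softP V w ρ kc u + softP V w ρ kc (-u)) * ⌈mCut ρ⌉₊) := by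
        refine lowSum_mono fun u hu => (occ_le_lowOcc_add V w kc h.dilute hu).trans ?_
        rw [mul_comm]
        gcongr
        exact h.lowOcc_le_bogDist hg kc hu
    _ = lowSum ρ (fun n => ENNReal.ofReal (bogDist (4 * g0 V w) (relMom ρ n))) +
        (⌈mCut ρ⌉₊ * lowSum ρ (fun u => softP V w ρ kc u) +
          ⌈mCut ρ⌉₊ * lowSum ρ (fun u => softP V w ρ kc (-u))) := by
        rw [lowSum_add, lowSum_mul_const, lowSum_add]
        ring
    _ ≤ _ := by
        rw [two_mul]
        gcongr
        · exact h.lowSum_softP_le hK kc (f := id)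
        · exact h.lowSum_softP_le hK kc

/-- `le_lowOcc` divided by `1 - r`, with `r/(1-r)` recognized as `bogDist`; this makes the errors
relative to `bogDist`. -/
theorem bogDist_le_occ (hg : 0 ≤ g0 V w) (h : IsSmall V w K ρ) (kc : ℝ) {u : Mode}
    (hu : u ∈ PL ρ) :
    ENNReal.ofReal (bogDist (4 * g0 V w) (relMom ρ u)) ≤ occ V w ρ kc u +
      (ENNReal.ofReal (bogDist (4 * g0 V w) (relMom ρ u) *
        ((⌈mCut ρ⌉₊ + 1) * bogRatio (4 * g0 V w) (relMom ρ u) ^ ⌈mCut ρ⌉₊)) +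
      ENNReal.ofReal (bogDist (4 * g0 V w) (relMom ρ u)) * (⌈mCut ρ⌉₊ * depletion V w ρ kc +
        (softP V w ρ kc u + softP V w ρ kc (-u)))) := by
  have hb : 0 ≤ 4 * g0 V w := by positivity
  have h1 := le_lowOcc V w kc h.dilute h.finite h.summable hu
  have hfin : lowOcc V w ρ kc u ≠ ⊤ :=
    ne_top_of_le_ne_top (occ_ne_top V w kc h.dilute h.finite h.summable u)
      (lowOcc_le_occ V w ρ kc u)
  refine le_trans ?_ (add_le_add_left (lowOcc_le_occ V w ρ kc u) _)
  rw [ratio_low h.dilute.pos hu] at h1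
  have hr0 := bogRatio_nonneg (4 * g0 V w) (relMom ρ u)
  have hr1 := bogRatio_lt_one hb (relMom ρ u)
  have hd0 := bogDist_nonneg hb (relMom ρ u)
  set Z := ⌈mCut ρ⌉₊ * depletion V w ρ kc + (softP V w ρ kc u + softP V w ρ kc (-u)) with hZdef
  set m := ⌈mCut ρ⌉₊
  have hde := bogDist_eq hb (relMom ρ u)
  set d := bogDist (4 * g0 V w) (relMom ρ u)
  set r := bogRatio (4 * g0 V w) (relMom ρ u)
  rw [add_assoc ((m + 1 : ℝ≥0∞) * _), ← hZdef] at h1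
  by_cases hZ : Z = ⊤
  · rcases hd0.eq_or_lt with hd | hd
    · rw [← hd]; simp
    · rw [hZ, ENNReal.mul_top (ENNReal.ofReal_pos.2 hd).ne']
      simp
  rw [← ENNReal.ofReal_toReal hfin, ← ENNReal.ofReal_toReal hZ] at h1 ⊢
  set x := (lowOcc V w ρ kc u).toReal
  set z := Z.toReal
  have hx : 0 ≤ x := ENNReal.toReal_nonneg
  have hz : 0 ≤ z := ENNReal.toReal_nonneg
  have hm : ((m : ℝ≥0∞) + 1) = ENNReal.ofReal (m + 1) := by
    rw [ENNReal.ofReal_add (Nat.cast_nonneg _) zero_le_one, ENNReal.ofReal_natCast,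
      ENNReal.ofReal_one]
  rw [hm, ← ENNReal.ofReal_pow hr0, ← ENNReal.ofReal_mul (by positivity),
    ← ENNReal.ofReal_add (by positivity) hz, ← ENNReal.ofReal_mul hr0,
    ← ENNReal.ofReal_add hx (by positivity), ← ENNReal.ofReal_one,
    ← ENNReal.ofReal_add hx zero_le_one, ← ENNReal.ofReal_mul hr0,
    ENNReal.ofReal_le_ofReal_iff (by positivity)] at h1
  rw [← ENNReal.ofReal_mul hd0, ← ENNReal.ofReal_add (by positivity) (by positivity),
    ← ENNReal.ofReal_add hx (by positivity)]
  refine ENNReal.ofReal_le_ofReal ?_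
  have hd : d * (1 - r) = r := by
    rw [hde, div_mul_cancel₀]
    linarith
  have h2 : d * (1 - r) ≤ (x + (d * ((m + 1) * r ^ m) + d * z)) * (1 - r) := by
    rw [add_mul, ← mul_add, mul_assoc, mul_comm ((m + 1) * r ^ m + z), ← mul_assoc, hd]
    linarith
  exact le_of_mul_le_mul_right h2 (by linarith)

theorem depletion_le (h : IsSmall V w K ρ) (kc : ℝ) :
    ⌈mCut ρ⌉₊ * depletion V w ρ kc ≤ ENNReal.ofReal (2 * errScale ρ) *
      (2 * (lowSum ρ (occ V w ρ kc) + ENNReal.ofReal (step ρ) ^ 3 *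
        ∑' k : PIH ρ, occ V w ρ kc k) + 3 * ENNReal.ofReal (step ρ) ^ 3) := by
  have h0 := h.dilute.pos
  have hs := step_pos h0
  have hc := epsL_pos h0
  have hv := h.dilute.vol_pos
  have hm := ceil_mCut_le h0 h.lt_one
  have e : (⌈mCut ρ⌉₊ : ℝ≥0∞) * ENNReal.ofReal (ρ * vol ρ)⁻¹ ≤
      ENNReal.ofReal (2 * errScale ρ) * ENNReal.ofReal (step ρ) ^ 3 := by
    rw [← ENNReal.ofReal_natCast, ← ENNReal.ofReal_mul (Nat.cast_nonneg _),
      ← ENNReal.ofReal_pow hs.le, ← ENNReal.ofReal_mul (by unfold errScale; positivity)]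
    refine ENNReal.ofReal_le_ofReal ?_
    have h6 : (epsL ρ)⁻¹ ≤ (epsL ρ)⁻¹ ^ 6 := le_self_pow₀ h.one_le_inv (by norm_num)
    calc (⌈mCut ρ⌉₊ : ℝ) * (ρ * vol ρ)⁻¹
        ≤ (2 * (epsL ρ)⁻¹ ^ 6) * (ρ ^ (1 / 2 : ℝ) * step ρ ^ 3) := by
          gcongr
          · linarith
          · exact inv_mul_vol_le h0
      _ = _ := by unfold errScale; ring
  calc _ ≤ ⌈mCut ρ⌉₊ * (ENNReal.ofReal (ρ * vol ρ)⁻¹ *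
      (2 * (∑ u ∈ h.finite.toFinset, occ V w ρ kc u + ∑' k : PIH ρ, occ V w ρ kc k) + 3)) := by
        gcongr
        exact BoseGas.depletion_le V w kc h.dilute h.finite h.summable
    _ = (⌈mCut ρ⌉₊ * ENNReal.ofReal (ρ * vol ρ)⁻¹) *
      (2 * (∑ u ∈ h.finite.toFinset, occ V w ρ kc u + ∑' k : PIH ρ, occ V w ρ kc k) + 3) := by
        ring
    _ ≤ (ENNReal.ofReal (2 * errScale ρ) * ENNReal.ofReal (step ρ) ^ 3) *
      (2 * (∑ u ∈ h.finite.toFinset, occ V w ρ kc u + ∑' k : PIH ρ, occ V w ρ kc k) + 3) := by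
        gcongr
    _ = _ := by
        rw [lowSum_eq_sum h.finite]
        ring

theorem lowSum_bogDist_le (hg : 0 ≤ g0 V w) (h : IsSmall V w K ρ) (kc : ℝ) :
    lowSum ρ (fun n => ENNReal.ofReal (bogDist (4 * g0 V w) (relMom ρ n))) ≤
      lowSum ρ (occ V w ρ kc) +
      (lowSum ρ (fun n => ENNReal.ofReal (bogDist (4 * g0 V w) (relMom ρ n) *
        ((⌈mCut ρ⌉₊ + 1) * bogRatio (4 * g0 V w) (relMom ρ n) ^ ⌈mCut ρ⌉₊))) +
      lowSum ρ (fun n => ENNReal.ofReal (bogDist (4 * g0 V w) (relMom ρ n))) *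
        (⌈mCut ρ⌉₊ * depletion V w ρ kc + 2 * ENNReal.ofReal (16 * errScale ρ))) := by
  have h0 := h.dilute.pos
  have hc := epsL_pos h0
  have hs : ∀ u, softP V w ρ kc u ≤ ENNReal.ofReal (16 * errScale ρ) := fun u => by
    refine (h.softP_le kc u).trans (ENNReal.ofReal_le_ofReal ?_)
    unfold errScale
    gcongr
    exact le_self_pow₀ h.one_le_inv (by norm_num)
  rw [← lowSum_mul_const, ← lowSum_add, ← lowSum_add]
  refine lowSum_mono fun u hu => (h.bogDist_le_occ hg kc hu).trans ?_
  rw [two_mul]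
  gcongr
  · exact hs u
  · exact hs (-u)

end IsSmall

/-! ### The limits -/

theorem tendsto_high_occ (hV : IsPotential V) (hw : IsScatteringSolution V w) (kc : ℝ) :
    Tendsto (fun ρ => ENNReal.ofReal (step ρ) ^ 3 * ∑' k : PIH ρ, occ V w ρ kc k) (𝓝[>] 0)
      (𝓝 0) := by
  obtain ⟨K, hK, hsmall⟩ := exists_isSmall hV hw
  have hlim : Tendsto (fun ρ => 4 * highSum (g0 V w) ρ + 2 * ENNReal.ofReal (32 * K * errScale ρ))
      (𝓝[>] 0) (𝓝 0) := by
    have h1 := ENNReal.Tendsto.const_mul (a := 4) (tendsto_highSum (g0 V w)) (Or.inr (by simp))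
    have h2 := ENNReal.Tendsto.const_mul (a := 2) (tendsto_ofReal_errScale (32 * K))
      (Or.inr (by simp))
    simpa using h1.add h2
  refine tendsto_of_tendsto_of_tendsto_of_le_of_le' tendsto_const_nhds hlim
    (Eventually.of_forall fun _ => zero_le) ?_
  filter_upwards [hsmall] with ρ h using h.high_occ_le hK kc

/-- A squeeze. There is no circularity: the upper bound is free of the depletion, it then bounds the
depletion, and that enters the lower bound only. -/
theorem tendsto_low_occ (hV : IsPotential V) (hw : IsScatteringSolution V w) (kc : ℝ) :
    Tendsto (fun ρ => lowSum ρ (occ V w ρ kc)) (𝓝[>] 0)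
      (𝓝 (ENNReal.ofReal (Real.pi / 3 * √(4 * g0 V w) ^ 3))) := by
  obtain ⟨K, hK, hsmall⟩ := exists_isSmall hV hw
  have hg := g0_nonneg hV hw
  have hb : 0 ≤ 4 * g0 V w := by positivity
  have hA := tendsto_lowSum_bogDist hb
  have hB := tendsto_lowSum_tail hb
  have hH := tendsto_high_occ hV hw kc
  have hE := fun c => tendsto_ofReal_errScale c
  set A := fun ρ => lowSum ρ fun n => ENNReal.ofReal (bogDist (4 * g0 V w) (relMom ρ n))
  set L := ENNReal.ofReal (Real.pi / 3 * √(4 * g0 V w) ^ 3)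
  have hL : L ≠ ⊤ := ENNReal.ofReal_ne_top
  have hup : Tendsto (fun ρ => A ρ + 2 * ENNReal.ofReal (32 * K * errScale ρ)) (𝓝[>] 0) (𝓝 L) := by
    simpa using hA.add (ENNReal.Tendsto.const_mul (a := 2) (hE (32 * K)) (Or.inr (by simp)))
  have hstep : Tendsto (fun ρ => ENNReal.ofReal (step ρ) ^ 3) (𝓝[>] 0) (𝓝 0) := by
    have := (ENNReal.continuous_pow 3).tendsto _ |>.comp (ENNReal.tendsto_ofReal tendsto_step)
    simpa [Function.comp_def] using this
  have hdep : Tendsto (fun ρ => ENNReal.ofReal (2 * errScale ρ) *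
      (2 * ((A ρ + 2 * ENNReal.ofReal (32 * K * errScale ρ)) + ENNReal.ofReal (step ρ) ^ 3 *
        ∑' k : PIH ρ, occ V w ρ kc k) + 3 * ENNReal.ofReal (step ρ) ^ 3)) (𝓝[>] 0) (𝓝 0) := by
    have h1 := (ENNReal.Tendsto.const_mul (a := 2) (hup.add hH) (Or.inr (by simp))).add
      (ENNReal.Tendsto.const_mul (a := 3) hstep (Or.inr (by simp)))
    have h2 := ENNReal.Tendsto.mul (hE 2) (Or.inr (by simp [hL, ENNReal.mul_eq_top])) h1
      (Or.inr (by simp))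
    simpa using h2
  have herr : Tendsto (fun ρ => lowSum ρ (fun n => ENNReal.ofReal
      (bogDist (4 * g0 V w) (relMom ρ n) *
        ((⌈mCut ρ⌉₊ + 1) * bogRatio (4 * g0 V w) (relMom ρ n) ^ ⌈mCut ρ⌉₊))) +
      A ρ * (ENNReal.ofReal (2 * errScale ρ) *
      (2 * ((A ρ + 2 * ENNReal.ofReal (32 * K * errScale ρ)) + ENNReal.ofReal (step ρ) ^ 3 *
        ∑' k : PIH ρ, occ V w ρ kc k) + 3 * ENNReal.ofReal (step ρ) ^ 3) +
        2 * ENNReal.ofReal (16 * errScale ρ))) (𝓝[>] 0) (𝓝 0) := by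
    have h1 := hdep.add (ENNReal.Tendsto.const_mul (a := 2) (hE 16) (Or.inr (by simp)))
    have h2 := ENNReal.Tendsto.mul hA (Or.inr (by simp)) h1 (Or.inr hL)
    simpa using hB.add h2
  have hlow := ENNReal.Tendsto.sub hA herr (Or.inl hL)
  rw [tsub_zero] at hlow
  refine tendsto_of_tendsto_of_tendsto_of_le_of_le' hlow hup ?_ ?_
  · filter_upwards [hsmall] with ρ h
    rw [tsub_le_iff_right]
    refine (h.lowSum_bogDist_le hg kc).trans ?_
    refine add_le_add le_rfl (add_le_add le_rfl (mul_le_mul' le_rfl (add_le_add ?_ le_rfl)))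
    refine (h.depletion_le kc).trans ?_
    gcongr
    exact h.low_occ_le hg hK kc
  · filter_upwards [hsmall] with ρ h using h.low_occ_le hg hK kc

theorem scaled_tsum_Q {K ρ : ℝ} (h : IsSmall V w K ρ) (kc : ℝ) (S : Set Mode) :
    ρ ^ (-(3 / 2) : ℝ) * (vol ρ)⁻¹ * ∑' u : S, Q V w ρ kc u =
      ((2 * Real.pi) ^ 3)⁻¹ *
        (ENNReal.ofReal (step ρ) ^ 3 * ∑' u : S, occ V w ρ kc u).toReal := by
  have hs := step_pos h.dilute.pos
  rw [normalization_eq h.dilute.pos, ENNReal.toReal_mul, ENNReal.toReal_pow,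
    ENNReal.toReal_ofReal hs.le, ENNReal.tsum_toReal_eq fun u : S =>
      occ_ne_top V w kc h.dilute h.finite h.summable u, mul_assoc]
  congr 2
  exact tsum_congr fun u => (summable_Q V w kc h.dilute h.finite h.summable u).2

theorem summable_Q_high {K ρ : ℝ} (h : IsSmall V w K ρ) (hK : 0 ≤ K) (kc : ℝ) :
    Summable fun u : PIH ρ => Q V w ρ kc u := by
  have ha : ENNReal.ofReal (step ρ) ^ 3 ≠ 0 :=
    pow_ne_zero _ (ENNReal.ofReal_pos.2 (step_pos h.dilute.pos)).ne'
  have hne : ∑' k : PIH ρ, occ V w ρ kc k ≠ ⊤ := by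
    intro ht
    have h1 := h.high_occ_le hK kc
    rw [ht, ENNReal.mul_top ha, top_le_iff] at h1
    have h2 : highSum (g0 V w) ρ ≠ ⊤ := ne_top_of_le_ne_top ENNReal.one_ne_top h.high_le
    exact ENNReal.add_ne_top.2 ⟨ENNReal.mul_ne_top (by simp) h2,
      ENNReal.mul_ne_top (by simp) ENNReal.ofReal_ne_top⟩ h1
  exact (ENNReal.summable_toReal hne).congr fun u =>
    (summable_Q V w kc h.dilute h.finite h.summable u).2.symm

theorem tendsto_scaled_tsum_Q (hV : IsPotential V) (hw : IsScatteringSolution V w) (kc : ℝ)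
    {S : ℝ → Set Mode} {L : ℝ≥0∞} (hL : L ≠ ⊤)
    (h : Tendsto (fun ρ => ENNReal.ofReal (step ρ) ^ 3 * ∑' u : S ρ, occ V w ρ kc u) (𝓝[>] 0)
      (𝓝 L)) :
    Tendsto (fun ρ => ρ ^ (-(3 / 2) : ℝ) * (vol ρ)⁻¹ * ∑' u : S ρ, Q V w ρ kc u) (𝓝[>] 0)
      (𝓝 (((2 * Real.pi) ^ 3)⁻¹ * L.toReal)) := by
  obtain ⟨K, -, hsmall⟩ := exists_isSmall hV hw
  refine (((ENNReal.tendsto_toReal hL).comp h).const_mul _).congr' ?_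
  filter_upwards [hsmall] with ρ hρ using (scaled_tsum_Q hρ kc (S ρ)).symm

theorem limit_value {g : ℝ} (hg : 0 ≤ g) :
    ((2 * Real.pi) ^ 3)⁻¹ * (ENNReal.ofReal (Real.pi / 3 * √(4 * g) ^ 3)).toReal =
      1 / (3 * Real.pi ^ 2) * g ^ (3 / 2 : ℝ) := by
  have hpi := Real.pi_pos
  have h : g ^ (3 / 2 : ℝ) = √g ^ 3 := by
    rw [Real.sqrt_eq_rpow, ← Real.rpow_natCast, ← Real.rpow_mul hg]
    norm_num
  have h4 : √(4 * g) = 2 * √g := by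
    rw [Real.sqrt_mul (by norm_num), show (4 : ℝ) = 2 ^ 2 by norm_num, Real.sqrt_sq (by norm_num)]
  rw [ENNReal.toReal_ofReal (by positivity), h, h4]
  field_simp

end

end BoseGas

end

theorem theorem4 (V w : BoseGas.Space → ℝ) (hV : BoseGas.IsPotential V)
    (hw : BoseGas.IsScatteringSolution V w) :
    -- the trial state is well defined and normalized, and the sums below converge
    (∀ kc : ℝ, ∀ᶠ ρ in 𝓝[>] (0 : ℝ),
      HasSum (fun α : BoseGas.M ρ kc => ‖BoseGas.coeff V w ρ kc α‖ ^ 2) 1 ∧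
      (∀ u : BoseGas.Mode, Summable fun α : BoseGas.M ρ kc =>
        ((α : BoseGas.Config) u : ℝ) * ‖BoseGas.coeff V w ρ kc α‖ ^ 2) ∧
      (BoseGas.PL ρ).Finite ∧
      Summable fun u : ↥(BoseGas.PI ρ ∪ BoseGas.PH ρ) => BoseGas.Q V w ρ kc u) ∧
    -- intermediate and high momenta
    BoseGas.IteratedLimit
      (fun kc ρ => ρ ^ (-(3 / 2) : ℝ) * (BoseGas.vol ρ)⁻¹ *
        ∑' u : ↥(BoseGas.PI ρ ∪ BoseGas.PH ρ), BoseGas.Q V w ρ kc u) 0 ∧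
    -- low momenta
    BoseGas.IteratedLimit
      (fun kc ρ => ρ ^ (-(3 / 2) : ℝ) * (BoseGas.vol ρ)⁻¹ *
        ∑' u : ↥(BoseGas.PL ρ), BoseGas.Q V w ρ kc u)
      (1 / (3 * Real.pi ^ 2) * BoseGas.g0 V w ^ (3 / 2 : ℝ)) := by
  have hg := BoseGas.g0_nonneg hV hw
  -- Both inner limits are the same for every `kc`, so the outer limits are those of constants.
  refine ⟨fun kc => ?_, ⟨fun _ => 0, ?_, tendsto_const_nhds⟩, ⟨_, ?_, tendsto_const_nhds⟩⟩
  · obtain ⟨K, hK, hsmall⟩ := BoseGas.exists_isSmall hV hw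
    filter_upwards [hsmall] with ρ h
    exact ⟨BoseGas.hasSum_coeff V w kc h.dilute h.finite h.summable,
      fun u => (BoseGas.summable_Q V w kc h.dilute h.finite h.summable u).1, h.finite,
      BoseGas.summable_Q_high h hK kc⟩
  · refine Eventually.of_forall fun kc => ?_
    have h := BoseGas.tendsto_scaled_tsum_Q hV hw kc (S := BoseGas.PIH) ENNReal.zero_ne_top
      (BoseGas.tendsto_high_occ hV hw kc)
    rw [ENNReal.toReal_zero, mul_zero] at h
    exact h
  · refine Eventually.of_forall fun kc => ?_
    have h := BoseGas.tendsto_low_occ hV hw kc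
    unfold BoseGas.lowSum at h
    simp_rw [← tsum_subtype] at h
    rw [← BoseGas.limit_value hg]
    exact BoseGas.tendsto_scaled_tsum_Q hV hw kc ENNReal.ofReal_ne_top h
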